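/- Let $n\ge 1$, $\mathbb{T}^n=\mathbb{R}^n/(2\pi\mathbb{Z})^n$, $T>0$, $\alpha\in(0,T/2)$ and $\bar m=1/\mathrm{vol}(\mathbb{T}^n)$. Let $\mathbb{P}f=f-\bar m\int_{\mathbb{T}^n}f$, and set $\beta(s)=2\alpha s/T$ for $s\in[0,T/2]$ and $\beta(s)=2\alpha-2\alpha s/T$ for $s\in[T/2,T]$. For $j\in\mathbb{N}$ let $B^j$ be the space of continuous $f:\mathbb{T}^n\to\mathbb{R}$ with $$|f|_{B^j}=\sum_{k\in\mathbb{Z}^n}(1+|k|^j)|\hat f(k)|<\infty,$$ and let $\mathcal{B}_\alpha^j$ be the space of $f\in C([0,T];B^j)$ with $$\|f\|_{\mathcal{B}_\alpha^j}=\sum_{k\in\mathbb{Z}^n}\sup_{t\in[0,T]}(1+|k|^j)e^{\beta(t)|k|}|\hat f(t,k)|<\infty .$$ Let $\mathcal{H}:[0,T]\times\mathbb{T}^n\times\mathbb{R}^n\times\mathbb{R}\to\mathbb{R}$, $(t,x,p,m)\mapsto\mathcal{H}(t,x,p,m)$, be continuous, and differentiable in $p$ with gradient $\mathcal{H}_p$.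 Let $G$ be an operator that sends functions on $\mathbb{T}^n$ to functions on $\mathbb{T}^n$, and let $b\in\mathcal{B}_\alpha^0$. Put $\tilde G(a)=\mathbb{P}\,G(a+\bar m)$ and, for $w,\mu\in\mathcal{B}_\alpha^2$, $$\Theta(\cdot,\cdot,Dw,\mu)=\mathcal{H}_p(\cdot,\cdot,Dw,\mu+\bar m),\qquad \Upsilon(\cdot,\cdot,Dw,\mu)=\mathbb{P}\,\mathcal{H}(\cdot,\cdot,Dw,\mu+\bar m)-b\mu .$$ Assume: (A1) $\tilde G(0)=0$, and there are $c,\epsilon>0$ such that $\tilde G(a)\in B^2$ whenever $|a|_{B^2}<\epsilon$, and $|\tilde G(a_1)-\tilde G(a_2)|_{B^2}\le c|a_1-a_2|_{B^2}$ whenever $|a_1|_{B^2},|a_2|_{B^2}<\epsilon$. (A2) $\Upsilon(\cdot,\cdot,0,0)=0$ and $\Theta(\cdot,\cdot,0,0)=0$. For all $w,\mu\in\mathcal{B}_\alpha^2$ we have $\Theta(\cdot,\cdot,Dw,\mu)\in(\mathcal{B}_\alpha^1)^n$ and $\mathbb{P}\Upsilon(\cdot,\cdot,Dw,\mu)\in\mathcal{B}_\alpha^0$.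 There are continuous functions $\Phi_1,\Phi_2:(\mathcal{B}_\alpha^2)^4\to\mathbb{R}$, both tending to $0$ at the origin, such that for all $w_1,w_2,\mu_1,\mu_2\in\mathcal{B}_\alpha^2$ $$\|\Theta(\cdot,\cdot,Dw_1,\mu_1)-\Theta(\cdot,\cdot,Dw_2,\mu_2)\|_{(\mathcal{B}_\alpha^1)^n}\le\Phi_1(w_1,w_2,\mu_1,\mu_2)\left(\|Dw_1-Dw_2\|_{(\mathcal{B}_\alpha^1)^n}+\|\mu_1-\mu_2\|_{\mathcal{B}_\alpha^2}\right),$$ $$\|\mathbb{P}\Upsilon(\cdot,\cdot,Dw_1,\mu_1)-\mathbb{P}\Upsilon(\cdot,\cdot,Dw_2,\mu_2)\|_{\mathcal{B}_\alpha^0}\le\Phi_2(w_1,w_2,\mu_1,\mu_2)\left(\|Dw_1-Dw_2\|_{(\mathcal{B}_\alpha^1)^n}+\|\mu_1-\mu_2\|_{\mathcal{B}_\alpha^2}\right).$$ Then there are $\delta>0$ and $r>0$ such that for every probability measure with density $m_0$ on $\mathbb{T}^n$ with $|m_0-\bar m|_{B^2}<\delta$, the problem $$u_t+\Delta u+\mathcal{H}(t,x,Du,m)=0,\qquad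 m_t-\Delta m+\mathrm{div}\big(m\,\mathcal{H}_p(t,x,Du,m)\big)=0,$$ $$m(0,\cdot)=m_0,\qquad u(T,\cdot)=G(m(T,\cdot))$$ has a strong solution $(u,m)\in(\mathcal{B}_\alpha^2)^2$ with $\|\mathbb{P}u\|_{\mathcal{B}_\alpha^2}+\|m-\bar m\|_{\mathcal{B}_\alpha^2}<r$ (the derivatives exist and the equations hold at every point of $(0,T)\times\mathbb{T}^n$), and it is the only strong solution in $(\mathcal{B}_\alpha^2)^2$ that satisfies this bound. Moreover, for every $t\in(0,T)$, $u(t,\cdot)$ and $m(t,\cdot)$ are real analytic and $m(t,\cdot)$ is the density of a probability measure. -/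

import Mathlib

noncomputable section

namespace MFG

/-- `ℝⁿ`. A function on the torus `𝕋ⁿ = ℝⁿ / (2πℤ)ⁿ` is represented by a function on `ℝⁿ` that is
`2π`-periodic in each coordinate. -/
abbrev Euc (n : ℕ) : Type := EuclideanSpace ℝ (Fin n)

/-- `2π`-periodicity in each coordinate. -/
def TorusPeriodic {n : ℕ} (f : Euc n → ℝ) : Prop :=
  ∀ (i : Fin n) (x : Euc n), f (x + EuclideanSpace.single i (2 * Real.pi)) = f x

/-- A fundamental cell of the torus. -/
def cell (n : ℕ) : Set (Euc n) := {x | ∀ i, x i ∈ Set.Ioc (0 : ℝ) (2 * Real.pi)}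

/-- `m̄ = 1 / vol(𝕋ⁿ)`. -/
def mBar (n : ℕ) : ℝ := 1 / (2 * Real.pi) ^ n

/-- The spatial mean. -/
def mean {n : ℕ} (f : Euc n → ℝ) : ℝ := mBar n * ∫ x in cell n, f x

/-- The projection `ℙ`, which removes the spatial mean. -/
def proj {n : ℕ} (f : Euc n → ℝ) : Euc n → ℝ := fun x => f x - mean f

/-- The Fourier coefficient of `f` at `k ∈ ℤⁿ`, normalized so that `f = ∑ f̂(k) e^{i k·x}`. -/
def torusCoeff {n : ℕ} (f : Euc n → ℝ) (k : Fin n → ℤ) : ℂ :=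
  (mBar n : ℂ) * ∫ x in cell n,
    (f x : ℂ) * Complex.exp (-(Complex.I * ((∑ i, (k i : ℝ) * x i : ℝ) : ℂ)))

/-- The Euclidean length `|k|`. -/
def freqNorm {n : ℕ} (k : Fin n → ℤ) : ℝ := Real.sqrt (∑ i, (k i : ℝ) ^ 2)

/-- `∑ₖ (1 + |k|ʲ) |f̂(k)|`, with values in `[0, ∞]`. -/
def bENorm {n : ℕ} (j : ℕ) (f : Euc n → ℝ) : ENNReal :=
  ∑' k : Fin n → ℤ, ENNReal.ofReal ((1 + freqNorm k ^ j) * ‖torusCoeff f k‖)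

/-- The space `Bʲ`. -/
def MemB {n : ℕ} (j : ℕ) (f : Euc n → ℝ) : Prop :=
  Continuous f ∧ TorusPeriodic f ∧ bENorm j f < ⊤

/-- The norm of `Bʲ`. -/
def bNorm {n : ℕ} (j : ℕ) (f : Euc n → ℝ) : ℝ := (bENorm j f).toReal

/-- The weight `β : [0, T] → [0, α]`. -/
def weight (T α s : ℝ) : ℝ :=
  if s ≤ T / 2 then 2 * α * s / T else 2 * α - 2 * α * s / T

/-- `∑ₖ sup_{t ∈ [0,T]} (1 + |k|ʲ) e^{β(t)|k|} |f̂(t,k)|`, with values in `[0, ∞]`. -/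
def stENorm {n : ℕ} (T α : ℝ) (j : ℕ) (f : ℝ → Euc n → ℝ) : ENNReal :=
  ∑' k : Fin n → ℤ, ⨆ t ∈ Set.Icc (0 : ℝ) T,
    ENNReal.ofReal
      ((1 + freqNorm k ^ j) * Real.exp (weight T α t * freqNorm k) * ‖torusCoeff (f t) k‖)

/-- The space `𝓑_αʲ`: functions in `C([0,T]; Bʲ)` with finite weighted norm. Values at times outside
`[0,T]` play no role. -/
def MemST {n : ℕ} (T α : ℝ) (j : ℕ) (f : ℝ → Euc n → ℝ) : Prop :=
  (∀ t ∈ Set.Icc (0 : ℝ) T, MemB j (f t)) ∧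
  (∀ t ∈ Set.Icc (0 : ℝ) T, Filter.Tendsto (fun s => bENorm j (fun x => f s x - f t x))
    (nhdsWithin t (Set.Icc (0 : ℝ) T)) (nhds 0)) ∧
  stENorm T α j f < ⊤

/-- The norm of `𝓑_αʲ`. -/
def stNorm {n : ℕ} (T α : ℝ) (j : ℕ) (f : ℝ → Euc n → ℝ) : ℝ := (stENorm T α j f).toReal

/-- The norm of `(𝓑_αʲ)ⁿ`. -/
def stVecNorm {n : ℕ} (T α : ℝ) (j : ℕ) (F : ℝ → Euc n → Euc n) : ℝ :=
  ∑ i, stNorm T α j (fun t x => F t x i)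

/-- Distance in `𝓑_αʲ`. -/
def stDist {n : ℕ} (T α : ℝ) (j : ℕ) (f g : ℝ → Euc n → ℝ) : ℝ :=
  stNorm T α j (fun t x => f t x - g t x)

/-- The spatial gradient of a space-time function. -/
def spaceGrad {n : ℕ} (f : ℝ → Euc n → ℝ) : ℝ → Euc n → Euc n := fun t x => gradient (f t) x

/-- The divergence of a vector field on `ℝⁿ`. -/
def divergence {n : ℕ} (F : Euc n → Euc n) (x : Euc n) : ℝ :=
  ∑ i, fderiv ℝ (fun y => F y i) x (EuclideanSpace.single i 1)

/-- A Hamiltonian `𝓗(t,x,p,m)` on `[0,T] × 𝕋ⁿ × ℝⁿ × ℝ`: continuous, and differentiable in `p`. -/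
structure IsHamiltonian {n : ℕ} (T : ℝ) (H : ℝ → Euc n → Euc n → ℝ → ℝ) : Prop where
  continuousOn : ContinuousOn
    (fun z : ℝ × Euc n × Euc n × ℝ => H z.1 z.2.1 z.2.2.1 z.2.2.2)
    (Set.Icc (0 : ℝ) T ×ˢ Set.univ)
  differentiable : ∀ t ∈ Set.Icc (0 : ℝ) T, ∀ (x : Euc n) (m : ℝ),
    Differentiable ℝ (fun p => H t x p m)
  periodic : ∀ t ∈ Set.Icc (0 : ℝ) T, ∀ (p : Euc n) (m : ℝ), TorusPeriodic (fun x => H t x p m)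

/-- `𝓗_p(t,x,p,m)`. -/
def gradP {n : ℕ} (H : ℝ → Euc n → Euc n → ℝ → ℝ) (t : ℝ) (x p : Euc n) (m : ℝ) : Euc n :=
  gradient (fun q => H t x q m) p

/-- `Θ(·,·,Dw,μ) = 𝓗_p(·,·,Dw,μ + m̄)`. -/
def Theta {n : ℕ} (H : ℝ → Euc n → Euc n → ℝ → ℝ) (w μ : ℝ → Euc n → ℝ) :
    ℝ → Euc n → Euc n :=
  fun t x => gradP H t x (spaceGrad w t x) (μ t x + mBar n)

/-- `Ξ(·,·,Dw,μ) = ℙ 𝓗(·,·,Dw,μ + m̄)`. -/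
def Xi {n : ℕ} (H : ℝ → Euc n → Euc n → ℝ → ℝ) (w μ : ℝ → Euc n → ℝ) : ℝ → Euc n → ℝ :=
  fun t => proj (fun x => H t x (spaceGrad w t x) (μ t x + mBar n))

/-- `Υ(·,·,Dw,μ)`, defined by `Ξ = b μ + Υ`. -/
def Upsilon {n : ℕ} (H : ℝ → Euc n → Euc n → ℝ → ℝ) (b : ℝ → Euc n → ℝ)
    (w μ : ℝ → Euc n → ℝ) : ℝ → Euc n → ℝ :=
  fun t x => Xi H w μ t x - b t x * μ t x

/-- `G̃(a) = ℙ G(a + m̄)`. -/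
def payoffTilde {n : ℕ} (G : (Euc n → ℝ) → Euc n → ℝ) (a : Euc n → ℝ) : Euc n → ℝ :=
  proj (G (fun x => a x + mBar n))

/-- The condition on the payoff: `G̃(0) = 0`, and `G̃` is Lipschitz near the origin of `B²`. -/
def PayoffCondition {n : ℕ} (G : (Euc n → ℝ) → Euc n → ℝ) : Prop :=
  payoffTilde G 0 = 0 ∧
  ∃ c > 0, ∃ ε > 0,
    (∀ a : Euc n → ℝ, MemB 2 a → bNorm 2 a < ε → MemB 2 (payoffTilde G a)) ∧
    ∀ a₁ a₂ : Euc n → ℝ, MemB 2 a₁ → MemB 2 a₂ → bNorm 2 a₁ < ε → bNorm 2 a₂ < ε →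
      bNorm 2 (fun x => payoffTilde G a₁ x - payoffTilde G a₂ x)
        ≤ c * bNorm 2 (fun x => a₁ x - a₂ x)

/-- `Φ : (𝓑_α²)⁴ → ℝ` is continuous and tends to `0` at the origin. -/
def VanishingContinuous {n : ℕ} (T α : ℝ)
    (Φ : (ℝ → Euc n → ℝ) → (ℝ → Euc n → ℝ) → (ℝ → Euc n → ℝ) → (ℝ → Euc n → ℝ) → ℝ) : Prop :=
  (∀ w₁ w₂ μ₁ μ₂, MemST T α 2 w₁ → MemST T α 2 w₂ → MemST T α 2 μ₁ → MemST T α 2 μ₂ →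
    ∀ ε > 0, ∃ δ > 0, ∀ v₁ v₂ ν₁ ν₂,
      MemST T α 2 v₁ → MemST T α 2 v₂ → MemST T α 2 ν₁ → MemST T α 2 ν₂ →
      stDist T α 2 v₁ w₁ + stDist T α 2 v₂ w₂ + stDist T α 2 ν₁ μ₁ + stDist T α 2 ν₂ μ₂ < δ →
      |Φ v₁ v₂ ν₁ ν₂ - Φ w₁ w₂ μ₁ μ₂| < ε) ∧
  (∀ ε > 0, ∃ δ > 0, ∀ v₁ v₂ ν₁ ν₂,
      MemST T α 2 v₁ → MemST T α 2 v₂ → MemST T α 2 ν₁ → MemST T α 2 ν₂ →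
      stNorm T α 2 v₁ + stNorm T α 2 v₂ + stNorm T α 2 ν₁ + stNorm T α 2 ν₂ < δ →
      |Φ v₁ v₂ ν₁ ν₂| < ε)

/-- `‖Dw₁ - Dw₂‖_{(𝓑_α¹)ⁿ} + ‖μ₁ - μ₂‖_{𝓑_α²}`. -/
def pairDist {n : ℕ} (T α : ℝ) (w₁ w₂ μ₁ μ₂ : ℝ → Euc n → ℝ) : ℝ :=
  stVecNorm T α 1 (fun t x => spaceGrad w₁ t x - spaceGrad w₂ t x) + stDist T α 2 μ₁ μ₂

/-- The condition on the Hamiltonian: `Υ` and `Θ` vanish at zero, map into `𝓑_α⁰` (after `ℙ`) and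
`(𝓑_α¹)ⁿ`, and satisfy Lipschitz bounds with factors `Φ₁`, `Φ₂` that vanish at the origin. -/
def HamiltonianCondition {n : ℕ} (T α : ℝ) (H : ℝ → Euc n → Euc n → ℝ → ℝ)
    (b : ℝ → Euc n → ℝ) : Prop :=
  (∀ t ∈ Set.Icc (0 : ℝ) T, ∀ x, Upsilon H b 0 0 t x = 0) ∧
  (∀ t ∈ Set.Icc (0 : ℝ) T, ∀ x, Theta H 0 0 t x = 0) ∧
  (∀ w μ : ℝ → Euc n → ℝ, MemST T α 2 w → MemST T α 2 μ →
    (∀ i, MemST T α 1 (fun t x => Theta H w μ t x i)) ∧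
    MemST T α 0 (fun t => proj (Upsilon H b w μ t))) ∧
  (∃ Φ₁, VanishingContinuous T α Φ₁ ∧
    ∀ w₁ w₂ μ₁ μ₂ : ℝ → Euc n → ℝ,
      MemST T α 2 w₁ → MemST T α 2 w₂ → MemST T α 2 μ₁ → MemST T α 2 μ₂ →
      stVecNorm T α 1 (fun t x => Theta H w₁ μ₁ t x - Theta H w₂ μ₂ t x)
        ≤ Φ₁ w₁ w₂ μ₁ μ₂ * pairDist T α w₁ w₂ μ₁ μ₂) ∧
  (∃ Φ₂, VanishingContinuous T α Φ₂ ∧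
    ∀ w₁ w₂ μ₁ μ₂ : ℝ → Euc n → ℝ,
      MemST T α 2 w₁ → MemST T α 2 w₂ → MemST T α 2 μ₁ → MemST T α 2 μ₂ →
      stDist T α 0 (fun t => proj (Upsilon H b w₁ μ₁ t)) (fun t => proj (Upsilon H b w₂ μ₂ t))
        ≤ Φ₂ w₁ w₂ μ₁ μ₂ * pairDist T α w₁ w₂ μ₁ μ₂)

/-- `f` is the density of a probability measure on the torus (an integral with a nonzero value is
the integral of an integrable function). -/
def IsProbabilityDensity {n : ℕ} (f : Euc n → ℝ) : Prop :=
  TorusPeriodic f ∧ (∀ x, 0 ≤ f x) ∧ ∫ x in cell n, f x = 1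

/-- `(u, m) ∈ (𝓑_α²)²` is a strong solution of the payoff problem
`u_t + Δu + 𝓗(t,x,Du,m) = 0`, `m_t - Δm + div(m 𝓗_p(t,x,Du,m)) = 0`,
`m(0,·) = m₀`, `u(T,·) = G(m(T,·))`: all derivatives exist, and the equations hold pointwise. -/
structure IsStrongSolution {n : ℕ} (T α : ℝ) (H : ℝ → Euc n → Euc n → ℝ → ℝ)
    (G : (Euc n → ℝ) → Euc n → ℝ) (m₀ : Euc n → ℝ) (u m : ℝ → Euc n → ℝ) : Prop where
  mem_u : MemST T α 2 u
  mem_m : MemST T α 2 m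
  smooth_u : ∀ t ∈ Set.Ioo (0 : ℝ) T, ContDiff ℝ 2 (u t)
  smooth_m : ∀ t ∈ Set.Ioo (0 : ℝ) T, ContDiff ℝ 2 (m t)
  smooth_flux : ∀ t ∈ Set.Ioo (0 : ℝ) T,
    Differentiable ℝ (fun x => m t x • gradP H t x (spaceGrad u t x) (m t x))
  eq_u : ∀ t ∈ Set.Ioo (0 : ℝ) T, ∀ x,
    ∃ ut, HasDerivAt (fun s => u s x) ut t ∧
      ut + Laplacian.laplacian (u t) x + H t x (spaceGrad u t x) (m t x) = 0
  eq_m : ∀ t ∈ Set.Ioo (0 : ℝ) T, ∀ x,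
    ∃ mt, HasDerivAt (fun s => m s x) mt t ∧
      mt - Laplacian.laplacian (m t) x
        + divergence (fun y => m t y • gradP H t y (spaceGrad u t y) (m t y)) x = 0
  initial : ∀ x, m 0 x = m₀ x
  terminal : ∀ x, u T x = G (m T) x

/-- `(ℙu, m - m̄)` lies in the open ball of radius `r` about the origin of `(𝓑_α²)²`. -/
def InBall {n : ℕ} (T α r : ℝ) (u m : ℝ → Euc n → ℝ) : Prop :=
  stNorm T α 2 (fun t => proj (u t)) + stNorm T α 2 (fun t x => m t x - mBar n) < r

end MFG

end

/-! Only the gradient of u enters the system, so u is split into w = ℙu and its mean, and m = m̄ +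
μ. The pair (w, μ) solves a backward and a forward heat equation with right-hand sides Ξ = bμ + Υ
and -div((μ + m̄)Θ). The mean of u is recovered afterwards by integrating in time.

In Fourier variables each mode k is a scalar linear equation with rate |k|², solved by Duhamel's
formula. The weight exponent β has slope at most q = 2α/T < 1. For |k| ≥ 1 the weight therefore
grows from s to t by at most exp(q|k|²(t - s)), while the heat kernel decays like exp(-|k|²(t - s)).
The surplus integrates to at most 1/((1 - q)|k|²), so Duhamel's formula gains two derivatives
without losing the exponential weight, and maps 𝓑_α⁰ forcing to 𝓑_α² (`norm_fwd_zero_le`,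
`wt_mul_norm_fwd_le`). Since β vanishes at 0 and T, data in B² suffice; since β is symmetric about
T/2, time reversal gives the backward estimate. The mode k = 0 has no decay, but both forcings have
mean zero.

Near the origin Θ and Υ have small Lipschitz constants, but G̃ and bμ do not. Both depend on μ
alone, so the system is triangular: A, the map producing μ, is a strong contraction, and B, the map
producing w, has a possibly large constant K only in μ. Feeding the output of A into B gives a
contraction (`exists_fixedPoint_pair`). It acts on an ℓ¹ space of weighted coefficient families,
whose completeness is immediate. The real part in `trig` discards any non-Hermitian component, so
symmetry need not be carried through the iteration.

Conversely, the equations express the time derivatives of a strong solution as trigonometric series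
with summable time-independent majorants. Fourier coefficients may thus be differentiated under the
integral (`hasDerivAt_torusCoeff`), every strong solution is mild (`IsStrongSolution.coeff_eq`), and
uniqueness of the fixed point applies. Analyticity holds because β > 0 inside (0, T), mass is
conserved because the flux is a divergence, and m is positive because the ball has radius at most
m̄. -/

noncomputable section

namespace MFG

open Complex MeasureTheory Set Filter Topology ComplexConjugate

/-! ### Characters and Fourier inversion on the torus. -/

section

variable {n : ℕ}

/-- The character `x ↦ e^{i k·x}`. -/
def chi (k : Fin n → ℤ) (x : Euc n) : ℂ :=
  Complex.exp (Complex.I * ((∑ i, (k i : ℝ) * x i : ℝ) : ℂ))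

/-- The real part of the trigonometric series with coefficients `c`. -/
def trig (c : (Fin n → ℤ) → ℂ) (x : Euc n) : ℝ := (∑' k, c k * chi k x).re

lemma norm_chi (k : Fin n → ℤ) (x : Euc n) : ‖chi k x‖ = 1 := by
  rw [chi, mul_comm, Complex.norm_exp_ofReal_mul_I]

lemma chi_add (k l : Fin n → ℤ) (x : Euc n) : chi (k + l) x = chi k x * chi l x := by
  simp only [chi, ← Complex.exp_add, ← mul_add, ← Complex.ofReal_add, ← Finset.sum_add_distrib]
  congr 4; ext i; push_cast [Pi.add_apply]; ring

lemma chi_neg (k : Fin n → ℤ) (x : Euc n) : chi (-k) x = conj (chi k x) := by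
  simp only [chi, ← Complex.exp_conj, map_mul, Complex.conj_I, Complex.conj_ofReal]
  congr 1
  simp

lemma chi_zero (x : Euc n) : chi 0 x = 1 := by simp [chi]

@[fun_prop]
lemma continuous_chi (k : Fin n → ℤ) : Continuous (chi k) := by
  unfold chi; fun_prop

lemma chi_periodic (k : Fin n → ℤ) (i : Fin n) (x : Euc n) :
    chi k (x + EuclideanSpace.single i (2 * Real.pi)) = chi k x := by
  have : (∑ j, (k j : ℝ) * (x + EuclideanSpace.single i (2 * Real.pi)) j : ℝ)
      = (∑ j, (k j : ℝ) * x j) + k i * (2 * Real.pi) := by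
    simp [mul_add, Finset.sum_add_distrib]
  rw [chi, this, chi]
  push_cast
  rw [mul_add, Complex.exp_add]
  have h2 : Complex.exp (Complex.I * ((k i : ℂ) * (2 * Real.pi))) = 1 := by
    rw [Complex.exp_eq_one_iff]; exact ⟨k i, by ring⟩
  rw [h2, mul_one]

lemma torusCoeff_def (f : Euc n → ℝ) (k : Fin n → ℤ) :
    torusCoeff f k = (mBar n : ℂ) * ∫ x in cell n, (f x : ℂ) * chi (-k) x := by
  simp [torusCoeff, chi]

lemma mBar_pos (n : ℕ) : 0 < mBar n := by unfold mBar; positivity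

/-! ### Integrals over the cell -/

lemma cell_subset_closedBall :
    cell n ⊆ Metric.closedBall (0 : Euc n) (Real.sqrt (∑ _i : Fin n, (2 * Real.pi) ^ 2)) := by
  intro x hx
  rw [mem_closedBall_zero_iff, EuclideanSpace.norm_eq]
  apply Real.sqrt_le_sqrt
  gcongr with i
  rw [Real.norm_eq_abs, abs_of_pos (hx i).1]
  exact (hx i).2

lemma measurableSet_cell : MeasurableSet (cell n) := by
  have : cell n = ⋂ i, (fun x : Euc n => x i) ⁻¹' Set.Ioc 0 (2 * Real.pi) := by
    ext x; simp [cell]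
  rw [this]
  refine MeasurableSet.iInter fun i => measurableSet_Ioc.preimage ?_
  exact (by fun_prop : Continuous fun x : Euc n => x i).measurable

lemma integrableOn_cell {E : Type*} [NormedAddCommGroup E] {f : Euc n → E} (hf : Continuous f) :
    IntegrableOn f (cell n) :=
  (hf.continuousOn.integrableOn_compact (isCompact_closedBall _ _)).mono_set cell_subset_closedBall

/-- Dilation by 2π carries the unit cell to `cell n`. The unit cell is written with corner 0 in the
shape that `UnitAddTorus.mFourierCoeff_eq_integral` produces. -/
lemma setIntegral_cell {E : Type*} [NormedAddCommGroup E] [NormedSpace ℝ E] (F : Euc n → E) :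
    ∫ x in cell n, F x = ((2 * Real.pi) ^ n) •
      ∫ y in {y : Fin n → ℝ | ∀ i, y i ∈ Ioc ((0 : Fin n → ℝ) i) ((0 : Fin n → ℝ) i + 1)},
        F (WithLp.toLp 2 ((2 * Real.pi) • y)) := by
  have h2 : (0 : ℝ) < 2 * Real.pi := by positivity
  have h1 : ∫ x in cell n, F x
      = ∫ y in {y : Fin n → ℝ | ∀ i, y i ∈ Ioc 0 (2 * Real.pi)}, F (WithLp.toLp 2 y) := by
    rw [← (PiLp.volume_preserving_toLp (Fin n)).setIntegral_preimage_emb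
      (MeasurableEquiv.toLp 2 (Fin n → ℝ)).measurableEmbedding]
    rfl
  rw [h1, Measure.setIntegral_comp_smul_of_pos volume (fun y => F (WithLp.toLp 2 y)) _ h2,
    smul_smul, Module.finrank_fin_fun, mul_inv_cancel₀ (by positivity), one_smul]
  congr 2
  ext y
  rw [Set.mem_smul_set_iff_inv_smul_mem₀ h2.ne']
  simp only [mem_ofPred_eq, mem_Ioc, Pi.smul_apply, smul_eq_mul, Pi.zero_apply, zero_add]
  refine forall_congr' fun i => ?_
  rw [inv_mul_le_iff₀ h2, mul_one, mul_pos_iff_of_pos_left (inv_pos.2 h2)]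

/-- The function on the unit torus induced by `f`. -/
def toUnit (f : Euc n → ℂ) (y : UnitAddTorus (Fin n)) : ℂ :=
  f (WithLp.toLp 2 ((2 * Real.pi) • fun i => (AddCircle.equivIoc 1 0 (y i) : ℝ)))

/-- Periodicity of complex-valued functions in each coordinate. -/
def CPeriodic (f : Euc n → ℂ) : Prop :=
  ∀ (i : Fin n) (x : Euc n), f (x + EuclideanSpace.single i (2 * Real.pi)) = f x

lemma CPeriodic.int_mul {f : Euc n → ℂ} (hf : CPeriodic f) (i : Fin n) (x : Euc n) (m : ℤ) :
    f (x + EuclideanSpace.single i (m * (2 * Real.pi))) = f x := by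
  have h := (show Function.Periodic (fun s : ℝ => f (x + EuclideanSpace.single i s))
    (2 * Real.pi) from fun s => by
      have := hf i (x + EuclideanSpace.single i s)
      rw [add_assoc] at this
      refine Eq.trans ?_ this
      simp only []
      congr 2
      ext j; by_cases hj : j = i <;> simp [hj]).int_mul m 0
  have h0 : EuclideanSpace.single i (0 : ℝ) = 0 := by ext j; simp
  simpa [h0] using h

lemma CPeriodic.add_lattice {f : Euc n → ℂ} (hf : CPeriodic f) (x : Euc n) (m : Fin n → ℤ) :
    f (x + WithLp.toLp 2 (fun i => m i * (2 * Real.pi))) = f x := by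
  have key : ∀ s : Finset (Fin n),
      f (x + ∑ i ∈ s, EuclideanSpace.single i (m i * (2 * Real.pi))) = f x := by
    intro s
    induction s using Finset.induction_on with
    | empty => simp
    | insert a s ha ih =>
      rw [Finset.sum_insert ha, add_comm (EuclideanSpace.single a _), ← add_assoc,
        hf.int_mul, ih]
  rw [← key Finset.univ]
  congr 2
  ext j
  simp [WithLp.ofLp_sum, Finset.sum_apply, Pi.single_apply]

/-- The representative in (0, 1] differs from y by an integer vector, which becomes a period of f
after scaling. -/
lemma toUnit_coe {f : Euc n → ℂ} (hf : CPeriodic f) (y : Fin n → ℝ) :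
    toUnit f (fun i => (y i : UnitAddCircle)) = f (WithLp.toLp 2 ((2 * Real.pi) • y)) := by
  have h : ∀ i, ∃ m : ℤ, (AddCircle.equivIoc 1 0 (y i : UnitAddCircle) : ℝ) = y i + m := by
    intro i
    have h1 : (((AddCircle.equivIoc (1 : ℝ) 0 (y i : UnitAddCircle)) : ℝ) : UnitAddCircle)
        = (y i : UnitAddCircle) := (AddCircle.equivIoc (1 : ℝ) 0).symm_apply_apply _
    rw [QuotientAddGroup.eq_iff_sub_mem, AddSubgroup.mem_zmultiples_iff] at h1
    obtain ⟨m, hm⟩ := h1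
    exact ⟨m, by simp at hm; linarith⟩
  choose m hm using h
  rw [← hf.add_lattice _ m, toUnit]
  congr 1
  ext i
  simp [hm]
  ring

/-- The section behind `toUnit` jumps, so continuity is tested upstairs, through the quotient map ℝⁿ
→ torus. -/
lemma continuous_toUnit {f : Euc n → ℂ} (hf : CPeriodic f) (hc : Continuous f) :
    Continuous (toUnit f) := by
  have hq : Topology.IsQuotientMap (fun (y : Fin n → ℝ) (i : Fin n) => (y i : UnitAddCircle)) := by
    refine IsOpenQuotientMap.isQuotientMap (IsOpenQuotientMap.piMap
      (fun _ => ?_))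
    exact QuotientAddGroup.isOpenQuotientMap_mk
  rw [hq.continuous_iff]
  have : toUnit f ∘ (fun (y : Fin n → ℝ) (i : Fin n) => (y i : UnitAddCircle))
      = fun y => f (WithLp.toLp 2 ((2 * Real.pi) • y)) := by
    ext y; exact toUnit_coe hf y
  rw [this]
  exact hc.comp ((PiLp.continuous_toLp 2 _).comp (by fun_prop))

lemma chi_toLp (k : Fin n → ℤ) (y : Fin n → ℝ) :
    chi k (WithLp.toLp 2 ((2 * Real.pi) • y))
      = UnitAddTorus.mFourier k (fun i => (y i : UnitAddCircle)) := by
  simp only [chi, UnitAddTorus.mFourier, ContinuousMap.coe_mk, fourier_coe_apply,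
    ← Complex.exp_sum]
  congr 1
  push_cast
  rw [Finset.mul_sum]
  refine Finset.sum_congr rfl fun i _ => ?_
  simp
  ring

lemma chi_cPeriodic (k : Fin n → ℤ) : CPeriodic (chi k) := fun i x => chi_periodic k i x

/-- Normalized Fourier coefficients of complex-valued functions. -/
def cCoeff (f : Euc n → ℂ) (k : Fin n → ℤ) : ℂ := (mBar n : ℂ) * ∫ x in cell n, f x * chi (-k) x

lemma torusCoeff_eq_cCoeff (f : Euc n → ℝ) (k : Fin n → ℤ) :
    torusCoeff f k = cCoeff (fun x => (f x : ℂ)) k := torusCoeff_def f k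

lemma cCoeff_eq_mFourierCoeff {f : Euc n → ℂ} (hf : CPeriodic f) (k : Fin n → ℤ) :
    cCoeff f k = UnitAddTorus.mFourierCoeff (toUnit f) k := by
  rw [cCoeff, setIntegral_cell, UnitAddTorus.mFourierCoeff_eq_integral _ _ 0, mBar,
    Complex.real_smul, ← mul_assoc]
  have : ((1 / (2 * Real.pi) ^ n : ℝ) : ℂ) * (((2 * Real.pi) ^ n : ℝ) : ℂ) = 1 := by
    rw [← Complex.ofReal_mul, one_div_mul_cancel (by positivity), Complex.ofReal_one]
  rw [this, one_mul]
  refine integral_congr_ae (Eventually.of_forall fun y => ?_)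
  simp only [chi_toLp, toUnit_coe hf, smul_eq_mul]
  rw [mul_comm]

/-- Orthonormality of the characters, read off from the Hilbert basis of L² of the unit torus. -/
lemma cCoeff_chi (k l : Fin n → ℤ) : cCoeff (chi k) l = if k = l then 1 else 0 := by
  classical
  rw [cCoeff_eq_mFourierCoeff (chi_cPeriodic k)]
  have h1 : toUnit (chi k) = UnitAddTorus.mFourier k := by
    ext y
    obtain ⟨z, rfl⟩ : ∃ z : Fin n → ℝ, (fun i => (z i : UnitAddCircle)) = y :=
      ⟨fun i => (AddCircle.equivIoc 1 0 (y i) : ℝ), by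
        ext i; exact (AddCircle.equivIoc (1 : ℝ) 0).symm_apply_apply _⟩
    rw [toUnit_coe (chi_cPeriodic k), chi_toLp]
  have h2 := UnitAddTorus.mFourierCoeff_toLp (UnitAddTorus.mFourier k) l
  have h3 := UnitAddTorus.mFourierBasis_repr (UnitAddTorus.mFourierLp 2 k) l
  rw [← UnitAddTorus.coe_mFourierBasis, HilbertBasis.repr_self, lp.coeFn_single,
    Pi.single_apply] at h3
  rw [h1, ← h2]
  refine Eq.trans ?_ (h3.symm.trans (by simp [eq_comm]))
  rw [UnitAddTorus.coe_mFourierBasis]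

/-- Fourier inversion for continuous periodic functions with summable coefficients. -/
lemma hasSum_cCoeff {f : Euc n → ℂ} (hf : CPeriodic f) (hc : Continuous f)
    (hs : Summable (cCoeff f)) (x : Euc n) : HasSum (fun k => cCoeff f k * chi k x) (f x) := by
  have hcoef : cCoeff f = UnitAddTorus.mFourierCoeff (toUnit f) :=
    funext fun k => cCoeff_eq_mFourierCoeff hf k
  have h := UnitAddTorus.hasSum_mFourier_series_apply_of_summable
    (f := ⟨toUnit f, continuous_toUnit hf hc⟩) (by rw [hcoef] at hs; exact hs)
    (fun i => ((((2 * Real.pi)⁻¹ • x.ofLp) i : ℝ) : UnitAddCircle))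
  have h2 : (2 * Real.pi) ≠ 0 := by positivity
  simp only [ContinuousMap.coe_mk, toUnit_coe hf, smul_eq_mul, ← chi_toLp] at h
  rw [smul_inv_smul₀ h2] at h
  rw [hcoef]
  exact h

end

/-! ### Trigonometric series and their Fourier coefficients. -/

section

variable {n : ℕ}

/-! ### Frequencies -/

lemma freqNorm_eq (k : Fin n → ℤ) :
    freqNorm k = ‖(WithLp.toLp 2 (fun i => (k i : ℝ)) : Euc n)‖ := by
  simp [freqNorm, EuclideanSpace.norm_eq]

lemma freqNorm_nonneg (k : Fin n → ℤ) : 0 ≤ freqNorm k := Real.sqrt_nonneg _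

lemma freqNorm_sq (k : Fin n → ℤ) : freqNorm k ^ 2 = ∑ i, (k i : ℝ) ^ 2 :=
  Real.sq_sqrt (Finset.sum_nonneg fun _ _ => sq_nonneg _)

lemma freqNorm_neg (k : Fin n → ℤ) : freqNorm (-k) = freqNorm k := by simp [freqNorm]

lemma freqNorm_zero : freqNorm (0 : Fin n → ℤ) = 0 := by simp [freqNorm]

lemma freqNorm_add_le (k l : Fin n → ℤ) : freqNorm (k + l) ≤ freqNorm k + freqNorm l := by
  simp only [freqNorm_eq]
  refine le_trans (le_of_eq ?_) (norm_add_le _ _)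
  congr 1
  ext i
  simp

lemma abs_le_freqNorm (k : Fin n → ℤ) (i : Fin n) : |(k i : ℝ)| ≤ freqNorm k := by
  rw [← Real.sqrt_sq_eq_abs]
  exact Real.sqrt_le_sqrt (Finset.single_le_sum (f := fun i => (k i : ℝ) ^ 2)
    (fun _ _ => sq_nonneg _) (Finset.mem_univ i))

lemma one_le_freqNorm {k : Fin n → ℤ} (hk : k ≠ 0) : 1 ≤ freqNorm k := by
  obtain ⟨i, hi⟩ := Function.ne_iff.1 hk
  refine le_trans ?_ (abs_le_freqNorm k i)
  exact_mod_cast Int.one_le_abs hi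

lemma abs_sum_mul_le (k : Fin n → ℤ) (x : Euc n) :
    |∑ i, (k i : ℝ) * x i| ≤ freqNorm k * ‖x‖ := by
  have h := abs_real_inner_le_norm (WithLp.toLp 2 (fun i => (k i : ℝ)) : Euc n) x
  rw [← freqNorm_eq] at h
  refine le_trans (le_of_eq ?_) h
  simp [PiLp.inner_apply, mul_comm]

/-! ### Trigonometric series -/

/-- The Hermitian part of a coefficient family. -/
def herm (c : (Fin n → ℤ) → ℂ) (k : Fin n → ℤ) : ℂ := (c k + conj (c (-k))) / 2

lemma summable_chi {c : (Fin n → ℤ) → ℂ} (hc : Summable fun k => ‖c k‖) (x : Euc n) :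
    Summable fun k => c k * chi k x :=
  Summable.of_norm (by simpa [norm_chi] using hc)

lemma summable_comp_neg {E : Type*} [AddCommMonoid E] [TopologicalSpace E]
    {M : (Fin n → ℤ) → E} : Summable (fun k => M (-k)) ↔ Summable M :=
  (Equiv.neg (Fin n → ℤ)).summable_iff (f := M)

lemma tsum_comp_neg {E : Type*} [AddCommMonoid E] [TopologicalSpace E]
    (M : (Fin n → ℤ) → E) : ∑' k, M (-k) = ∑' k, M k :=
  (Equiv.neg (Fin n → ℤ)).tsum_eq M

lemma norm_herm_le (c : (Fin n → ℤ) → ℂ) (k : Fin n → ℤ) :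
    ‖herm c k‖ ≤ (‖c k‖ + ‖c (-k)‖) / 2 := by
  rw [herm, norm_div]
  simp only [RCLike.norm_ofNat]
  gcongr
  exact (norm_add_le _ _).trans (by simp)

lemma summable_norm_herm {c : (Fin n → ℤ) → ℂ} (hc : Summable fun k => ‖c k‖) :
    Summable fun k => ‖herm c k‖ :=
  Summable.of_nonneg_of_le (fun _ => norm_nonneg _) (norm_herm_le c)
    ((hc.add (summable_comp_neg.2 hc)).div_const 2)

/-- The real part is the average of the series and its conjugate, and conjugation replaces k by -k.
-/
lemma hasSum_herm {c : (Fin n → ℤ) → ℂ} (hc : Summable fun k => ‖c k‖) (x : Euc n) :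
    HasSum (fun k => herm c k * chi k x) (trig c x : ℂ) := by
  have h1 := (summable_chi hc x).hasSum
  have h2 : HasSum (fun k => conj (c (-k)) * chi k x) (conj (∑' k, c k * chi k x)) := by
    have := (Equiv.neg (Fin n → ℤ)).hasSum_iff.2 (Complex.hasSum_conj'.2 h1)
    refine this.congr_fun ?_
    intro k
    simp [chi_neg]
  have h3 := (h1.add h2).div_const 2
  rw [Complex.add_conj, mul_comm, ofReal_mul] at h3
  have h4 : ((∑' k, c k * chi k x).re : ℂ) * ((2 : ℝ) : ℂ) / 2 = (trig c x : ℂ) := by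
    simp [trig]
  rw [h4] at h3
  refine h3.congr_fun fun k => ?_
  rw [herm]; ring

lemma hasSum_trig {c : (Fin n → ℤ) → ℂ} (hc : Summable fun k => ‖c k‖) (x : Euc n) :
    HasSum (fun k => (c k * chi k x).re) (trig c x) :=
  Complex.hasSum_re (summable_chi hc x).hasSum

lemma abs_trig_le {c : (Fin n → ℤ) → ℂ} (hc : Summable fun k => ‖c k‖) (x : Euc n) :
    |trig c x| ≤ ∑' k, ‖c k‖ := by
  refine (Complex.abs_re_le_norm _).trans ?_
  refine (norm_tsum_le_tsum_norm (by simpa [norm_chi] using hc)).trans (le_of_eq ?_)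
  simp [norm_chi]

lemma continuous_trig {c : (Fin n → ℤ) → ℂ} (hc : Summable fun k => ‖c k‖) :
    Continuous (trig c) :=
  Complex.continuous_re.comp (continuous_tsum (fun k => by fun_prop) hc
    (fun k x => by simp [norm_chi]))

lemma periodic_trig (c : (Fin n → ℤ) → ℂ) : TorusPeriodic (trig c) := fun i x => by
  simp [trig, chi_periodic]

lemma trig_add {c d : (Fin n → ℤ) → ℂ} (hc : Summable fun k => ‖c k‖)
    (hd : Summable fun k => ‖d k‖) (x : Euc n) :
    trig (fun k => c k + d k) x = trig c x + trig d x := by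
  simp only [trig, add_mul]
  rw [(summable_chi hc x).tsum_add (summable_chi hd x), Complex.add_re]

lemma trig_sub {c d : (Fin n → ℤ) → ℂ} (hc : Summable fun k => ‖c k‖)
    (hd : Summable fun k => ‖d k‖) (x : Euc n) :
    trig (fun k => c k - d k) x = trig c x - trig d x := by
  simp only [trig, sub_mul]
  rw [(summable_chi hc x).tsum_sub (summable_chi hd x), Complex.sub_re]

/-! ### Fourier coefficients -/

lemma integrableOn_cell_mul_chi {f : Euc n → ℂ} (hf : Continuous f) (k : Fin n → ℤ) :
    IntegrableOn (fun x => f x * chi k x) (cell n) := integrableOn_cell (by fun_prop)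

lemma cCoeff_add {f g : Euc n → ℂ} (hf : Continuous f) (hg : Continuous g) (k : Fin n → ℤ) :
    cCoeff (fun x => f x + g x) k = cCoeff f k + cCoeff g k := by
  simp only [cCoeff, add_mul]
  rw [integral_add (integrableOn_cell_mul_chi hf _) (integrableOn_cell_mul_chi hg _), mul_add]

lemma cCoeff_sub {f g : Euc n → ℂ} (hf : Continuous f) (hg : Continuous g) (k : Fin n → ℤ) :
    cCoeff (fun x => f x - g x) k = cCoeff f k - cCoeff g k := by
  simp only [cCoeff, sub_mul]
  rw [integral_sub (integrableOn_cell_mul_chi hf _) (integrableOn_cell_mul_chi hg _), mul_sub]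

lemma cCoeff_const_mul (a : ℂ) (f : Euc n → ℂ) (k : Fin n → ℤ) :
    cCoeff (fun x => a * f x) k = a * cCoeff f k := by
  simp only [cCoeff, mul_assoc]
  rw [integral_const_mul]
  ring

/-- Absolute summability allows termwise integration, and orthogonality leaves the term k = l. -/
lemma cCoeff_tsum {c : (Fin n → ℤ) → ℂ} (hc : Summable fun k => ‖c k‖) (l : Fin n → ℤ) :
    cCoeff (fun x => ∑' k, c k * chi k x) l = c l := by
  have h := hasSum_integral_of_summable_integral_norm (μ := volume.restrict (cell n))
    (F := fun k x => c k * chi k x * chi (-l) x)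
    (fun k => integrableOn_cell_mul_chi (by fun_prop) _)
    (by
      simp only [norm_mul, norm_chi, mul_one, integral_const]
      simpa using hc.mul_left _)
  have h1 : ∀ x, ∑' k, c k * chi k x * chi (-l) x = (∑' k, c k * chi k x) * chi (-l) x :=
    fun x => tsum_mul_right
  simp only [h1] at h
  have h2 := h.mul_left (mBar n : ℂ)
  have h3 : ∀ k, (mBar n : ℂ) * ∫ x in cell n, c k * chi k x * chi (-l) x
      = if k = l then c l else 0 := by
    intro k
    have := cCoeff_const_mul (c k) (chi k) l
    rw [cCoeff_chi, cCoeff] at this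
    rw [this]
    split_ifs with hkl <;> simp [hkl]
  simp only [h3] at h2
  exact h2.unique (hasSum_ite_eq l (c l))

lemma torusCoeff_trig {c : (Fin n → ℤ) → ℂ} (hc : Summable fun k => ‖c k‖) (l : Fin n → ℤ) :
    torusCoeff (trig c) l = herm c l := by
  rw [torusCoeff_eq_cCoeff, ← cCoeff_tsum (summable_norm_herm hc) l]
  congr 1
  ext x
  exact (hasSum_herm hc x).tsum_eq.symm

lemma torusCoeff_neg (f : Euc n → ℝ) (k : Fin n → ℤ) :
    torusCoeff f (-k) = conj (torusCoeff f k) := by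
  rw [torusCoeff_def, torusCoeff_def, map_mul, Complex.conj_ofReal, ← integral_conj]
  simp [chi_neg]

lemma herm_torusCoeff (f : Euc n → ℝ) : herm (torusCoeff f) = torusCoeff f := by
  ext k
  simp [herm, torusCoeff_neg]

lemma torusCoeff_add {f g : Euc n → ℝ} (hf : Continuous f) (hg : Continuous g) (k : Fin n → ℤ) :
    torusCoeff (fun x => f x + g x) k = torusCoeff f k + torusCoeff g k := by
  simp only [torusCoeff_eq_cCoeff, ofReal_add]
  exact cCoeff_add (by fun_prop) (by fun_prop) k

lemma torusCoeff_sub {f g : Euc n → ℝ} (hf : Continuous f) (hg : Continuous g) (k : Fin n → ℤ) :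
    torusCoeff (fun x => f x - g x) k = torusCoeff f k - torusCoeff g k := by
  simp only [torusCoeff_eq_cCoeff, ofReal_sub]
  exact cCoeff_sub (by fun_prop) (by fun_prop) k

lemma torusCoeff_const_mul (a : ℝ) (f : Euc n → ℝ) (k : Fin n → ℤ) :
    torusCoeff (fun x => a * f x) k = a * torusCoeff f k := by
  simp only [torusCoeff_eq_cCoeff, ofReal_mul]
  exact cCoeff_const_mul _ _ k

lemma torusCoeff_zero (k : Fin n → ℤ) : torusCoeff (fun _ : Euc n => 0) k = 0 := by
  simp [torusCoeff]

lemma torusCoeff_const (a : ℝ) (k : Fin n → ℤ) :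
    torusCoeff (fun _ : Euc n => a) k = if k = 0 then (a : ℂ) else 0 := by
  have h := cCoeff_const_mul (a : ℂ) (chi (0 : Fin n → ℤ)) k
  rw [cCoeff_chi] at h
  simp only [chi_zero, mul_one] at h
  rw [torusCoeff_eq_cCoeff, h]
  simp [eq_comm]

lemma torusCoeff_zero_eq_mean (f : Euc n → ℝ) : torusCoeff f 0 = (mean f : ℂ) := by
  rw [torusCoeff_def, mean, ofReal_mul, ← integral_complex_ofReal]
  simp [chi_zero]

lemma torusCoeff_proj {f : Euc n → ℝ} (hf : Continuous f) (k : Fin n → ℤ) :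
    torusCoeff (proj f) k = if k = 0 then 0 else torusCoeff f k := by
  unfold proj
  rw [torusCoeff_sub hf continuous_const, torusCoeff_const]
  split_ifs with h
  · subst h; rw [torusCoeff_zero_eq_mean, sub_self]
  · simp

/-- Fourier inversion. -/
lemma hasSum_torusCoeff {f : Euc n → ℝ} (hf : Continuous f) (hp : TorusPeriodic f)
    (hs : Summable fun k => ‖torusCoeff f k‖) (x : Euc n) :
    HasSum (fun k => torusCoeff f k * chi k x) (f x : ℂ) := by
  simp only [torusCoeff_eq_cCoeff]
  refine hasSum_cCoeff (f := fun x => (f x : ℂ)) (fun i x => congrArg _ (hp i x)) (by fun_prop) ?_ x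
  exact hs.of_norm.congr fun k => torusCoeff_eq_cCoeff f k

lemma trig_torusCoeff {f : Euc n → ℝ} (hf : Continuous f) (hp : TorusPeriodic f)
    (hs : Summable fun k => ‖torusCoeff f k‖) : trig (torusCoeff f) = f := by
  ext x
  rw [trig, (hasSum_torusCoeff hf hp hs x).tsum_eq, ofReal_re]

/-- Only f is expanded in its series, so g need only be continuous. -/
lemma torusCoeff_mul {f g : Euc n → ℝ} (hf : Continuous f) (hg : Continuous g)
    (hpf : TorusPeriodic f) (hsf : Summable fun k => ‖torusCoeff f k‖) (l : Fin n → ℤ) :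
    HasSum (fun k => torusCoeff f k * torusCoeff g (l - k))
      (torusCoeff (fun x => f x * g x) l) := by
  have h := hasSum_integral_of_summable_integral_norm (μ := volume.restrict (cell n))
    (F := fun k x => torusCoeff f k * (g x * chi (-(l - k)) x))
    (fun k => (integrableOn_cell_mul_chi (f := fun x => (g x : ℂ)) (by fun_prop) _).const_mul _)
    (by
      simp only [norm_mul, norm_chi, mul_one, integral_const_mul]
      exact hsf.mul_right _)
  have h1 : ∀ x, ∑' k, torusCoeff f k * (g x * chi (-(l - k)) x)
      = ((f x * g x : ℝ) : ℂ) * chi (-l) x := fun x => by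
    have h := (hasSum_torusCoeff hf hpf hsf x).mul_right (g x * chi (-l) x)
    rw [← mul_assoc, ← ofReal_mul] at h
    rw [← h.tsum_eq]
    refine tsum_congr fun k => ?_
    rw [show -(l - k) = k + -l by abel, chi_add]
    ring
  simp only [h1] at h
  have h2 := h.mul_left (mBar n : ℂ)
  rw [← torusCoeff_def] at h2
  refine h2.congr_fun fun k => ?_
  rw [integral_const_mul, torusCoeff_def g]
  ring

end

/-! ### Termwise differentiation and analyticity of trigonometric series. -/

section

variable {n : ℕ}

/-! ### Differentiation of trigonometric series -/

/-- The coefficients of the `i`-th partial derivative. -/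
def dcoef (i : Fin n) (c : (Fin n → ℤ) → ℂ) (k : Fin n → ℤ) : ℂ := Complex.I * k i * c k

lemma norm_dcoef_le (i : Fin n) (c : (Fin n → ℤ) → ℂ) (k : Fin n → ℤ) :
    ‖dcoef i c k‖ ≤ freqNorm k * ‖c k‖ := by
  rw [dcoef, norm_mul, norm_mul, Complex.norm_I, one_mul]
  gcongr
  simpa using abs_le_freqNorm k i

/-- The factor 2 is needed only at k = 0, where i = 0 gives 1 + 0⁰ = 2. Nonzero frequencies have |k|
≥ 1, so their powers are monotone. -/
lemma one_add_pow_le {i j : ℕ} (hij : i ≤ j) (k : Fin n → ℤ) :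
    1 + freqNorm k ^ i ≤ 2 * (1 + freqNorm k ^ j) := by
  rcases eq_or_ne k 0 with rfl | hk
  · rw [freqNorm_zero]
    have h1 : (0 : ℝ) ^ i ≤ 1 := pow_le_one₀ le_rfl zero_le_one
    have h2 : (0 : ℝ) ≤ 0 ^ j := by positivity
    linarith
  · have := pow_le_pow_right₀ (one_le_freqNorm hk) hij
    have h2 : 0 ≤ freqNorm k ^ i := pow_nonneg (freqNorm_nonneg k) _
    linarith

lemma one_le_one_add_pow (j : ℕ) (k : Fin n → ℤ) : 1 ≤ 1 + freqNorm k ^ j :=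
  le_add_of_nonneg_right (pow_nonneg (freqNorm_nonneg k) j)

lemma summable_of_weight {j : ℕ} {c : (Fin n → ℤ) → ℂ}
    (hc : Summable fun k => (1 + freqNorm k ^ j) * ‖c k‖) : Summable fun k => ‖c k‖ :=
  Summable.of_nonneg_of_le (fun _ => norm_nonneg _)
    (fun k => le_mul_of_one_le_left (norm_nonneg _) (one_le_one_add_pow j k)) hc

lemma summable_weight_of_le {i j : ℕ} (hij : i ≤ j) {c : (Fin n → ℤ) → ℂ}
    (hc : Summable fun k => (1 + freqNorm k ^ j) * ‖c k‖) :
    Summable fun k => (1 + freqNorm k ^ i) * ‖c k‖ :=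
  Summable.of_nonneg_of_le
    (fun k => mul_nonneg (zero_le_one.trans (one_le_one_add_pow i k)) (norm_nonneg _))
    (fun k => by
      rw [← mul_assoc]
      exact mul_le_mul_of_nonneg_right (one_add_pow_le hij k) (norm_nonneg _)) (hc.mul_left 2)

lemma weight_dcoef_le (j : ℕ) (i : Fin n) (c : (Fin n → ℤ) → ℂ) (k : Fin n → ℤ) :
    (1 + freqNorm k ^ j) * ‖dcoef i c k‖ ≤ 2 * ((1 + freqNorm k ^ (j + 1)) * ‖c k‖) := by
  have h0 := freqNorm_nonneg k
  have h1 : (1 + freqNorm k ^ j) * freqNorm k ≤ 2 * (1 + freqNorm k ^ (j + 1)) := by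
    have := one_add_pow_le (show 1 ≤ j + 1 by omega) k
    have h2 : 0 ≤ freqNorm k ^ (j + 1) := pow_nonneg h0 _
    rcases eq_or_ne k 0 with rfl | hk
    · rw [freqNorm_zero] at *; simp
    · have h3 := pow_le_pow_right₀ (one_le_freqNorm hk) (show 1 ≤ j + 1 by omega)
      rw [pow_one] at h3
      rw [add_mul, one_mul, ← pow_succ]
      linarith
  calc (1 + freqNorm k ^ j) * ‖dcoef i c k‖
      ≤ (1 + freqNorm k ^ j) * (freqNorm k * ‖c k‖) := by
        gcongr; exact norm_dcoef_le i c k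
    _ = ((1 + freqNorm k ^ j) * freqNorm k) * ‖c k‖ := by ring
    _ ≤ (2 * (1 + freqNorm k ^ (j + 1))) * ‖c k‖ := by gcongr
    _ = _ := by ring

lemma summable_dcoef {j : ℕ} (i : Fin n) {c : (Fin n → ℤ) → ℂ}
    (hc : Summable fun k => (1 + freqNorm k ^ (j + 1)) * ‖c k‖) :
    Summable fun k => (1 + freqNorm k ^ j) * ‖dcoef i c k‖ :=
  Summable.of_nonneg_of_le (fun k => by have := freqNorm_nonneg k; positivity)
    (weight_dcoef_le j i c) (hc.mul_left 2)

lemma hasFDerivAt_chi (k : Fin n → ℤ) (x : Euc n) :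
    HasFDerivAt (chi k) (∑ i, (chi k x * (Complex.I * k i)) •
      (Complex.ofRealCLM.comp (EuclideanSpace.proj i : Euc n →L[ℝ] ℝ))) x := by
  have h1 : HasFDerivAt (fun x : Euc n => (∑ i, (k i : ℝ) * x i : ℝ))
      (∑ i, (k i : ℝ) • (EuclideanSpace.proj i : Euc n →L[ℝ] ℝ)) x := by
    refine HasFDerivAt.fun_sum fun i _ => ?_
    exact ((EuclideanSpace.proj i : Euc n →L[ℝ] ℝ).hasFDerivAt).const_mul (k i : ℝ)
  have h2 := (Complex.ofRealCLM.hasFDerivAt.comp x h1)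
  have h3 := (h2.const_mul Complex.I).cexp
  refine h3.congr_fderiv ?_
  ext v
  simp [chi, Finset.mul_sum]
  refine Finset.sum_congr rfl fun i _ => ?_
  ring

lemma hasFDerivAt_re_mul_chi (a : ℂ) (k : Fin n → ℤ) (x : Euc n) :
    HasFDerivAt (fun x => (a * chi k x).re)
      (∑ i, (Complex.I * k i * a * chi k x).re • (EuclideanSpace.proj i : Euc n →L[ℝ] ℝ)) x := by
  have h := Complex.reCLM.hasFDerivAt.comp x ((hasFDerivAt_chi k x).const_mul a)
  refine h.congr_fderiv ?_
  ext v
  simp only [ContinuousLinearMap.comp_apply, smul_apply, reCLM_apply,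
    smul_eq_mul, sum_apply, Finset.mul_sum, Complex.re_sum]
  refine Finset.sum_congr rfl fun i _ => ?_
  simp only [ofRealCLM_apply, PiLp.proj_apply]
  rw [← Complex.re_mul_ofReal]
  congr 1
  ring

lemma hasFDerivAt_trig {c : (Fin n → ℤ) → ℂ}
    (hc : Summable fun k => (1 + freqNorm k ^ 1) * ‖c k‖) (x : Euc n) :
    HasFDerivAt (trig c)
      (∑ i, trig (dcoef i c) x • (EuclideanSpace.proj i : Euc n →L[ℝ] ℝ)) x := by
  have hs := summable_of_weight hc
  have hds : ∀ i : Fin n, Summable fun k => ‖dcoef i c k‖ :=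
    fun i => summable_of_weight (j := 0) (summable_dcoef i hc)
  have hu : Summable fun k =>
      ∑ i, ‖dcoef i c k‖ * ‖(EuclideanSpace.proj i : Euc n →L[ℝ] ℝ)‖ :=
    summable_sum fun i _ => (hds i).mul_right _
  have h := hasFDerivAt_tsum hu (fun k x => hasFDerivAt_re_mul_chi (c k) k x)
    (fun k x => by
      refine norm_sum_le_of_le _ fun i _ => ?_
      rw [norm_smul]
      gcongr
      refine (Complex.abs_re_le_norm _).trans ?_
      rw [norm_mul, norm_chi, mul_one, dcoef]) (x₀ := 0) (hasSum_trig hs 0).summable x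
  have h1 : (fun y => ∑' k, (c k * chi k y).re) = trig c := by
    ext y; exact (hasSum_trig hs y).tsum_eq
  rw [h1] at h
  refine h.congr_fderiv ?_
  have h2 : HasSum (fun k => ∑ i, (Complex.I * k i * c k * chi k x).re •
      (EuclideanSpace.proj i : Euc n →L[ℝ] ℝ))
      (∑ i, trig (dcoef i c) x • (EuclideanSpace.proj i : Euc n →L[ℝ] ℝ)) :=
    hasSum_sum fun i _ => (hasSum_trig (hds i) x).smul_const _
  exact h2.tsum_eq

lemma fderiv_trig {c : (Fin n → ℤ) → ℂ}
    (hc : Summable fun k => (1 + freqNorm k ^ 1) * ‖c k‖) :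
    fderiv ℝ (trig c) =
      fun x => ∑ i, trig (dcoef i c) x • (EuclideanSpace.proj i : Euc n →L[ℝ] ℝ) :=
  funext fun x => (hasFDerivAt_trig hc x).fderiv

lemma fderiv_trig_single {c : (Fin n → ℤ) → ℂ}
    (hc : Summable fun k => (1 + freqNorm k ^ 1) * ‖c k‖) (x : Euc n) (i : Fin n) :
    fderiv ℝ (trig c) x (EuclideanSpace.single i 1) = trig (dcoef i c) x := by
  rw [fderiv_trig hc]
  simp

lemma gradient_apply_eq {f : Euc n → ℝ} (x : Euc n) (i : Fin n) :
    gradient f x i = fderiv ℝ f x (EuclideanSpace.single i 1) := by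
  have h := InnerProductSpace.toDual_symm_apply (𝕜 := ℝ) (x := EuclideanSpace.single i (1 : ℝ))
    (y := fderiv ℝ f x)
  rw [← h, gradient, EuclideanSpace.inner_single_right]
  simp

lemma gradient_trig {c : (Fin n → ℤ) → ℂ}
    (hc : Summable fun k => (1 + freqNorm k ^ 1) * ‖c k‖) (x : Euc n) (i : Fin n) :
    gradient (trig c) x i = trig (dcoef i c) x := by
  rw [gradient_apply_eq, fderiv_trig_single hc]

lemma contDiff_one_trig {c : (Fin n → ℤ) → ℂ}
    (hc : Summable fun k => (1 + freqNorm k ^ 1) * ‖c k‖) : ContDiff ℝ 1 (trig c) := by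
  rw [contDiff_one_iff_fderiv]
  refine ⟨fun x => (hasFDerivAt_trig hc x).differentiableAt, ?_⟩
  rw [fderiv_trig hc]
  refine continuous_finsetSum _ fun i _ => ?_
  have := continuous_trig (summable_of_weight (j := 0) (summable_dcoef i hc))
  fun_prop

lemma contDiff_two_trig {c : (Fin n → ℤ) → ℂ}
    (hc : Summable fun k => (1 + freqNorm k ^ 2) * ‖c k‖) : ContDiff ℝ 2 (trig c) := by
  have hc1 := summable_weight_of_le (show 1 ≤ 2 by norm_num) hc
  rw [show (2 : WithTop ℕ∞) = 1 + 1 by norm_num, contDiff_succ_iff_fderiv]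
  refine ⟨fun x => (hasFDerivAt_trig hc1 x).differentiableAt, by simp, ?_⟩
  rw [fderiv_trig hc1]
  exact ContDiff.sum fun i _ =>
    (contDiff_one_trig (summable_dcoef i hc)).smul contDiff_const

lemma laplacian_trig {c : (Fin n → ℤ) → ℂ}
    (hc : Summable fun k => (1 + freqNorm k ^ 2) * ‖c k‖) (x : Euc n) :
    Laplacian.laplacian (trig c) x = trig (fun k => -((freqNorm k : ℂ) ^ 2 * c k)) x := by
  have hc1 := summable_weight_of_le (show 1 ≤ 2 by norm_num) hc
  rw [InnerProductSpace.laplacian_eq_iteratedFDeriv_orthonormalBasis _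
    (EuclideanSpace.basisFun (Fin n) ℝ)]
  have h1 : ∀ i : Fin n, HasSum (fun k => (dcoef i (dcoef i c) k * chi k x).re)
      (trig (dcoef i (dcoef i c)) x) := fun i =>
    hasSum_trig (summable_of_weight (j := 0) (summable_dcoef i (summable_dcoef i hc))) x
  have h2 : ∀ i : Fin n, iteratedFDeriv ℝ 2 (trig c) x
      ![EuclideanSpace.basisFun (Fin n) ℝ i, EuclideanSpace.basisFun (Fin n) ℝ i]
      = trig (dcoef i (dcoef i c)) x := by
    intro i
    rw [iteratedFDeriv_two_apply]
    simp only [Matrix.cons_val_zero, Matrix.cons_val_one, EuclideanSpace.basisFun_apply]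
    rw [← fderiv_trig_single (summable_dcoef i hc)]
    have hd : DifferentiableAt ℝ (fderiv ℝ (trig c)) x :=
      ((contDiff_two_trig hc).fderiv_right (m := 1) (by norm_num)).differentiable (by norm_num) x
    have h3 : trig (dcoef i c) = fun y => fderiv ℝ (trig c) y (EuclideanSpace.single i 1) := by
      ext y; rw [fderiv_trig_single hc1]
    rw [h3, fderiv_clm_apply hd (differentiableAt_const _)]
    simp
  simp only [h2]
  have h4 := hasSum_sum (s := Finset.univ) fun i _ => h1 i
  rw [← h4.tsum_eq, trig, Complex.re_tsum]
  · refine tsum_congr fun k => ?_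
    rw [← Complex.re_sum, ← Finset.sum_mul]
    congr 2
    simp only [dcoef]
    rw [← Complex.ofReal_pow, freqNorm_sq, ofReal_sum, Finset.sum_mul, ← Finset.sum_neg_distrib]
    refine Finset.sum_congr rfl fun i _ => ?_
    push_cast
    linear_combination (k i : ℂ) ^ 2 * c k * Complex.I_sq
  · refine summable_chi (c := fun k => -((freqNorm k : ℂ) ^ 2 * c k)) ?_ x
    refine Summable.of_nonneg_of_le (fun _ => norm_nonneg _) (fun k => ?_) hc
    rw [norm_neg, norm_mul, norm_pow, Complex.norm_real, Real.norm_of_nonneg (freqNorm_nonneg k)]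
    gcongr
    linarith

/-! ### Analyticity -/

/-- The linear form `y ↦ i k·y`. -/
def phase (k : Fin n → ℤ) : Euc n →L[ℝ] ℂ :=
  LinearMap.mkContinuous
    { toFun := fun y => Complex.I * ((∑ i, (k i : ℝ) * y i : ℝ) : ℂ)
      map_add' := fun y z => by
        simp [mul_add, Finset.sum_add_distrib]
      map_smul' := fun a y => by
        simp [Finset.mul_sum]
        refine Finset.sum_congr rfl fun i _ => by ring }
    (freqNorm k) (fun y => by
      simp only [LinearMap.coe_mk, AddHom.coe_mk, norm_mul, Complex.norm_I, one_mul,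
        Complex.norm_real, Real.norm_eq_abs]
      exact abs_sum_mul_le k y)

lemma phase_apply (k : Fin n → ℤ) (y : Euc n) :
    phase k y = Complex.I * ((∑ i, (k i : ℝ) * y i : ℝ) : ℂ) := rfl

lemma norm_phase_le (k : Fin n → ℤ) : ‖phase k‖ ≤ freqNorm k :=
  LinearMap.mkContinuous_norm_le _ (freqNorm_nonneg k) _

lemma chi_add_eq (k : Fin n → ℤ) (x y : Euc n) :
    chi k (x + y) = chi k x * Complex.exp (phase k y) := by
  rw [chi, chi, phase_apply, ← Complex.exp_add]
  congr 1
  simp [mul_add, Finset.sum_add_distrib]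

/-- The `j`-th Taylor coefficient of `chi k` at `x`, up to the factor `chi k x`. -/
def taylorTerm (k : Fin n → ℤ) (j : ℕ) : ContinuousMultilinearMap ℝ (fun _ : Fin j => Euc n) ℂ :=
  (ContinuousMultilinearMap.mkPiAlgebra ℝ (Fin j) ℂ).compContinuousLinearMap fun _ => phase k

lemma taylorTerm_apply (k : Fin n → ℤ) (j : ℕ) (y : Euc n) :
    taylorTerm k j (fun _ => y) = phase k y ^ j := by
  simp [taylorTerm]

lemma norm_taylorTerm_le (k : Fin n → ℤ) (j : ℕ) : ‖taylorTerm k j‖ ≤ freqNorm k ^ j := by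
  refine (ContinuousMultilinearMap.norm_compContinuousLinearMap_le _ _).trans ?_
  rw [ContinuousMultilinearMap.norm_mkPiAlgebra, one_mul, Finset.prod_const, Finset.card_univ,
    Fintype.card_fin]
  gcongr
  exact norm_phase_le k

/-- A Cauchy-type estimate from zʲ/j! ≤ eᶻ at z = r|k|: exponential decay of the coefficients at
rate r yields a power series with radius at least r. -/
lemma norm_taylor_coeff_le {r : ℝ} (hr : 0 < r) (c : ℂ) (k : Fin n → ℤ) (x : Euc n) (j : ℕ) :
    ‖(c * chi k x * (j.factorial : ℂ)⁻¹) • taylorTerm k j‖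
      ≤ Real.exp (r * freqNorm k) * ‖c‖ * (r ^ j)⁻¹ := by
  have h1 := Real.pow_div_factorial_le_exp (r * freqNorm k)
    (mul_nonneg hr.le (freqNorm_nonneg k)) j
  rw [← div_eq_mul_inv _ (r ^ j), le_div_iff₀ (by positivity), norm_smul, norm_mul, norm_mul, norm_chi,
    norm_inv, Complex.norm_natCast, mul_one]
  calc ‖c‖ * (j.factorial : ℝ)⁻¹ * ‖taylorTerm k j‖ * r ^ j
      ≤ ‖c‖ * (j.factorial : ℝ)⁻¹ * freqNorm k ^ j * r ^ j := by
        gcongr; exact norm_taylorTerm_le k j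
    _ = (r * freqNorm k) ^ j / j.factorial * ‖c‖ := by rw [mul_pow]; ring
    _ ≤ _ := by gcongr

lemma hasSum_real_exp (z : ℝ) : HasSum (fun j : ℕ => z ^ j / j.factorial) (Real.exp z) := by
  have := NormedSpace.expSeries_div_hasSum_exp z
  rwa [← Real.exp_eq_exp_ℝ] at this

lemma hasSum_taylor_row (c : ℂ) (k : Fin n → ℤ) (x y : Euc n) :
    HasSum (fun j : ℕ => c * chi k x * (j.factorial : ℂ)⁻¹ * phase k y ^ j)
      (c * chi k (x + y)) := by
  have h := NormedSpace.expSeries_div_hasSum_exp (phase k y)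
  rw [← Complex.exp_eq_exp_ℂ] at h
  rw [chi_add_eq, ← mul_assoc]
  exact (h.mul_left (c * chi k x)).congr_fun fun j => by ring

/-- For fixed k the terms are dominated by ‖c k‖ times the exponential series at r|k|, so the double
series converges absolutely and may be summed in either order. -/
lemma summable_taylor {c : (Fin n → ℤ) → ℂ} {r : ℝ} (hr : 0 < r)
    (hc : Summable fun k => Real.exp (r * freqNorm k) * ‖c k‖) (x : Euc n) {y : Euc n}
    (hy : ‖y‖ ≤ r) : Summable fun q : (Fin n → ℤ) × ℕ =>
      c q.1 * chi q.1 x * (q.2.factorial : ℂ)⁻¹ * phase q.1 y ^ q.2 := by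
  have hnn : (0 : (Fin n → ℤ) × ℕ → ℝ) ≤ fun q =>
      ‖c q.1‖ * ((r * freqNorm q.1) ^ q.2 / q.2.factorial) := fun q => by
    have h0 := freqNorm_nonneg q.1
    have : (0 : ℝ) ≤ ‖c q.1‖ * ((r * freqNorm q.1) ^ q.2 / q.2.factorial) := by positivity
    exact this
  have hg : Summable fun q : (Fin n → ℤ) × ℕ =>
      ‖c q.1‖ * ((r * freqNorm q.1) ^ q.2 / q.2.factorial) := by
    rw [summable_prod_of_nonneg hnn]
    have h2 : ∀ k : Fin n → ℤ, ∑' j : ℕ, ‖c k‖ * ((r * freqNorm k) ^ j / j.factorial)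
        = Real.exp (r * freqNorm k) * ‖c k‖ := fun k => by
      rw [tsum_mul_left, (hasSum_real_exp _).tsum_eq, mul_comm]
    refine ⟨fun k => (hasSum_real_exp (r * freqNorm k)).summable.mul_left ‖c k‖, ?_⟩
    simp only [h2]
    exact hc
  refine Summable.of_norm_bounded hg fun q => ?_
  have hph : ‖phase q.1 y‖ ≤ r * freqNorm q.1 := by
    refine ((phase q.1).le_opNorm y).trans ?_
    rw [mul_comm]
    exact mul_le_mul hy (norm_phase_le q.1) (norm_nonneg _) hr.le
  rw [norm_mul, norm_mul, norm_mul, norm_chi, norm_inv, Complex.norm_natCast, mul_one, norm_pow,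
    mul_assoc, ← div_eq_inv_mul]
  gcongr

lemma analyticAt_tsum_chi {c : (Fin n → ℤ) → ℂ} {r : ℝ} (hr : 0 < r)
    (hc : Summable fun k => Real.exp (r * freqNorm k) * ‖c k‖) (x : Euc n) :
    AnalyticAt ℝ (fun x => ∑' k, c k * chi k x) x := by
  have hsn : ∀ j : ℕ, Summable fun k =>
      ‖(c k * chi k x * (j.factorial : ℂ)⁻¹) • taylorTerm k j‖ := fun j =>
    Summable.of_nonneg_of_le (fun _ => norm_nonneg _)
      (fun k => norm_taylor_coeff_le hr (c k) k x j) (hc.mul_right ((r ^ j)⁻¹))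
  refine ⟨fun j => ∑' k, (c k * chi k x * (j.factorial : ℂ)⁻¹) • taylorTerm k j,
    ENNReal.ofReal r, ?_, by simpa using hr, ?_⟩
  · refine FormalMultilinearSeries.le_radius_of_bound _
      (∑' k, Real.exp (r * freqNorm k) * ‖c k‖) fun j => ?_
    rw [Real.coe_toNNReal r hr.le, ← le_div_iff₀ (by positivity), div_eq_mul_inv, ← tsum_mul_right]
    exact (norm_tsum_le_tsum_norm (hsn j)).trans (Summable.tsum_le_tsum
      (fun k => norm_taylor_coeff_le hr (c k) k x j) (hsn j) (hc.mul_right _))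
  · intro y hy
    have hy' : ‖y‖ ≤ r := by
      rw [Metric.mem_eball, edist_zero_right, ← ofReal_norm,
        ENNReal.ofReal_lt_ofReal_iff hr] at hy
      exact hy.le
    have htot := (summable_taylor hr hc x hy').hasSum
    -- Summing over j first gives the value at x + y; summing over k first, below, gives the power
    -- series in y.
    rw [(htot.prod_fiberwise fun k => hasSum_taylor_row (c k) k x y).tsum_eq]
    have h2 := (Equiv.prodComm ℕ (Fin n → ℤ)).hasSum_iff.2 htot
    refine h2.prod_fiberwise fun j => ?_
    refine (ContinuousMultilinearMap.hasSum_eval (hsn j).of_norm.hasSum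
      (fun _ => y)).congr_fun fun k => ?_
    rw [smul_apply, taylorTerm_apply]
    rfl

lemma analyticOnNhd_trig {c : (Fin n → ℤ) → ℂ} {r : ℝ} (hr : 0 < r)
    (hc : Summable fun k => Real.exp (r * freqNorm k) * ‖c k‖) :
    AnalyticOnNhd ℝ (trig c) univ := fun x _ =>
  (Complex.reCLM.analyticAt _).comp (analyticAt_tsum_chi hr hc x)

end

/-! ### The spaces Bʲ and 𝓑_αʲ through Fourier coefficients. -/

section

variable {n : ℕ} {T α : ℝ} {i j : ℕ}

/-! ### The spaces `Bʲ` -/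

lemma bENorm_eq_ofReal {f : Euc n → ℝ}
    (hs : Summable fun k => (1 + freqNorm k ^ j) * ‖torusCoeff f k‖) :
    bENorm j f = ENNReal.ofReal (∑' k, (1 + freqNorm k ^ j) * ‖torusCoeff f k‖) := by
  rw [bENorm, ENNReal.ofReal_tsum_of_nonneg _ hs]
  intro k
  have := freqNorm_nonneg k
  positivity

lemma bNorm_eq {f : Euc n → ℝ}
    (hs : Summable fun k => (1 + freqNorm k ^ j) * ‖torusCoeff f k‖) :
    bNorm j f = ∑' k, (1 + freqNorm k ^ j) * ‖torusCoeff f k‖ := by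
  rw [bNorm, bENorm_eq_ofReal hs, ENNReal.toReal_ofReal]
  exact tsum_nonneg fun k => by have := freqNorm_nonneg k; positivity

lemma MemB.summable {f : Euc n → ℝ} (hf : MemB j f) :
    Summable fun k => (1 + freqNorm k ^ j) * ‖torusCoeff f k‖ := by
  have := ENNReal.summable_toReal hf.2.2.ne
  refine this.congr fun k => ?_
  rw [ENNReal.toReal_ofReal]
  have := freqNorm_nonneg k
  positivity

lemma MemB.trig_eq {f : Euc n → ℝ} (hf : MemB j f) : trig (torusCoeff f) = f :=
  trig_torusCoeff hf.1 hf.2.1 (summable_of_weight hf.summable)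

lemma memB_of_summable {f : Euc n → ℝ} (hf : Continuous f) (hp : TorusPeriodic f)
    (hs : Summable fun k => (1 + freqNorm k ^ j) * ‖torusCoeff f k‖) : MemB j f :=
  ⟨hf, hp, by rw [bENorm_eq_ofReal hs]; exact ENNReal.ofReal_lt_top⟩

/-! ### The weights -/

/-- The full Fourier weight `(1 + |k|ʲ) e^{β(t)|k|}`. -/
def wt (T α : ℝ) (j : ℕ) (t : ℝ) (k : Fin n → ℤ) : ℝ :=
  (1 + freqNorm k ^ j) * Real.exp (weight T α t * freqNorm k)

lemma wt_pos (t : ℝ) (k : Fin n → ℤ) : 0 < wt T α j t k := by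
  have := freqNorm_nonneg k
  unfold wt; positivity

lemma weight_nonneg (hT : 0 < T) (hα : 0 ≤ α) {t : ℝ} (ht : t ∈ Icc 0 T) :
    0 ≤ weight T α t := by
  unfold weight
  split_ifs
  · have := ht.1; positivity
  · rw [sub_nonneg, div_le_iff₀ hT]
    have := ht.2
    gcongr

lemma one_add_pow_le_wt (hT : 0 < T) (hα : 0 ≤ α) {t : ℝ} (ht : t ∈ Icc 0 T) (k : Fin n → ℤ) :
    1 + freqNorm k ^ j ≤ wt T α j t k := by
  refine le_mul_of_one_le_right (zero_le_one.trans (one_le_one_add_pow j k)) ?_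
  exact Real.one_le_exp (mul_nonneg (weight_nonneg hT hα ht) (freqNorm_nonneg k))

lemma one_le_wt (hT : 0 < T) (hα : 0 ≤ α) {t : ℝ} (ht : t ∈ Icc 0 T) (k : Fin n → ℤ) :
    1 ≤ wt T α j t k :=
  (one_le_one_add_pow j k).trans (one_add_pow_le_wt hT hα ht k)

lemma wt_neg (t : ℝ) (k : Fin n → ℤ) : wt T α j t (-k) = wt T α j t k := by
  simp [wt, freqNorm_neg]

lemma continuous_weight (hT : 0 < T) : Continuous (weight T α) := by
  unfold weight
  refine Continuous.if_le (by fun_prop) (by fun_prop) (by fun_prop) (by fun_prop) ?_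
  rintro t rfl
  field_simp
  ring

lemma continuous_wt (hT : 0 < T) (k : Fin n → ℤ) : Continuous fun t => wt T α j t k := by
  have := continuous_weight (α := α) hT
  unfold wt
  fun_prop

/-! ### The space-time spaces -/

/-- The supremum over time of a weighted Fourier coefficient. -/
def stSup (T α : ℝ) (j : ℕ) (f : ℝ → Euc n → ℝ) (k : Fin n → ℤ) : ℝ :=
  (⨆ t ∈ Icc (0 : ℝ) T, ENNReal.ofReal (wt T α j t k * ‖torusCoeff (f t) k‖)).toReal

lemma stENorm_eq (f : ℝ → Euc n → ℝ) : stENorm T α j f =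
    ∑' k : Fin n → ℤ, ⨆ t ∈ Icc (0 : ℝ) T,
      ENNReal.ofReal (wt T α j t k * ‖torusCoeff (f t) k‖) := rfl

lemma stSup_nonneg (f : ℝ → Euc n → ℝ) (k : Fin n → ℤ) : 0 ≤ stSup T α j f k :=
  ENNReal.toReal_nonneg

lemma stNorm_nonneg (f : ℝ → Euc n → ℝ) : 0 ≤ stNorm T α j f := ENNReal.toReal_nonneg

lemma stENorm_le {f : ℝ → Euc n → ℝ} {M : (Fin n → ℤ) → ℝ} (hM : Summable M)
    (hM0 : ∀ k, 0 ≤ M k)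
    (hb : ∀ t ∈ Icc 0 T, ∀ k, wt T α j t k * ‖torusCoeff (f t) k‖ ≤ M k) :
    stENorm T α j f ≤ ENNReal.ofReal (∑' k, M k) := by
  rw [stENorm_eq, ENNReal.ofReal_tsum_of_nonneg hM0 hM]
  exact ENNReal.tsum_le_tsum fun k => iSup₂_le fun t ht => ENNReal.ofReal_le_ofReal (hb t ht k)

lemma stNorm_le {f : ℝ → Euc n → ℝ} {M : (Fin n → ℤ) → ℝ} (hM : Summable M)
    (hM0 : ∀ k, 0 ≤ M k)
    (hb : ∀ t ∈ Icc 0 T, ∀ k, wt T α j t k * ‖torusCoeff (f t) k‖ ≤ M k) :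
    stNorm T α j f ≤ ∑' k, M k :=
  ENNReal.toReal_le_of_le_ofReal (tsum_nonneg hM0) (stENorm_le hM hM0 hb)

section Elim

variable {f : ℝ → Euc n → ℝ}

lemma MemST.coeff_le (hf : MemST T α j f) {t : ℝ} (ht : t ∈ Icc 0 T) (k : Fin n → ℤ) :
    wt T α j t k * ‖torusCoeff (f t) k‖ ≤ stSup T α j f k := by
  have h1 := ENNReal.ne_top_of_tsum_ne_top (hf.2.2.ne) k
  refine (ENNReal.ofReal_le_iff_le_toReal h1).1 ?_
  exact le_iSup₂ (f := fun t _ => ENNReal.ofReal (wt T α j t k * ‖torusCoeff (f t) k‖)) t ht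

lemma MemST.summable_stSup (hf : MemST T α j f) : Summable (stSup T α j f) :=
  ENNReal.summable_toReal hf.2.2.ne

lemma MemST.tsum_stSup (hf : MemST T α j f) : ∑' k, stSup T α j f k = stNorm T α j f := by
  exact (ENNReal.tsum_toReal_eq (ENNReal.ne_top_of_tsum_ne_top hf.2.2.ne)).symm

lemma MemST.norm_coeff_le (hf : MemST T α j f) (hT : 0 < T) (hα : 0 ≤ α) {t : ℝ}
    (ht : t ∈ Icc 0 T) (k : Fin n → ℤ) : ‖torusCoeff (f t) k‖ ≤ stSup T α j f k :=
  (le_mul_of_one_le_left (norm_nonneg _) (one_le_wt hT hα ht k)).trans (hf.coeff_le ht k)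

lemma MemST.weight_coeff_le (hf : MemST T α j f) (hT : 0 < T) (hα : 0 ≤ α) {t : ℝ}
    (ht : t ∈ Icc 0 T) (k : Fin n → ℤ) :
    (1 + freqNorm k ^ j) * ‖torusCoeff (f t) k‖ ≤ stSup T α j f k :=
  (mul_le_mul_of_nonneg_right (one_add_pow_le_wt hT hα ht k) (norm_nonneg _)).trans
    (hf.coeff_le ht k)

lemma MemST.continuous (hf : MemST T α j f) {t : ℝ} (ht : t ∈ Icc 0 T) : Continuous (f t) :=
  (hf.1 t ht).1

lemma MemST.periodic (hf : MemST T α j f) {t : ℝ} (ht : t ∈ Icc 0 T) : TorusPeriodic (f t) :=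
  (hf.1 t ht).2.1

lemma MemST.trig_eq (hf : MemST T α j f) {t : ℝ} (ht : t ∈ Icc 0 T) :
    trig (torusCoeff (f t)) = f t := (hf.1 t ht).trig_eq

lemma MemST.continuousOn_coeff (hf : MemST T α j f) (k : Fin n → ℤ) :
    ContinuousOn (fun t => torusCoeff (f t) k) (Icc 0 T) := by
  intro t ht
  rw [ContinuousWithinAt, tendsto_iff_norm_sub_tendsto_zero]
  have h1 := hf.2.1 t ht
  have h2 : Tendsto (fun s => ENNReal.ofReal ‖torusCoeff (f s) k - torusCoeff (f t) k‖)
      (𝓝[Icc 0 T] t) (𝓝 0) := by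
    refine tendsto_of_tendsto_of_tendsto_of_le_of_le' tendsto_const_nhds h1
      (Eventually.of_forall fun _ => bot_le) ?_
    filter_upwards [self_mem_nhdsWithin] with s hs
    rw [← torusCoeff_sub (hf.continuous hs) (hf.continuous ht)]
    refine le_trans (ENNReal.ofReal_le_ofReal ?_) (ENNReal.le_tsum k)
    exact le_mul_of_one_le_left (norm_nonneg _) (one_le_one_add_pow j k)
  have h3 := (ENNReal.tendsto_toReal ENNReal.zero_ne_top).comp h2
  simpa [Function.comp_def, ENNReal.toReal_ofReal] using h3

end Elim

/-- The working criterion for membership. Since e^{β|k|} ≥ 1, the time-independent majorant also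
dominates the Bʲ norm, so continuity of each mode upgrades to continuity in time with values in Bʲ
by dominated convergence. -/
lemma memST_of_coeff (hT : 0 < T) (hα : 0 ≤ α) {f : ℝ → Euc n → ℝ} {M : (Fin n → ℤ) → ℝ}
    (h1 : ∀ t ∈ Icc 0 T, Continuous (f t)) (h2 : ∀ t ∈ Icc 0 T, TorusPeriodic (f t))
    (h3 : ∀ k, ContinuousOn (fun t => torusCoeff (f t) k) (Icc 0 T)) (hM : Summable M)
    (hb : ∀ t ∈ Icc 0 T, ∀ k, wt T α j t k * ‖torusCoeff (f t) k‖ ≤ M k) :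
    MemST T α j f := by
  have hT0 : (0 : ℝ) ∈ Icc 0 T := left_mem_Icc.2 hT.le
  have hM0 : ∀ k, 0 ≤ M k := fun k =>
    (mul_nonneg (wt_pos _ _).le (norm_nonneg _)).trans (hb 0 hT0 k)
  have hw : ∀ t ∈ Icc 0 T, ∀ k, (1 + freqNorm k ^ j) * ‖torusCoeff (f t) k‖ ≤ M k :=
    fun t ht k => (mul_le_mul_of_nonneg_right (one_add_pow_le_wt hT hα ht k)
      (norm_nonneg _)).trans (hb t ht k)
  have hnn : ∀ (k : Fin n → ℤ), 0 ≤ 1 + freqNorm k ^ j :=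
    fun k => zero_le_one.trans (one_le_one_add_pow j k)
  refine ⟨fun t ht => memB_of_summable (h1 t ht) (h2 t ht) ?_, fun t ht => ?_,
    (stENorm_le hM hM0 hb).trans_lt ENNReal.ofReal_lt_top⟩
  · exact Summable.of_nonneg_of_le (fun k => mul_nonneg (hnn k) (norm_nonneg _)) (hw t ht) hM
  · have hd : ∀ s ∈ Icc 0 T, ∀ k,
        (1 + freqNorm k ^ j) * ‖torusCoeff (f s) k - torusCoeff (f t) k‖ ≤ M k + M k := by
      intro s hs k
      refine le_trans ?_ (add_le_add (hw s hs k) (hw t ht k))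
      rw [← mul_add]
      exact mul_le_mul_of_nonneg_left (norm_sub_le _ _) (hnn k)
    have hlim : Tendsto (fun s => ∑' k,
        (1 + freqNorm k ^ j) * ‖torusCoeff (f s) k - torusCoeff (f t) k‖) (𝓝[Icc 0 T] t)
        (𝓝 (∑' k : Fin n → ℤ, (0 : ℝ))) := by
      refine tendsto_tsum_of_dominated_convergence (hM.add hM) (fun k => ?_) ?_
      · have := tendsto_iff_norm_sub_tendsto_zero.1 (h3 k t ht)
        simpa using this.const_mul (1 + freqNorm k ^ j)
      · filter_upwards [self_mem_nhdsWithin] with s hs k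
        rw [Real.norm_of_nonneg (mul_nonneg (hnn k) (norm_nonneg _))]
        exact hd s hs k
    rw [tsum_zero] at hlim
    have h4 := (ENNReal.continuous_ofReal.tendsto 0).comp hlim
    rw [ENNReal.ofReal_zero] at h4
    refine h4.congr' ?_
    filter_upwards [self_mem_nhdsWithin] with s hs
    have h5 : ∀ k, torusCoeff (fun x => f s x - f t x) k = torusCoeff (f s) k - torusCoeff (f t) k :=
      torusCoeff_sub (h1 s hs) (h1 t ht)
    rw [bENorm_eq_ofReal]
    · simp only [Function.comp_apply, h5]
    · simp only [h5]
      exact Summable.of_nonneg_of_le (fun k => mul_nonneg (hnn k) (norm_nonneg _)) (hd s hs)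
        (hM.add hM)

lemma weighted_herm_le {c : ℝ → (Fin n → ℤ) → ℂ} {M : (Fin n → ℤ) → ℝ}
    (hb : ∀ t ∈ Icc 0 T, ∀ k, wt T α j t k * ‖c t k‖ ≤ M k) {t : ℝ} (ht : t ∈ Icc 0 T)
    (k : Fin n → ℤ) : wt T α j t k * ‖herm (c t) k‖ ≤ (M k + M (-k)) / 2 := by
  have h1 := hb t ht k
  have h2 := hb t ht (-k)
  rw [wt_neg] at h2
  have h3 := mul_le_mul_of_nonneg_left (norm_herm_le (c t) k) (wt_pos (T := T) (α := α) (j := j) t k).le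
  linarith

/-- Symmetrizing a majorant preserves its sum, so passing to the Hermitian part costs nothing in
norm. -/
lemma tsum_symm {M : (Fin n → ℤ) → ℝ} (hM : Summable M) :
    ∑' k, (M k + M (-k)) / 2 = ∑' k, M k := by
  rw [tsum_div_const, hM.tsum_add (summable_comp_neg.2 hM), tsum_comp_neg]
  ring

/-- Trigonometric series with dominated coefficients lie in the space-time spaces. -/
lemma memST_trig (hT : 0 < T) (hα : 0 ≤ α) {c : ℝ → (Fin n → ℤ) → ℂ} {M : (Fin n → ℤ) → ℝ}
    (h3 : ∀ k, ContinuousOn (fun t => c t k) (Icc 0 T)) (hM : Summable M)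
    (hb : ∀ t ∈ Icc 0 T, ∀ k, wt T α j t k * ‖c t k‖ ≤ M k) :
    MemST T α j (fun t => trig (c t)) ∧ stNorm T α j (fun t => trig (c t)) ≤ ∑' k, M k := by
  have hT0 : (0 : ℝ) ∈ Icc 0 T := left_mem_Icc.2 hT.le
  have hM0 : ∀ k, 0 ≤ M k := fun k =>
    (mul_nonneg (wt_pos _ _).le (norm_nonneg _)).trans (hb 0 hT0 k)
  have hs : ∀ t ∈ Icc 0 T, Summable fun k => ‖c t k‖ := fun t ht =>
    Summable.of_nonneg_of_le (fun _ => norm_nonneg _)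
      (fun k => (le_mul_of_one_le_left (norm_nonneg _) (one_le_wt hT hα ht k)).trans (hb t ht k)) hM
  have hM' : Summable fun k => (M k + M (-k)) / 2 :=
    (hM.add (summable_comp_neg.2 hM)).div_const 2
  have hb' : ∀ t ∈ Icc 0 T, ∀ k,
      wt T α j t k * ‖torusCoeff (trig (c t)) k‖ ≤ (M k + M (-k)) / 2 := fun t ht k => by
    rw [torusCoeff_trig (hs t ht)]
    exact weighted_herm_le hb ht k
  refine ⟨memST_of_coeff hT hα (fun t ht => continuous_trig (hs t ht))
    (fun t _ => periodic_trig _) (fun k => ?_) hM' hb', ?_⟩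
  · refine ContinuousOn.congr (f := fun t => herm (c t) k) ?_
      (fun t ht => torusCoeff_trig (hs t ht) k)
    exact ((h3 k).add (Complex.continuous_conj.comp_continuousOn (h3 (-k)))).div_const 2
  · rw [← tsum_symm hM]
    exact stNorm_le hM' (fun k => by have := hM0 k; have := hM0 (-k); positivity) hb'

section Operations

variable {f g : ℝ → Euc n → ℝ}

lemma stNorm_congr (h : ∀ t ∈ Icc 0 T, f t = g t) : stNorm T α j f = stNorm T α j g := by
  have : stENorm T α j f = stENorm T α j g := by
    simp only [stENorm_eq]
    refine tsum_congr fun k => iSup_congr fun t => iSup_congr fun ht => ?_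
    rw [h t ht]
  rw [stNorm, stNorm, this]

lemma MemST.congr (hT : 0 < T) (hα : 0 ≤ α) (hf : MemST T α j f)
    (h : ∀ t ∈ Icc 0 T, f t = g t) : MemST T α j g :=
  memST_of_coeff hT hα (fun t ht => by rw [← h t ht]; exact hf.continuous ht)
    (fun t ht => by rw [← h t ht]; exact hf.periodic ht)
    (fun k => (hf.continuousOn_coeff k).congr fun t ht => by simp only [h t ht])
    hf.summable_stSup (fun t ht k => by rw [← h t ht]; exact hf.coeff_le ht k)

lemma stNorm_zero : stNorm T α j (fun (_ : ℝ) (_ : Euc n) => (0 : ℝ)) = 0 := by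
  refine le_antisymm ?_ (stNorm_nonneg _)
  refine (stNorm_le (M := fun _ => 0) summable_zero (fun _ => le_rfl) fun t _ k => ?_).trans
    (by simp)
  rw [torusCoeff_zero]; simp

lemma memST_zero (hT : 0 < T) (hα : 0 ≤ α) :
    MemST T α j (fun (_ : ℝ) (_ : Euc n) => (0 : ℝ)) :=
  memST_of_coeff (M := fun _ => 0) hT hα (fun _ _ => continuous_const) (fun _ _ _ _ => rfl)
    (fun _ => continuousOn_const) summable_zero (fun t _ k => by rw [torusCoeff_zero]; simp)

lemma MemST.add (hT : 0 < T) (hα : 0 ≤ α) (hf : MemST T α j f) (hg : MemST T α j g) :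
    MemST T α j (fun t x => f t x + g t x) ∧
      stNorm T α j (fun t x => f t x + g t x) ≤ stNorm T α j f + stNorm T α j g := by
  have hb : ∀ t ∈ Icc 0 T, ∀ k, wt T α j t k * ‖torusCoeff (fun x => f t x + g t x) k‖
      ≤ stSup T α j f k + stSup T α j g k := fun t ht k => by
    rw [torusCoeff_add (hf.continuous ht) (hg.continuous ht)]
    refine (mul_le_mul_of_nonneg_left (norm_add_le _ _) (wt_pos _ _).le).trans ?_
    rw [mul_add]
    exact add_le_add (hf.coeff_le ht k) (hg.coeff_le ht k)
  have hM := hf.summable_stSup.add hg.summable_stSup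
  refine ⟨memST_of_coeff hT hα (fun t ht => (hf.continuous ht).add (hg.continuous ht))
    (fun t ht i x => by simp only [hf.periodic ht i x, hg.periodic ht i x]) (fun k => ?_) hM hb, ?_⟩
  · exact ((hf.continuousOn_coeff k).add (hg.continuousOn_coeff k)).congr fun t ht =>
      torusCoeff_add (hf.continuous ht) (hg.continuous ht) k
  · rw [← hf.tsum_stSup, ← hg.tsum_stSup, ← hf.summable_stSup.tsum_add hg.summable_stSup]
    exact stNorm_le hM (fun k => add_nonneg (stSup_nonneg _ _) (stSup_nonneg _ _)) hb

lemma MemST.const_mul (hT : 0 < T) (hα : 0 ≤ α) (hf : MemST T α j f) (a : ℝ) :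
    MemST T α j (fun t x => a * f t x) ∧
      stNorm T α j (fun t x => a * f t x) ≤ |a| * stNorm T α j f := by
  have hb : ∀ t ∈ Icc 0 T, ∀ k, wt T α j t k * ‖torusCoeff (fun x => a * f t x) k‖
      ≤ |a| * stSup T α j f k := fun t ht k => by
    rw [torusCoeff_const_mul, norm_mul, Complex.norm_real, Real.norm_eq_abs, mul_left_comm]
    exact mul_le_mul_of_nonneg_left (hf.coeff_le ht k) (abs_nonneg _)
  have hM := hf.summable_stSup.mul_left |a|
  refine ⟨memST_of_coeff hT hα (fun t ht => (hf.continuous ht).const_mul a)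
    (fun t ht i x => by simp only [hf.periodic ht i x]) (fun k => ?_) hM hb, ?_⟩
  · exact ((hf.continuousOn_coeff k).const_mul (a : ℂ)).congr fun t ht =>
      torusCoeff_const_mul a _ k
  · rw [← hf.tsum_stSup, ← tsum_mul_left]
    exact stNorm_le hM (fun k => mul_nonneg (abs_nonneg _) (stSup_nonneg _ _)) hb

lemma MemST.sub (hT : 0 < T) (hα : 0 ≤ α) (hf : MemST T α j f) (hg : MemST T α j g) :
    MemST T α j (fun t x => f t x - g t x) ∧
      stNorm T α j (fun t x => f t x - g t x) ≤ stNorm T α j f + stNorm T α j g := by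
  have h1 := hg.const_mul hT hα (-1)
  have h2 := hf.add hT hα h1.1
  have h3 : (fun t x => f t x + -1 * g t x) = fun t x => f t x - g t x := by
    ext t x; ring
  rw [h3] at h2
  refine ⟨h2.1, h2.2.trans ?_⟩
  have := h1.2
  simp only [abs_neg, abs_one, one_mul] at this ⊢
  linarith

lemma MemST.proj (hT : 0 < T) (hα : 0 ≤ α) (hf : MemST T α j f) :
    MemST T α j (fun t => proj (f t)) ∧ stNorm T α j (fun t => proj (f t)) ≤ stNorm T α j f := by
  have hb : ∀ t ∈ Icc 0 T, ∀ k, wt T α j t k * ‖torusCoeff (MFG.proj (f t)) k‖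
      ≤ stSup T α j f k := fun t ht k => by
    rw [torusCoeff_proj (hf.continuous ht)]
    split_ifs
    · simpa using stSup_nonneg f k
    · exact hf.coeff_le ht k
  refine ⟨memST_of_coeff hT hα (fun t ht => (hf.continuous ht).sub continuous_const)
    (fun t ht i x => by simp only [MFG.proj, hf.periodic ht i x]) (fun k => ?_)
    hf.summable_stSup hb, ?_⟩
  · refine ContinuousOn.congr (f := fun t => if k = 0 then 0 else torusCoeff (f t) k) ?_
      fun t ht => torusCoeff_proj (hf.continuous ht) k
    split_ifs
    exacts [continuousOn_const, hf.continuousOn_coeff k]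
  · rw [← hf.tsum_stSup]
    exact stNorm_le hf.summable_stSup (fun k => stSup_nonneg _ _) hb

/-- The exponential factor is submultiplicative by the triangle inequality and β ≥ 0. The asymmetric
form, order 2 against order at most 1, fits the products μΘ with Θ in 𝓑_α¹ and μb with b in 𝓑_α⁰. -/
lemma wt_add_le (hT : 0 < T) (hα : 0 ≤ α) (hj : j ≤ 1) {t : ℝ} (ht : t ∈ Icc 0 T)
    (k l : Fin n → ℤ) : wt T α j t (k + l) ≤ 2 * (wt T α 2 t k * wt T α j t l) := by
  have hk := freqNorm_nonneg k
  have hl := freqNorm_nonneg l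
  have hkl := freqNorm_add_le k l
  have h1 : (1 + freqNorm (k + l) ^ j) ≤ 2 * ((1 + freqNorm k ^ 2) * (1 + freqNorm l ^ j)) := by
    interval_cases j
    · simp only [pow_zero]
      nlinarith [sq_nonneg (freqNorm k)]
    · simp only [pow_one]
      nlinarith [sq_nonneg (freqNorm k - 1), mul_nonneg (sq_nonneg (freqNorm k)) hl]
  have h2 : Real.exp (weight T α t * freqNorm (k + l))
      ≤ Real.exp (weight T α t * freqNorm k) * Real.exp (weight T α t * freqNorm l) := by
    rw [← Real.exp_add, ← mul_add]
    exact Real.exp_le_exp.2 (mul_le_mul_of_nonneg_left hkl (weight_nonneg hT hα ht))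
  calc wt T α j t (k + l) ≤ _ := mul_le_mul h1 h2 (Real.exp_pos _).le (by positivity)
    _ = _ := by unfold wt; ring

/-- The shear `(l, k) ↦ (k, l - k)`. -/
def convEquiv (A : Type*) [AddCommGroup A] : A × A ≃ A × A where
  toFun q := (q.2, q.1 - q.2)
  invFun q := (q.1 + q.2, q.1)
  left_inv q := by simp
  right_inv q := by simp

/-- Young's inequality in ℓ¹, an equality for nonnegative families: the shear turns the product
double sum into the convolution sum. -/
lemma hasSum_convolution {A : Type*} [AddCommGroup A] {F G : A → ℝ} (hF : Summable F)
    (hG : Summable G) (hF0 : ∀ k, 0 ≤ F k) (hG0 : ∀ k, 0 ≤ G k) :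
    (∀ l, Summable fun k => F k * G (l - k)) ∧
      HasSum (fun l => ∑' k, F k * G (l - k)) ((∑' k, F k) * ∑' k, G k) := by
  have h1 := hF.mul_of_nonneg hG hF0 hG0
  have h2 := hF.hasSum.mul hG.hasSum h1
  have h3 : HasSum (fun q : A × A => F q.2 * G (q.1 - q.2)) ((∑' k, F k) * ∑' k, G k) :=
    (convEquiv A).hasSum_iff.2 h2
  have h4 : ∀ l, Summable fun k => F k * G (l - k) := fun l => h3.summable.prod_factor l
  exact ⟨h4, h3.prod_fiberwise fun l => (h4 l).hasSum⟩

/-- Coefficients of a product convolve. The suprema over time are taken before convolving, which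
gives a summable majorant independent of t. -/
lemma MemST.mul (hT : 0 < T) (hα : 0 ≤ α) (hj : j ≤ 1) (hf : MemST T α 2 f)
    (hg : MemST T α j g) :
    MemST T α j (fun t x => f t x * g t x) ∧
      stNorm T α j (fun t x => f t x * g t x) ≤ 2 * (stNorm T α 2 f * stNorm T α j g) := by
  obtain ⟨hrow, hsum⟩ := hasSum_convolution hf.summable_stSup hg.summable_stSup
    (stSup_nonneg f) (stSup_nonneg g)
  have hcoef : ∀ t ∈ Icc 0 T, ∀ l, HasSum (fun k => torusCoeff (f t) k * torusCoeff (g t) (l - k))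
      (torusCoeff (fun x => f t x * g t x) l) := fun t ht l =>
    torusCoeff_mul (hf.continuous ht) (hg.continuous ht) (hf.periodic ht)
      (summable_of_weight (hf.1 t ht).summable) l
  have hM := hsum.summable.mul_left 2
  have hb : ∀ t ∈ Icc 0 T, ∀ l, wt T α j t l * ‖torusCoeff (fun x => f t x * g t x) l‖
      ≤ 2 * ∑' k, stSup T α 2 f k * stSup T α j g (l - k) := by
    intro t ht l
    rw [← (hcoef t ht l).tsum_eq, ← tsum_mul_left, ← le_div_iff₀' (wt_pos _ _), ← tsum_div_const]
    refine tsum_of_norm_bounded (((hrow l).mul_left 2).div_const _).hasSum fun k => ?_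
    rw [le_div_iff₀' (wt_pos _ _), norm_mul]
    have h1 := wt_add_le hT hα hj ht k (l - k)
    rw [add_sub_cancel] at h1
    calc wt T α j t l * (‖torusCoeff (f t) k‖ * ‖torusCoeff (g t) (l - k)‖)
        ≤ 2 * (wt T α 2 t k * wt T α j t (l - k)) *
          (‖torusCoeff (f t) k‖ * ‖torusCoeff (g t) (l - k)‖) := by gcongr
      _ = 2 * ((wt T α 2 t k * ‖torusCoeff (f t) k‖) *
          (wt T α j t (l - k) * ‖torusCoeff (g t) (l - k)‖)) := by ring
      _ ≤ _ := by
        have hp := wt_pos (T := T) (α := α) (j := j) t (l - k)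
        have hs := stSup_nonneg (T := T) (α := α) (j := 2) f k
        gcongr
        · exact hf.coeff_le ht k
        · exact hg.coeff_le ht _
  refine ⟨memST_of_coeff hT hα (fun t ht => (hf.continuous ht).mul (hg.continuous ht))
    (fun t ht i x => by simp only [hf.periodic ht i x, hg.periodic ht i x]) (fun l => ?_) hM hb, ?_⟩
  · refine ContinuousOn.congr ?_ fun t ht => (hcoef t ht l).tsum_eq.symm
    refine continuousOn_tsum (fun k => (hf.continuousOn_coeff k).mul (hg.continuousOn_coeff _))
      (hrow l) fun k t ht => ?_
    rw [norm_mul]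
    exact mul_le_mul (hf.norm_coeff_le hT hα ht k) (hg.norm_coeff_le hT hα ht _) (norm_nonneg _)
      (stSup_nonneg _ _)
  · rw [← hf.tsum_stSup, ← hg.tsum_stSup, ← hsum.tsum_eq, ← tsum_mul_left]
    exact stNorm_le hM (fun k => mul_nonneg zero_le_two
      (tsum_nonneg fun _ => mul_nonneg (stSup_nonneg _ _) (stSup_nonneg _ _))) hb

lemma herm_dcoef {c : (Fin n → ℤ) → ℂ} (hc : herm c = c) (i : Fin n) :
    herm (dcoef i c) = dcoef i c := by
  ext k
  have h := congrFun hc k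
  simp only [herm, dcoef, map_mul, Complex.conj_I, Pi.neg_apply, Int.cast_neg, map_neg] at *
  have h2 : conj ((k i : ℤ) : ℂ) = (k i : ℂ) := by simp
  rw [h2]
  linear_combination (Complex.I * k i) * h

lemma MemST.summable_coeff (hf : MemST T α j f) {t : ℝ} (ht : t ∈ Icc 0 T) :
    Summable fun k => (1 + freqNorm k ^ j) * ‖torusCoeff (f t) k‖ := (hf.1 t ht).summable

lemma MemST.spaceGrad_eq (hf : MemST T α (j + 1) f) {t : ℝ} (ht : t ∈ Icc 0 T) (x : Euc n)
    (i : Fin n) : spaceGrad f t x i = trig (dcoef i (torusCoeff (f t))) x := by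
  rw [spaceGrad]
  conv_lhs => rw [← hf.trig_eq ht]
  exact gradient_trig (summable_weight_of_le (show 1 ≤ j + 1 by omega) (hf.summable_coeff ht)) x i

lemma wt_mul_dcoef_le (t : ℝ) (i : Fin n) (c : (Fin n → ℤ) → ℂ) (k : Fin n → ℤ) :
    wt T α j t k * ‖dcoef i c k‖ ≤ 2 * (wt T α (j + 1) t k * ‖c k‖) := by
  have := mul_le_mul_of_nonneg_right (weight_dcoef_le j i c k)
    (Real.exp_pos (weight T α t * freqNorm k)).le
  unfold wt
  linarith

lemma MemST.spaceGrad (hT : 0 < T) (hα : 0 ≤ α) (hf : MemST T α (j + 1) f) (i : Fin n) :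
    MemST T α j (fun t x => spaceGrad f t x i) ∧
      stNorm T α j (fun t x => MFG.spaceGrad f t x i) ≤ 2 * stNorm T α (j + 1) f := by
  have h := memST_trig (j := j) hT hα (c := fun t => dcoef i (torusCoeff (f t)))
    (fun k => (hf.continuousOn_coeff k).const_mul _) (hf.summable_stSup.mul_left 2)
    (fun t ht k => (wt_mul_dcoef_le t i _ k).trans
      (mul_le_mul_of_nonneg_left (hf.coeff_le ht k) zero_le_two))
  have h2 : ∀ t ∈ Icc 0 T, trig (dcoef i (torusCoeff (f t))) = fun x => MFG.spaceGrad f t x i :=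
    fun t ht => funext fun x => (hf.spaceGrad_eq ht x i).symm
  refine ⟨h.1.congr hT hα h2, ?_⟩
  rw [← stNorm_congr h2, ← hf.tsum_stSup, ← tsum_mul_left]
  exact h.2

/-- Trigonometric series with dominated coefficients are jointly continuous. -/
lemma continuousOn_uncurry_trig {c : ℝ → (Fin n → ℤ) → ℂ} {M : (Fin n → ℤ) → ℝ} {s : Set ℝ}
    (h3 : ∀ k, ContinuousOn (fun t => c t k) s) (hM : Summable M)
    (hb : ∀ t ∈ s, ∀ k, ‖c t k‖ ≤ M k) :
    ContinuousOn (fun p : ℝ × Euc n => trig (c p.1) p.2) (s ×ˢ univ) := by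
  refine Complex.continuous_re.comp_continuousOn (continuousOn_tsum (fun k => ?_) hM ?_)
  · refine ContinuousOn.mul ?_ (by fun_prop)
    exact (h3 k).comp continuousOn_fst fun p hp => hp.1
  · intro k p hp
    rw [norm_mul, norm_chi, mul_one]
    exact hb p.1 hp.1 k

lemma MemST.continuousOn_uncurry (hT : 0 < T) (hα : 0 ≤ α) (hf : MemST T α j f) :
    ContinuousOn (fun p : ℝ × Euc n => f p.1 p.2) (Icc 0 T ×ˢ univ) :=
  (continuousOn_uncurry_trig hf.continuousOn_coeff hf.summable_stSup
    fun _ ht k => hf.norm_coeff_le hT hα ht k).congr fun p hp => by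
      simp only [hf.trig_eq hp.1]

/-- This pointwise bound later keeps the density positive. -/
lemma MemST.abs_le_stNorm (hT : 0 < T) (hα : 0 ≤ α) (hf : MemST T α j f) {t : ℝ}
    (ht : t ∈ Icc 0 T) (x : Euc n) : |f t x| ≤ stNorm T α j f := by
  have hs := summable_of_weight (hf.summable_coeff ht)
  rw [← hf.trig_eq ht, ← hf.tsum_stSup]
  exact (abs_trig_le hs x).trans
    (hs.tsum_le_tsum (fun k => hf.norm_coeff_le hT hα ht k) hf.summable_stSup)

end Operations

end

/-! ### Scalar Duhamel formula and the weighted parabolic estimate. -/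

section

variable {n : ℕ} {T α : ℝ}

/-! ### The scalar Duhamel formula -/

/-- The solution of `y' = -κ y + f`, `y(0) = y₀`. -/
def fwd (κ : ℝ) (y₀ : ℂ) (f : ℝ → ℂ) (t : ℝ) : ℂ :=
  (Real.exp (-(κ * t)) : ℂ) * (y₀ + ∫ s in (0 : ℝ)..t, (Real.exp (κ * s) : ℂ) * f s)

/-- The solution of `y' = κ y - f`, `y(T) = y₁`. -/
def bwd (T κ : ℝ) (y₁ : ℂ) (f : ℝ → ℂ) (t : ℝ) : ℂ := fwd κ y₁ (fun s => f (T - s)) (T - t)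

lemma fwd_zero (κ : ℝ) (y₀ : ℂ) (f : ℝ → ℂ) : fwd κ y₀ f 0 = y₀ := by simp [fwd]

lemma bwd_self (κ : ℝ) (y₁ : ℂ) (f : ℝ → ℂ) : bwd T κ y₁ f T = y₁ := by simp [bwd, fwd_zero]

lemma continuousOn_exp_mul {f : ℝ → ℂ} (κ : ℝ) {s : Set ℝ} (hf : ContinuousOn f s) :
    ContinuousOn (fun s : ℝ => (Real.exp (κ * s) : ℂ) * f s) s :=
  ContinuousOn.mul (by fun_prop) hf

lemma uIcc_subset_of_mem {t : ℝ} (ht : t ∈ Icc 0 T) : uIcc 0 t ⊆ Icc 0 T := by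
  rw [uIcc_of_le ht.1]; exact Icc_subset_Icc_right ht.2

lemma intervalIntegrable_exp_mul {f : ℝ → ℂ} (κ : ℝ) (hf : ContinuousOn f (Icc 0 T)) {t : ℝ}
    (ht : t ∈ Icc 0 T) :
    IntervalIntegrable (fun s : ℝ => (Real.exp (κ * s) : ℂ) * f s) volume 0 t :=
  ((continuousOn_exp_mul κ hf).mono (uIcc_subset_of_mem ht)).intervalIntegrable

lemma continuousOn_fwd {f : ℝ → ℂ} (hT : 0 < T) (κ : ℝ) (y₀ : ℂ)
    (hf : ContinuousOn f (Icc 0 T)) : ContinuousOn (fwd κ y₀ f) (Icc 0 T) := by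
  have h1 : ContinuousOn (fun t => ∫ s in (0 : ℝ)..t, (Real.exp (κ * s) : ℂ) * f s) (Icc 0 T) := by
    have h := intervalIntegral.continuousOn_primitive_interval (μ := volume) (a := 0) (b := T)
      (f := fun s : ℝ => (Real.exp (κ * s) : ℂ) * f s) (by
        rw [uIcc_of_le hT.le]
        exact (continuousOn_exp_mul κ hf).integrableOn_compact isCompact_Icc)
    rwa [uIcc_of_le hT.le] at h
  exact ContinuousOn.mul (by fun_prop) (continuousOn_const.add h1)

lemma hasDerivAt_fwd {f : ℝ → ℂ} (κ : ℝ) (y₀ : ℂ) (hf : ContinuousOn f (Icc 0 T)) {t : ℝ}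
    (ht : t ∈ Ioo 0 T) : HasDerivAt (fwd κ y₀ f) (-(κ * fwd κ y₀ f t) + f t) t := by
  have ht' := Ioo_subset_Icc_self ht
  have hc := continuousOn_exp_mul κ hf
  have h1 : HasDerivAt (fun t => ∫ s in (0 : ℝ)..t, (Real.exp (κ * s) : ℂ) * f s)
      ((Real.exp (κ * t) : ℂ) * f t) t := by
    refine intervalIntegral.integral_hasDerivAt_right (intervalIntegrable_exp_mul κ hf ht') ?_
      (hc.continuousAt (Icc_mem_nhds ht.1 ht.2))
    exact (hc.mono Ioo_subset_Icc_self).stronglyMeasurableAtFilter isOpen_Ioo t ht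
  have h2 : HasDerivAt (fun t : ℝ => (Real.exp (-(κ * t)) : ℂ))
      ((Real.exp (-(κ * t)) * (-(κ * 1)) : ℝ) : ℂ) t :=
    ((((hasDerivAt_id t).const_mul κ).neg).exp).ofReal_comp
  refine (h2.mul (h1.const_add y₀)).congr_deriv ?_
  have h3 : (Real.exp (-(κ * t)) : ℂ) * (Real.exp (κ * t) : ℂ) = 1 := by
    rw [← ofReal_mul, ← Real.exp_add]; simp
  rw [fwd]
  rw [ofReal_mul, ofReal_neg, mul_one]
  linear_combination (f t) * h3

/-- Integrating factor: e^{κs} g has derivative e^{κs} f. The equation is needed only on the open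
interval, together with continuity up to its ends. -/
lemma eq_fwd_of_hasDerivAt {f g : ℝ → ℂ} {κ : ℝ} (hf : ContinuousOn f (Icc 0 T))
    (hg : ContinuousOn g (Icc 0 T))
    (hd : ∀ t ∈ Ioo 0 T, HasDerivAt g (-(κ * g t) + f t) t) {t : ℝ} (ht : t ∈ Icc 0 T) :
    g t = fwd κ (g 0) f t := by
  have hsub : Icc 0 t ⊆ Icc 0 T := Icc_subset_Icc_right ht.2
  have h := intervalIntegral.integral_eq_sub_of_hasDerivAt_of_le (a := 0) (b := t)
    (f := fun s : ℝ => (Real.exp (κ * s) : ℂ) * g s)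
    (f' := fun s : ℝ => (Real.exp (κ * s) : ℂ) * f s) ht.1
    (continuousOn_exp_mul κ (hg.mono hsub)) (fun s hs => ?_) (intervalIntegrable_exp_mul κ hf ht)
  · rw [fwd, h]
    have h3 : (Real.exp (-(κ * t)) : ℂ) * (Real.exp (κ * t) : ℂ) = 1 := by
      rw [← ofReal_mul, ← Real.exp_add]; simp
    simp only [mul_zero, Real.exp_zero, ofReal_one]
    linear_combination (-g t) * h3
  · have h2 : HasDerivAt (fun t : ℝ => (Real.exp (κ * t) : ℂ))
        ((Real.exp (κ * s) * (κ * 1) : ℝ) : ℂ) s :=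
      (((hasDerivAt_id s).const_mul κ).exp).ofReal_comp
    refine (h2.mul (hd s ⟨hs.1, hs.2.trans_le ht.2⟩)).congr_deriv ?_
    rw [ofReal_mul, mul_one]
    ring

lemma fwd_sub {f g : ℝ → ℂ} (κ : ℝ) (y z : ℂ) (hf : ContinuousOn f (Icc 0 T))
    (hg : ContinuousOn g (Icc 0 T)) {t : ℝ} (ht : t ∈ Icc 0 T) :
    fwd κ y f t - fwd κ z g t = fwd κ (y - z) (fun s => f s - g s) t := by
  simp only [fwd, mul_sub]
  rw [intervalIntegral.integral_sub (intervalIntegrable_exp_mul κ hf ht)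
    (intervalIntegrable_exp_mul κ hg ht)]
  ring

lemma fwd_congr {f g : ℝ → ℂ} (κ : ℝ) (y : ℂ) (h : ∀ t ∈ Icc 0 T, f t = g t) {t : ℝ}
    (ht : t ∈ Icc 0 T) : fwd κ y f t = fwd κ y g t := by
  rw [fwd, fwd, intervalIntegral.integral_congr fun s hs => ?_]
  simp only [h s (uIcc_subset_of_mem ht hs)]

/-! ### Time reversal -/

lemma sub_mem_Icc_self {t : ℝ} (ht : t ∈ Icc 0 T) : T - t ∈ Icc 0 T :=
  ⟨sub_nonneg.2 ht.2, sub_le_self _ ht.1⟩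

lemma continuousOn_reverse {f : ℝ → ℂ} (hf : ContinuousOn f (Icc 0 T)) :
    ContinuousOn (fun s => f (T - s)) (Icc 0 T) :=
  hf.comp (by fun_prop) fun _ => sub_mem_Icc_self

lemma continuousOn_bwd {f : ℝ → ℂ} (hT : 0 < T) (κ : ℝ) (y₁ : ℂ)
    (hf : ContinuousOn f (Icc 0 T)) : ContinuousOn (bwd T κ y₁ f) (Icc 0 T) :=
  continuousOn_reverse (continuousOn_fwd hT κ y₁ (continuousOn_reverse hf))

lemma hasDerivAt_bwd {f : ℝ → ℂ} (κ : ℝ) (y₁ : ℂ) (hf : ContinuousOn f (Icc 0 T)) {t : ℝ}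
    (ht : t ∈ Ioo 0 T) : HasDerivAt (bwd T κ y₁ f) (κ * bwd T κ y₁ f t - f t) t := by
  have h := hasDerivAt_fwd κ y₁ (continuousOn_reverse hf)
    (t := T - t) ⟨sub_pos.2 ht.2, sub_lt_self _ ht.1⟩
  have h2 := h.comp_const_sub T t
  refine h2.congr_deriv ?_
  simp only [bwd, sub_sub_cancel]
  ring

lemma eq_bwd_of_hasDerivAt {f g : ℝ → ℂ} {κ : ℝ} (hf : ContinuousOn f (Icc 0 T))
    (hg : ContinuousOn g (Icc 0 T))
    (hd : ∀ t ∈ Ioo 0 T, HasDerivAt g (κ * g t - f t) t) {t : ℝ} (ht : t ∈ Icc 0 T) :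
    g t = bwd T κ (g T) f t := by
  have h := eq_fwd_of_hasDerivAt (κ := κ) (continuousOn_reverse hf) (continuousOn_reverse hg)
    (fun s hs => by
      have := (hd (T - s) ⟨sub_pos.2 hs.2, sub_lt_self _ hs.1⟩).comp_const_sub T s
      refine this.congr_deriv ?_
      ring) (sub_mem_Icc_self ht)
  simpa [bwd] using h

lemma bwd_sub {f g : ℝ → ℂ} (κ : ℝ) (y z : ℂ) (hf : ContinuousOn f (Icc 0 T))
    (hg : ContinuousOn g (Icc 0 T)) {t : ℝ} (ht : t ∈ Icc 0 T) :
    bwd T κ y f t - bwd T κ z g t = bwd T κ (y - z) (fun s => f s - g s) t :=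
  fwd_sub κ y z (continuousOn_reverse hf) (continuousOn_reverse hg) (sub_mem_Icc_self ht)

lemma bwd_congr {f g : ℝ → ℂ} (κ : ℝ) (y : ℂ) (h : ∀ t ∈ Icc 0 T, f t = g t) {t : ℝ}
    (ht : t ∈ Icc 0 T) : bwd T κ y f t = bwd T κ y g t :=
  fwd_congr κ y (fun _ hs => h _ (sub_mem_Icc_self hs)) (sub_mem_Icc_self ht)

/-- This symmetry lets every backward estimate follow from the forward one. -/
lemma weight_reverse (T α s : ℝ) (hT : 0 < T) : weight T α (T - s) = weight T α s := by
  unfold weight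
  split_ifs with h1 h2 h2
  · have : s = T / 2 := by linarith
    subst this; ring_nf
  · field_simp
  · field_simp; ring
  · exfalso; linarith

/-- The slope is 2α/T on the first half and its negative on the second, so only an upper bound on
the increase is at stake. -/
lemma weight_sub_le (hT : 0 < T) (hα : 0 ≤ α) {s t : ℝ} (hst : s ≤ t) :
    weight T α t - weight T α s ≤ 2 * α / T * (t - s) := by
  have h0 : 0 ≤ 2 * α / T := by positivity
  have e1 : ∀ x : ℝ, 2 * α * x / T = 2 * α / T * x := fun x => by ring
  have e2 : 2 * α = 2 * α / T * T := by field_simp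
  unfold weight
  split_ifs with h1 h2 h2
  · rw [e1, e1]; linarith
  · exfalso; linarith
  · rw [e1, e1]; nlinarith
  · rw [e1, e1]; nlinarith

lemma weight_zero (hT : 0 < T) : weight T α 0 = 0 := by
  rw [weight, if_pos (by positivity)]; simp

/-- The constant in the parabolic smoothing estimate. -/
def gain (T α : ℝ) : ℝ := 1 / (1 - 2 * α / T)

lemma gain_pos (hT : 0 < T) (hα : α < T / 2) : 0 < gain T α := by
  have : 2 * α / T < 1 := by rw [div_lt_one hT]; linarith
  exact one_div_pos.2 (by linarith)

/-- The parabolic gain. With q = 2α/T and |k| ≥ 1, moving the weight from s to t costs at most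
e^{q(t-s)|k|} ≤ e^{q(t-s)|k|²}. The heat kernel then leaves e^{-(1-q)|k|²(t-s)}, whose integral over
s is at most `gain T α / freqNorm k ^ 2`. -/
lemma norm_fwd_zero_le {f : ℝ → ℂ} (hT : 0 < T) (hα0 : 0 ≤ α) (hα : α < T / 2)
    {k : Fin n → ℤ} (hk : k ≠ 0) {M : ℝ} (hM : 0 ≤ M)
    (hb : ∀ s ∈ Icc 0 T, Real.exp (weight T α s * freqNorm k) * ‖f s‖ ≤ M)
    {t : ℝ} (ht : t ∈ Icc 0 T) :
    Real.exp (weight T α t * freqNorm k) * ‖fwd (freqNorm k ^ 2) 0 f t‖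
      ≤ gain T α / freqNorm k ^ 2 * M := by
  set κ := freqNorm k
  have hκ : 1 ≤ κ := one_le_freqNorm hk
  set q := 2 * α / T with hq
  have hq0 : 0 ≤ q := by positivity
  have hq1 : q < 1 := by rw [hq, div_lt_one hT]; linarith
  -- The decay rate left after the heat kernel has paid for the growth of the weight.
  set μ := (1 - q) * κ ^ 2 with hμ
  have hμ0 : 0 < μ := mul_pos (by linarith) (by positivity)
  have hint : ‖∫ s in (0 : ℝ)..t, (Real.exp (κ ^ 2 * s) : ℂ) * f s‖
      ≤ ∫ s in (0 : ℝ)..t,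
        M * Real.exp (κ ^ 2 * t - weight T α t * κ - μ * t) * Real.exp (μ * s) := by
    refine intervalIntegral.norm_integral_le_of_norm_le ht.1
      (Eventually.of_forall fun s hs => ?_) (Continuous.intervalIntegrable (by fun_prop) _ _)
    have hs' : s ∈ Icc 0 T := ⟨hs.1.le, hs.2.trans ht.2⟩
    have h1 : ‖f s‖ ≤ M * Real.exp (-(weight T α s * κ)) := by
      rw [Real.exp_neg, ← div_eq_mul_inv, le_div_iff₀' (Real.exp_pos _)]
      exact hb s hs'
    rw [norm_mul, Complex.norm_real, Real.norm_of_nonneg (Real.exp_pos _).le, mul_assoc,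
      ← Real.exp_add]
    calc Real.exp (κ ^ 2 * s) * ‖f s‖
        ≤ Real.exp (κ ^ 2 * s) * (M * Real.exp (-(weight T α s * κ))) := by gcongr
      _ = M * Real.exp (κ ^ 2 * s + -(weight T α s * κ)) := by rw [Real.exp_add]; ring
      _ ≤ _ := by
        refine mul_le_mul_of_nonneg_left (Real.exp_le_exp.2 ?_) hM
        have h2 := weight_sub_le hT hα0 hs.2
        have h3 : (weight T α t - weight T α s) * κ ≤ q * (t - s) * κ ^ 2 := by
          calc _ ≤ q * (t - s) * κ := by gcongr
            _ ≤ q * (t - s) * κ ^ 2 := by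
              have : 0 ≤ q * (t - s) := mul_nonneg hq0 (sub_nonneg.2 hs.2)
              gcongr
              nlinarith
        rw [hμ]
        nlinarith
  have hexp : ∫ s in (0 : ℝ)..t, Real.exp (μ * s) ≤ Real.exp (μ * t) / μ := by
    rw [intervalIntegral.integral_comp_mul_left (fun x => Real.exp x) hμ0.ne', integral_exp]
    simp only [mul_zero, Real.exp_zero, smul_eq_mul]
    rw [div_eq_inv_mul]
    gcongr
    linarith
  rw [intervalIntegral.integral_const_mul] at hint
  rw [fwd, zero_add, norm_mul, Complex.norm_real, Real.norm_of_nonneg (Real.exp_pos _).le]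
  calc Real.exp (weight T α t * κ) * (Real.exp (-(κ ^ 2 * t)) *
        ‖∫ s in (0 : ℝ)..t, (Real.exp (κ ^ 2 * s) : ℂ) * f s‖)
      ≤ Real.exp (weight T α t * κ) * (Real.exp (-(κ ^ 2 * t)) *
        (M * Real.exp (κ ^ 2 * t - weight T α t * κ - μ * t) * (Real.exp (μ * t) / μ))) := by
        gcongr
        exact hint.trans (by gcongr)
    _ = (Real.exp (weight T α t * κ) * Real.exp (-(κ ^ 2 * t)) *
        Real.exp (κ ^ 2 * t - weight T α t * κ - μ * t) * Real.exp (μ * t)) * (M / μ) := by ring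
    _ = M / μ := by
        rw [← Real.exp_add, ← Real.exp_add, ← Real.exp_add]
        ring_nf
        simp
    _ = gain T α / κ ^ 2 * M := by
        rw [gain, ← hq, hμ]
        have : (1 - q) ≠ 0 := by linarith
        field_simp

lemma fwd_eq_add (κ : ℝ) (y : ℂ) (f : ℝ → ℂ) (t : ℝ) :
    fwd κ y f t = (Real.exp (-(κ * t)) : ℂ) * y + fwd κ 0 f t := by
  simp only [fwd]; ring

lemma wt_mul_norm_fwd_le {f : ℝ → ℂ} (hT : 0 < T) (hα0 : 0 ≤ α) (hα : α < T / 2)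
    {k : Fin n → ℤ} (hk : k ≠ 0) {M : ℝ} (y : ℂ)
    (hb : ∀ s ∈ Icc 0 T, wt T α 0 s k * ‖f s‖ ≤ M) {t : ℝ} (ht : t ∈ Icc 0 T) :
    wt T α 2 t k * ‖fwd (freqNorm k ^ 2) y f t‖
      ≤ (1 + freqNorm k ^ 2) * ‖y‖ + gain T α * M := by
  have hκ : 1 ≤ freqNorm k := one_le_freqNorm hk
  have hM : 0 ≤ M := (mul_nonneg (wt_pos _ _).le (norm_nonneg _)).trans (hb t ht)
  -- At order 0 the polynomial weight is 1 + |k|⁰ = 2, hence M / 2.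
  have h1 := norm_fwd_zero_le (f := f) hT hα0 hα hk (M := M / 2) (by positivity) (fun s hs => by
    have := hb s hs
    simp only [wt, pow_zero] at this
    linarith) ht
  have h2 : Real.exp (weight T α t * freqNorm k) *
      ‖(Real.exp (-(freqNorm k ^ 2 * t)) : ℂ) * y‖ ≤ ‖y‖ := by
    rw [norm_mul, Complex.norm_real, Real.norm_of_nonneg (Real.exp_pos _).le, ← mul_assoc,
      ← Real.exp_add]
    refine mul_le_of_le_one_left (norm_nonneg _) (Real.exp_le_one_iff.2 ?_)
    -- Since β(0) = 0, β(t) ≤ (2α/T)t ≤ t, so β(t)|k| ≤ |k|²t and the heat factor absorbs the weight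
    -- on the initial datum.
    have h3 := weight_sub_le hT hα0 ht.1
    rw [weight_zero hT, sub_zero, sub_zero] at h3
    have h4 : 2 * α / T * t ≤ t := mul_le_of_le_one_left ht.1 (by rw [div_le_one hT]; linarith)
    have h5 := ht.1
    nlinarith [mul_nonneg h5 (freqNorm_nonneg k)]
  have hg := gain_pos hT hα
  calc wt T α 2 t k * ‖fwd (freqNorm k ^ 2) y f t‖
      ≤ wt T α 2 t k * (‖(Real.exp (-(freqNorm k ^ 2 * t)) : ℂ) * y‖
        + ‖fwd (freqNorm k ^ 2) 0 f t‖) := by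
        rw [fwd_eq_add]
        exact mul_le_mul_of_nonneg_left (norm_add_le _ _) (wt_pos _ _).le
    _ = (1 + freqNorm k ^ 2) * (Real.exp (weight T α t * freqNorm k) *
        ‖(Real.exp (-(freqNorm k ^ 2 * t)) : ℂ) * y‖) + (1 + freqNorm k ^ 2) *
        (Real.exp (weight T α t * freqNorm k) * ‖fwd (freqNorm k ^ 2) 0 f t‖) := by
        rw [wt]; ring
    _ ≤ (1 + freqNorm k ^ 2) * ‖y‖ +
        (1 + freqNorm k ^ 2) * (gain T α / freqNorm k ^ 2 * (M / 2)) := by gcongr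
    _ ≤ _ := by
        have h6 : (1 + freqNorm k ^ 2) * (gain T α / freqNorm k ^ 2 * (M / 2))
            = gain T α * M * ((1 + freqNorm k ^ 2) / (2 * freqNorm k ^ 2)) := by
          field_simp
        rw [h6]
        have h7 : (1 + freqNorm k ^ 2) / (2 * freqNorm k ^ 2) ≤ 1 := by
          rw [div_le_one (by positivity)]; nlinarith
        have := mul_le_mul_of_nonneg_left h7 (mul_nonneg hg.le hM)
        linarith

lemma wt_reverse (hT : 0 < T) (j : ℕ) (t : ℝ) (k : Fin n → ℤ) :
    wt T α j (T - t) k = wt T α j t k := by rw [wt, wt, weight_reverse T α t hT]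

end

/-! ### Fixed points of triangular systems, and the coefficient space. -/

section

/-! ### A fixed point theorem for triangular systems -/

section FixedPoint

variable {X : Type*} [NormedAddCommGroup X] {A B : X → X → X} {K η ρ : ℝ}

/-- Write x, y for the two distances. Then y ≤ η(x + y) and x ≤ Ky + η(x + y); as Kη = 1/16 and η ≤
1/16, x + y ≤ (3/16)(x + y), which forces both to vanish. -/
lemma fixedPoint_pair_unique (hK : 1 ≤ K) (hη : η * (16 * K) = 1)
    (hA : ∀ w w' μ μ', ‖w‖ ≤ ρ → ‖w'‖ ≤ ρ → ‖μ‖ ≤ ρ → ‖μ'‖ ≤ ρ →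
      ‖A w μ - A w' μ'‖ ≤ η * (‖w - w'‖ + ‖μ - μ'‖))
    (hB : ∀ w w' μ μ', ‖w‖ ≤ ρ → ‖w'‖ ≤ ρ → ‖μ‖ ≤ ρ → ‖μ'‖ ≤ ρ →
      ‖B w μ - B w' μ'‖ ≤ K * ‖μ - μ'‖ + η * (‖w - w'‖ + ‖μ - μ'‖))
    {w w' μ μ' : X} (hw : ‖w‖ ≤ ρ) (hw' : ‖w'‖ ≤ ρ) (hμ : ‖μ‖ ≤ ρ) (hμ' : ‖μ'‖ ≤ ρ)
    (h1 : A w μ = μ) (h2 : B w μ = w) (h1' : A w' μ' = μ') (h2' : B w' μ' = w') :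
    w = w' ∧ μ = μ' := by
  have a := hA w w' μ μ' hw hw' hμ hμ'
  have b := hB w w' μ μ' hw hw' hμ hμ'
  rw [h1, h1'] at a
  rw [h2, h2'] at b
  have hx := norm_nonneg (w - w')
  have hy := norm_nonneg (μ - μ')
  set x := ‖w - w'‖
  set y := ‖μ - μ'‖
  have hK0 : 0 < K := by linarith
  have hη0 : 0 < η := by
    by_contra h
    nlinarith
  have hη1 : η ≤ 1 / 16 := by nlinarith
  have hKy : K * y ≤ (x + y) / 16 := by
    have := mul_le_mul_of_nonneg_left a hK0.le
    nlinarith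
  have h3 : η * (x + y) ≤ (x + y) / 16 := by nlinarith
  have hsum : x + y = 0 := by linarith
  have hx0 : x = 0 := by linarith
  have hy0 : y = 0 := by linarith
  exact ⟨sub_eq_zero.1 (norm_eq_zero.1 hx0), sub_eq_zero.1 (norm_eq_zero.1 hy0)⟩

/-- The map (w, μ) ↦ (B w μ, A w μ) need not contract, because K may be large. Replacing μ by A w μ
inside B keeps the same fixed points, and K then occurs only in the product Kη = 1/16. -/
lemma exists_fixedPoint_pair [CompleteSpace X] (hρ : 0 < ρ) (hK : 1 ≤ K) (hη : η * (16 * K) = 1)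
    (hA : ∀ w w' μ μ', ‖w‖ ≤ ρ → ‖w'‖ ≤ ρ → ‖μ‖ ≤ ρ → ‖μ'‖ ≤ ρ →
      ‖A w μ - A w' μ'‖ ≤ η * (‖w - w'‖ + ‖μ - μ'‖))
    (hB : ∀ w w' μ μ', ‖w‖ ≤ ρ → ‖w'‖ ≤ ρ → ‖μ‖ ≤ ρ → ‖μ'‖ ≤ ρ →
      ‖B w μ - B w' μ'‖ ≤ K * ‖μ - μ'‖ + η * (‖w - w'‖ + ‖μ - μ'‖))
    (hA0 : ‖A 0 0‖ ≤ ρ / (8 * K)) (hB0 : B 0 0 = 0) :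
    ∃ w μ, ‖w‖ ≤ ρ / 4 ∧ ‖μ‖ ≤ ρ / 4 ∧ A w μ = μ ∧ B w μ = w := by
  have hK0 : 0 < K := by linarith
  have hη0 : 0 < η := by
    by_contra h
    nlinarith
  have hη1 : η ≤ 1 / 16 := by nlinarith
  have hA0' : K * ‖A 0 0‖ ≤ ρ / 8 := by
    rw [le_div_iff₀ (by positivity)] at hA0
    linarith
  have hKη : ∀ x : ℝ, K * (η * x) = x / 16 := fun x => by linear_combination x / 16 * hη
  -- ρ/8 comes from A 0 0 and ρ/32 from Kη(ρ/4 + ρ/4). The factor K is kept because B will multiply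
  -- by it: the image of B is then at most 5ρ/32 + ρ/32 < ρ/4.
  have hball : ∀ w μ, ‖w‖ ≤ ρ / 4 → ‖μ‖ ≤ ρ / 4 → K * ‖A w μ‖ ≤ ρ / 8 + ρ / 32 := by
    intro w μ hw hμ
    have h := hA w 0 μ 0 (by linarith) (by simpa using hρ.le) (by linarith) (by simpa using hρ.le)
    rw [sub_zero, sub_zero] at h
    have h2 : ‖A w μ‖ ≤ ‖A w μ - A 0 0‖ + ‖A 0 0‖ := by
      simpa using norm_add_le (A w μ - A 0 0) (A 0 0)
    have h3 := mul_le_mul_of_nonneg_left (h2.trans (add_le_add_left h _)) hK0.le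
    rw [mul_add, hKη] at h3
    linarith
  have hball' : ∀ w μ, ‖w‖ ≤ ρ / 4 → ‖μ‖ ≤ ρ / 4 → ‖A w μ‖ ≤ ρ / 4 := by
    intro w μ hw hμ
    have := hball w μ hw hμ
    nlinarith [norm_nonneg (A w μ)]
  set s : Set (X × X) := Metric.closedBall 0 (ρ / 4) with hs
  have hmem : ∀ p : X × X, p ∈ s ↔ ‖p.1‖ ≤ ρ / 4 ∧ ‖p.2‖ ≤ ρ / 4 := fun p => by
    rw [hs, mem_closedBall_zero_iff, Prod.norm_def, max_le_iff]
  set F : X × X → X × X := fun p => (B p.1 (A p.1 p.2), A p.1 p.2) with hF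
  have hmaps : MapsTo F s s := by
    intro p hp
    rw [hmem] at hp ⊢
    have h1 := hball' p.1 p.2 hp.1 hp.2
    refine ⟨?_, h1⟩
    have h := hB p.1 0 (A p.1 p.2) 0 (by linarith) (by simpa using hρ.le) (by linarith)
      (by simpa using hρ.le)
    rw [hB0, sub_zero, sub_zero, sub_zero] at h
    have h2 := hball p.1 p.2 hp.1 hp.2
    have h3 : η * (‖p.1‖ + ‖A p.1 p.2‖) ≤ 1 / 16 * (ρ / 4 + ρ / 4) :=
      mul_le_mul hη1 (add_le_add hp.1 h1) (by positivity) (by positivity)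
    simp only [hF]
    linarith
  have hlip : ContractingWith (1 / 2) (hmaps.restrict F s s) := by
    refine ⟨by rw [← NNReal.coe_lt_coe]; norm_num, LipschitzWith.of_dist_le_mul ?_⟩
    rintro ⟨p, hp⟩ ⟨q, hq⟩
    have hp' := (hmem p).1 hp
    have hq' := (hmem q).1 hq
    simp only [Subtype.dist_eq, MapsTo.val_restrict_apply]
    rw [dist_eq_norm, dist_eq_norm]
    have e1 : ‖p.1 - q.1‖ ≤ ‖p - q‖ := norm_fst_le (p - q)
    have e2 : ‖p.2 - q.2‖ ≤ ‖p - q‖ := norm_snd_le (p - q)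
    have a := hA p.1 q.1 p.2 q.2 (by linarith) (by linarith) (by linarith) (by linarith)
    have a1 := hball' p.1 p.2 hp'.1 hp'.2
    have a2 := hball' q.1 q.2 hq'.1 hq'.2
    have b := hB p.1 q.1 (A p.1 p.2) (A q.1 q.2) (by linarith) (by linarith) (by linarith)
      (by linarith)
    have hd := norm_nonneg (p - q)
    have ka := mul_le_mul_of_nonneg_left a hK0.le
    rw [hKη] at ka
    have a3 : ‖A p.1 p.2 - A q.1 q.2‖ ≤ ‖p - q‖ / 8 := by
      nlinarith [norm_nonneg (A p.1 p.2 - A q.1 q.2)]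
    have b2 : η * (‖p.1 - q.1‖ + ‖A p.1 p.2 - A q.1 q.2‖) ≤ 1 / 16 * (2 * ‖p - q‖) :=
      mul_le_mul hη1 (by linarith) (by positivity) (by positivity)
    rw [Prod.norm_def, max_le_iff]
    simp only [hF, Prod.fst_sub, Prod.snd_sub]
    push_cast
    constructor <;> linarith
  have h0 : (0 : X × X) ∈ s := by rw [hmem]; simp; linarith
  obtain ⟨y, hy, hfix, -⟩ := hlip.exists_fixedPoint' Metric.isClosed_closedBall.isComplete hmaps h0
    (edist_ne_top _ _)
  have h1 : A y.1 y.2 = y.2 := congrArg Prod.snd hfix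
  have h2 : B y.1 (A y.1 y.2) = y.1 := congrArg Prod.fst hfix
  rw [h1] at h2
  exact ⟨y.1, y.2, ((hmem y).1 hy).1, ((hmem y).1 hy).2, h1, h2⟩

end FixedPoint

/-! ### The Banach space of weighted coefficient families -/

variable {n : ℕ} {T α : ℝ}

/-- Weighted Fourier coefficients of elements of `𝓑_α²`. -/
abbrev CoeffSpace (n : ℕ) (T : ℝ) : Type :=
  lp (fun _ : Fin n → ℤ => C(Icc (0 : ℝ) T, ℂ)) 1

lemma hasSum_norm_coeffSpace (a : CoeffSpace n T) : HasSum (fun k => ‖a k‖) ‖a‖ := by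
  simpa using lp.hasSum_norm (by simp) a

/-- Coefficient families that define elements of `𝓑_α²`. -/
def GoodCoeff (T α : ℝ) (c : ℝ → (Fin n → ℤ) → ℂ) : Prop :=
  (∀ k, ContinuousOn (fun t => c t k) (Icc 0 T)) ∧
  ∃ M : (Fin n → ℤ) → ℝ, Summable M ∧ ∀ t ∈ Icc 0 T, ∀ k, wt T α 2 t k * ‖c t k‖ ≤ M k

/-- The coefficient family of an element of the coefficient space, with the weight removed. -/
def cof (hT : 0 < T) (α : ℝ) (a : CoeffSpace n T) (t : ℝ) (k : Fin n → ℤ) : ℂ :=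
  ((wt T α 2 t k)⁻¹ : ℝ) * a k (projIcc 0 T hT.le t)

lemma wt_mul_norm_cof_le (hT : 0 < T) (a : CoeffSpace n T) (t : ℝ) (k : Fin n → ℤ) :
    wt T α 2 t k * ‖cof hT α a t k‖ ≤ ‖a k‖ := by
  have h := wt_pos (T := T) (α := α) (j := 2) t k
  rw [cof, norm_mul, Complex.norm_real, norm_inv, Real.norm_of_nonneg h.le,
    mul_inv_cancel_left₀ h.ne']
  exact (a k).norm_coe_le_norm _

lemma continuousOn_cof (hT : 0 < T) (a : CoeffSpace n T) (k : Fin n → ℤ) :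
    ContinuousOn (fun t => cof hT α a t k) (Icc 0 T) := by
  refine Continuous.continuousOn ?_
  unfold cof
  refine Continuous.mul ?_ ((a k).continuous.comp continuous_projIcc)
  exact Complex.continuous_ofReal.comp ((continuous_wt hT k).inv₀ fun t => (wt_pos t k).ne')

lemma cof_sub (hT : 0 < T) (a b : CoeffSpace n T) (t : ℝ) (k : Fin n → ℤ) :
    cof hT α (a - b) t k = cof hT α a t k - cof hT α b t k := by
  simp [cof, mul_sub]

lemma cof_zero (hT : 0 < T) (t : ℝ) (k : Fin n → ℤ) :
    cof hT α (0 : CoeffSpace n T) t k = 0 := by simp [cof]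

lemma exists_cof_eq (hT : 0 < T) {c : ℝ → (Fin n → ℤ) → ℂ} (hc : GoodCoeff T α c) :
    ∃ a : CoeffSpace n T, ∀ t ∈ Icc 0 T, ∀ k, cof hT α a t k = c t k := by
  obtain ⟨h1, M, hM, hb⟩ := hc
  have hcont : ∀ k, Continuous fun t : Icc (0 : ℝ) T => (wt T α 2 t k : ℂ) * c t k := fun k =>
    (Complex.continuous_ofReal.comp ((continuous_wt hT k).comp continuous_subtype_val)).mul
      (continuousOn_iff_continuous_domRestrict.1 (h1 k))
  let a : (k : Fin n → ℤ) → C(Icc (0 : ℝ) T, ℂ) := fun k =>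
    ⟨fun t => (wt T α 2 t k : ℂ) * c t k, hcont k⟩
  have hle : ∀ k, ‖a k‖ ≤ M k := fun k => by
    have h0 : (0 : ℝ) ∈ Icc 0 T := left_mem_Icc.2 hT.le
    refine (ContinuousMap.norm_le _ ((mul_nonneg (wt_pos _ _).le (norm_nonneg _)).trans
      (hb 0 h0 k))).2 fun t => ?_
    simp only [a, ContinuousMap.coe_mk, norm_mul, Complex.norm_real,
      Real.norm_of_nonneg (wt_pos _ _).le]
    exact hb t t.2 k
  have hmem : Memℓp a 1 := by
    refine memℓp_gen ?_
    simp only [ENNReal.toReal_one, Real.rpow_one]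
    exact Summable.of_nonneg_of_le (fun _ => norm_nonneg _) hle hM
  refine ⟨⟨a, hmem⟩, fun t ht k => ?_⟩
  have h := wt_pos (T := T) (α := α) (j := 2) t k
  have h2 : (wt T α 2 t k : ℂ) ≠ 0 := by exact_mod_cast h.ne'
  simp only [cof, projIcc_of_mem hT.le ht, a, ContinuousMap.coe_mk, ofReal_inv]
  rw [inv_mul_cancel_left₀ h2]

lemma coeff_ext (hT : 0 < T) {a b : CoeffSpace n T}
    (h : ∀ t ∈ Icc 0 T, ∀ k, cof hT α a t k = cof hT α b t k) : a = b := by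
  ext k t
  have := h t t.2 k
  simp only [cof, projIcc_of_mem hT.le t.2] at this
  exact mul_left_cancel₀ (by exact_mod_cast (inv_pos.2 (wt_pos _ _)).ne') this

lemma norm_coeffSpace_le (hT : 0 < T) {a : CoeffSpace n T} {M : (Fin n → ℤ) → ℝ} (hM : Summable M)
    (hM0 : ∀ k, 0 ≤ M k)
    (hb : ∀ t ∈ Icc 0 T, ∀ k, wt T α 2 t k * ‖cof hT α a t k‖ ≤ M k) : ‖a‖ ≤ ∑' k, M k := by
  rw [← (hasSum_norm_coeffSpace a).tsum_eq]
  refine (hasSum_norm_coeffSpace a).summable.tsum_le_tsum (fun k => ?_) hM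
  refine (ContinuousMap.norm_le _ (hM0 k)).2 fun t => ?_
  have := hb t t.2 k
  have h := wt_pos (T := T) (α := α) (j := 2) t k
  rw [cof, norm_mul, Complex.norm_real, norm_inv, Real.norm_of_nonneg h.le,
    mul_inv_cancel_left₀ h.ne', projIcc_of_mem hT.le t.2] at this
  exact this

/-- The element of the coefficient space with a given coefficient family. -/
def enc (hT : 0 < T) (α : ℝ) (c : ℝ → (Fin n → ℤ) → ℂ) : CoeffSpace n T :=
  open Classical in
  -- The fixed point lemmas take total maps, whereas `mildW` is known to be good only when the
  -- payoff term lies in B²; elsewhere the value 0 is harmless.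
  if h : ∃ a : CoeffSpace n T, ∀ t ∈ Icc 0 T, ∀ k, cof hT α a t k = c t k then h.choose else 0

lemma cof_enc (hT : 0 < T) {c : ℝ → (Fin n → ℤ) → ℂ} (hc : GoodCoeff T α c) {t : ℝ}
    (ht : t ∈ Icc 0 T) (k : Fin n → ℤ) : cof hT α (enc hT α c) t k = c t k := by
  rw [enc, dif_pos (exists_cof_eq hT hc)]
  exact (exists_cof_eq hT hc).choose_spec t ht k

/-- The space-time function with given weighted coefficients. -/
def dec (hT : 0 < T) (α : ℝ) (a : CoeffSpace n T) : ℝ → Euc n → ℝ := fun t => trig (cof hT α a t)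

lemma summable_cof (hT : 0 < T) (hα : 0 ≤ α) (a : CoeffSpace n T) {t : ℝ} (ht : t ∈ Icc 0 T) :
    Summable fun k => ‖cof hT α a t k‖ :=
  Summable.of_nonneg_of_le (fun _ => norm_nonneg _) (fun k =>
    (le_mul_of_one_le_left (norm_nonneg _) (one_le_wt hT hα ht k)).trans
      (wt_mul_norm_cof_le hT a t k)) (hasSum_norm_coeffSpace a).summable

/-- Decoding can shrink the norm, since `trig` forgets the anti-Hermitian part. This inequality
suffices to transfer Lipschitz estimates on functions to the coefficient space. -/
lemma memST_dec (hT : 0 < T) (hα : 0 ≤ α) (a : CoeffSpace n T) :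
    MemST T α 2 (dec hT α a) ∧ stNorm T α 2 (dec hT α a) ≤ ‖a‖ := by
  rw [← (hasSum_norm_coeffSpace a).tsum_eq]
  exact memST_trig hT hα (continuousOn_cof hT a) (hasSum_norm_coeffSpace a).summable
    fun t _ k => wt_mul_norm_cof_le hT a t k

lemma dec_sub (hT : 0 < T) (hα : 0 ≤ α) (a b : CoeffSpace n T) {t : ℝ} (ht : t ∈ Icc 0 T) :
    dec hT α (a - b) t = fun x => dec hT α a t x - dec hT α b t x := by
  ext x
  rw [dec, dec, dec, ← trig_sub (summable_cof hT hα a ht) (summable_cof hT hα b ht)]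
  simp only [← cof_sub]

lemma stDist_dec_le (hT : 0 < T) (hα : 0 ≤ α) (a b : CoeffSpace n T) :
    stDist T α 2 (dec hT α a) (dec hT α b) ≤ ‖a - b‖ := by
  rw [stDist, ← stNorm_congr fun t ht => dec_sub hT hα a b ht]
  exact (memST_dec hT hα _).2

lemma dec_zero (hT : 0 < T) : dec hT α (0 : CoeffSpace n T) = 0 := by
  ext t x
  simp [dec, trig, cof_zero]

lemma MemST.goodCoeff {f : ℝ → Euc n → ℝ} (hf : MemST T α 2 f) :
    GoodCoeff T α (fun t => torusCoeff (f t)) :=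
  ⟨hf.continuousOn_coeff, _, hf.summable_stSup, fun _ ht k => hf.coeff_le ht k⟩

/-- The inversion holds in this order only: encoding a decoded family returns its Hermitian part. -/
lemma dec_enc_torusCoeff (hT : 0 < T) {f : ℝ → Euc n → ℝ} (hf : MemST T α 2 f) {t : ℝ}
    (ht : t ∈ Icc 0 T) : dec hT α (enc hT α fun t => torusCoeff (f t)) t = f t := by
  rw [dec, funext fun k => cof_enc hT hf.goodCoeff ht k]
  exact hf.trig_eq ht

lemma norm_enc_torusCoeff_le (hT : 0 < T) {f : ℝ → Euc n → ℝ} (hf : MemST T α 2 f) :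
    ‖enc hT α fun t => torusCoeff (f t)‖ ≤ stNorm T α 2 f := by
  rw [← hf.tsum_stSup]
  refine norm_coeffSpace_le (α := α) hT hf.summable_stSup (stSup_nonneg f) fun t ht k => ?_
  rw [cof_enc hT hf.goodCoeff ht]
  exact hf.coeff_le ht k

end

/-! ### The mild formulation and its Lipschitz estimates. -/

section

variable {n : ℕ} {T α : ℝ} {H : ℝ → Euc n → Euc n → ℝ → ℝ} {G : (Euc n → ℝ) → Euc n → ℝ}
  {b : ℝ → Euc n → ℝ} {w μ w₁ w₂ μ₁ μ₂ : ℝ → Euc n → ℝ}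

/-! ### The mild formulation -/

/-- The components of `(μ + m̄) Θ(·,·,Dw,μ)`. -/
def flux (H : ℝ → Euc n → Euc n → ℝ → ℝ) (w μ : ℝ → Euc n → ℝ) (i : Fin n) (t : ℝ)
    (x : Euc n) : ℝ := (μ t x + mBar n) * Theta H w μ t x i

/-- The Fourier coefficients of `-div ((μ + m̄) Θ(·,·,Dw,μ))`. -/
def fluxCoeff (H : ℝ → Euc n → Euc n → ℝ → ℝ) (w μ : ℝ → Euc n → ℝ) (t : ℝ)
    (k : Fin n → ℤ) : ℂ := -∑ i, Complex.I * k i * torusCoeff (flux H w μ i t) k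

/-- The Duhamel map of the Fokker-Planck equation. -/
def mildM (H : ℝ → Euc n → Euc n → ℝ → ℝ) (μ₀ : Euc n → ℝ) (w μ : ℝ → Euc n → ℝ) (t : ℝ)
    (k : Fin n → ℤ) : ℂ :=
  fwd (freqNorm k ^ 2) (torusCoeff μ₀ k) (fun s => fluxCoeff H w μ s k) t

/-- The Duhamel map of the mean-free Hamilton-Jacobi equation. -/
def mildW (T : ℝ) (H : ℝ → Euc n → Euc n → ℝ → ℝ) (G : (Euc n → ℝ) → Euc n → ℝ)
    (w μ : ℝ → Euc n → ℝ) (t : ℝ) (k : Fin n → ℤ) : ℂ :=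
  bwd T (freqNorm k ^ 2) (torusCoeff (payoffTilde G (μ T)) k)
    (fun s => torusCoeff (Xi H w μ s) k) t

/-- A ball on which the nonlinearities have small Lipschitz constants. -/
def LocalBound (T α : ℝ) (H : ℝ → Euc n → Euc n → ℝ → ℝ) (b : ℝ → Euc n → ℝ) (ε ρ : ℝ) : Prop :=
  ∀ w₁ w₂ μ₁ μ₂ : ℝ → Euc n → ℝ,
    MemST T α 2 w₁ → MemST T α 2 w₂ → MemST T α 2 μ₁ → MemST T α 2 μ₂ →
    stNorm T α 2 w₁ ≤ ρ → stNorm T α 2 w₂ ≤ ρ → stNorm T α 2 μ₁ ≤ ρ → stNorm T α 2 μ₂ ≤ ρ →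
    stVecNorm T α 1 (fun t x => Theta H w₁ μ₁ t x - Theta H w₂ μ₂ t x)
        ≤ ε * pairDist T α w₁ w₂ μ₁ μ₂ ∧
    stDist T α 0 (fun t => proj (Upsilon H b w₁ μ₁ t)) (fun t => proj (Upsilon H b w₂ μ₂ t))
        ≤ ε * pairDist T α w₁ w₂ μ₁ μ₂

lemma pairDist_nonneg : 0 ≤ pairDist T α w₁ w₂ μ₁ μ₂ :=
  add_nonneg (Finset.sum_nonneg fun _ _ => stNorm_nonneg _) (stNorm_nonneg _)

lemma HamiltonianCondition.exists_localBound (h : HamiltonianCondition T α H b) {ε : ℝ}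
    (hε : 0 < ε) : ∃ δ > 0, ∀ ρ ≤ δ, LocalBound T α H b ε ρ := by
  obtain ⟨-, -, -, ⟨Φ₁, hΦ₁, h₁⟩, Φ₂, hΦ₂, h₂⟩ := h
  obtain ⟨δ₁, hδ₁, k₁⟩ := hΦ₁.2 ε hε
  obtain ⟨δ₂, hδ₂, k₂⟩ := hΦ₂.2 ε hε
  -- A fifth, so that the sum of four norms stays strictly below both thresholds.
  refine ⟨min δ₁ δ₂ / 5, by positivity, fun ρ hρ w₁ w₂ μ₁ μ₂ hw₁ hw₂ hμ₁ hμ₂ n₁ n₂ n₃ n₄ => ?_⟩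
  have hm : 0 < min δ₁ δ₂ := lt_min hδ₁ hδ₂
  have hs : stNorm T α 2 w₁ + stNorm T α 2 w₂ + stNorm T α 2 μ₁ + stNorm T α 2 μ₂
      < min δ₁ δ₂ := by linarith
  have hp : 0 ≤ pairDist T α w₁ w₂ μ₁ μ₂ := pairDist_nonneg
  constructor
  · refine (h₁ w₁ w₂ μ₁ μ₂ hw₁ hw₂ hμ₁ hμ₂).trans (mul_le_mul_of_nonneg_right ?_ hp)
    exact (le_abs_self _).trans
      (k₁ _ _ _ _ hw₁ hw₂ hμ₁ hμ₂ (hs.trans_le (min_le_left _ _))).le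
  · refine (h₂ w₁ w₂ μ₁ μ₂ hw₁ hw₂ hμ₁ hμ₂).trans (mul_le_mul_of_nonneg_right ?_ hp)
    exact (le_abs_self _).trans
      (k₂ _ _ _ _ hw₁ hw₂ hμ₁ hμ₂ (hs.trans_le (min_le_right _ _))).le

lemma MemST.differentiable {f : ℝ → Euc n → ℝ} {j : ℕ} (hf : MemST T α (j + 1) f) {t : ℝ}
    (ht : t ∈ Icc 0 T) : Differentiable ℝ (f t) := by
  rw [← hf.trig_eq ht]
  exact (contDiff_one_trig (summable_weight_of_le (by omega) (hf.summable_coeff ht))).differentiable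
    (by norm_num)

lemma spaceGrad_sub (hw₁ : MemST T α 2 w₁) (hw₂ : MemST T α 2 w₂) {t : ℝ} (ht : t ∈ Icc 0 T)
    (x : Euc n) (i : Fin n) :
    spaceGrad (fun t x => w₁ t x - w₂ t x) t x i = (spaceGrad w₁ t x - spaceGrad w₂ t x) i := by
  simp only [spaceGrad, PiLp.sub_apply, gradient_apply_eq]
  rw [fderiv_fun_sub (hw₁.differentiable ht x) (hw₂.differentiable ht x)]
  rfl

lemma pairDist_le (hT : 0 < T) (hα : 0 ≤ α) (hw₁ : MemST T α 2 w₁) (hw₂ : MemST T α 2 w₂) :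
    pairDist T α w₁ w₂ μ₁ μ₂ ≤ (2 * n + 1) * (stDist T α 2 w₁ w₂ + stDist T α 2 μ₁ μ₂) := by
  have h1 : stVecNorm T α 1 (fun t x => spaceGrad w₁ t x - spaceGrad w₂ t x)
      ≤ ∑ _i : Fin n, 2 * stDist T α 2 w₁ w₂ := by
    refine Finset.sum_le_sum fun i _ => ?_
    rw [← stNorm_congr fun t ht => funext fun x => spaceGrad_sub hw₁ hw₂ ht x i]
    exact ((hw₁.sub hT hα hw₂).1.spaceGrad hT hα i).2
  simp only [Finset.sum_const, Finset.card_univ, Fintype.card_fin, nsmul_eq_mul] at h1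
  have h2 : 0 ≤ stDist T α 2 w₁ w₂ := stNorm_nonneg _
  have h3 : 0 ≤ stDist T α 2 μ₁ μ₂ := stNorm_nonneg _
  unfold pairDist
  have : (0 : ℝ) ≤ n := Nat.cast_nonneg n
  nlinarith [mul_nonneg this h3]

lemma stNorm_le_stVecNorm {j : ℕ} (F : ℝ → Euc n → Euc n) (i : Fin n) :
    stNorm T α j (fun t x => F t x i) ≤ stVecNorm T α j F :=
  Finset.single_le_sum (f := fun i => stNorm T α j (fun t x => F t x i))
    (fun _ _ => stNorm_nonneg _) (Finset.mem_univ i)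

/-! ### The flux -/

lemma memST_flux (hT : 0 < T) (hα : 0 ≤ α) (hH : HamiltonianCondition T α H b)
    (hw : MemST T α 2 w) (hμ : MemST T α 2 μ) (i : Fin n) : MemST T α 1 (flux H w μ i) := by
  have hΘ := (hH.2.2.1 w μ hw hμ).1 i
  have h := ((hμ.mul hT hα le_rfl hΘ).1.add hT hα (hΘ.const_mul hT hα (mBar n)).1).1
  refine h.congr hT hα fun t _ => funext fun x => ?_
  rw [flux]; ring

lemma continuousOn_fluxCoeff (hT : 0 < T) (hα : 0 ≤ α) (hH : HamiltonianCondition T α H b)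
    (hw : MemST T α 2 w) (hμ : MemST T α 2 μ) (k : Fin n → ℤ) :
    ContinuousOn (fun t => fluxCoeff H w μ t k) (Icc 0 T) :=
  (continuousOn_finsetSum _ fun i _ =>
    ((memST_flux hT hα hH hw hμ i).continuousOn_coeff k).const_mul _).neg

/-- A divergence has no mean. This settles the mode without heat decay and is the source of mass
conservation. -/
lemma fluxCoeff_zero_freq (t : ℝ) : fluxCoeff H w μ t 0 = 0 := by simp [fluxCoeff]

lemma wt_mul_norm_fluxCoeff_le (hT : 0 < T) (hα : 0 ≤ α) (hH : HamiltonianCondition T α H b)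
    (hw : MemST T α 2 w) (hμ : MemST T α 2 μ) {t : ℝ} (ht : t ∈ Icc 0 T) (k : Fin n → ℤ) :
    wt T α 0 t k * ‖fluxCoeff H w μ t k‖ ≤ ∑ i, 2 * stSup T α 1 (flux H w μ i) k := by
  rw [fluxCoeff, norm_neg]
  refine (mul_le_mul_of_nonneg_left (norm_sum_le _ _) (wt_pos _ _).le).trans ?_
  rw [Finset.mul_sum]
  refine Finset.sum_le_sum fun i _ => ?_
  exact (wt_mul_dcoef_le t i _ k).trans (mul_le_mul_of_nonneg_left
    ((memST_flux hT hα hH hw hμ i).coeff_le ht k) zero_le_two)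

/-- The difference of two fluxes. -/
def fluxDiff (H : ℝ → Euc n → Euc n → ℝ → ℝ) (w₁ w₂ μ₁ μ₂ : ℝ → Euc n → ℝ) (i : Fin n)
    (t : ℝ) (x : Euc n) : ℝ := flux H w₁ μ₁ i t x - flux H w₂ μ₂ i t x

lemma wt_mul_norm_fluxCoeff_sub_le (hT : 0 < T) (hα : 0 ≤ α) (hH : HamiltonianCondition T α H b)
    (hw₁ : MemST T α 2 w₁) (hw₂ : MemST T α 2 w₂) (hμ₁ : MemST T α 2 μ₁) (hμ₂ : MemST T α 2 μ₂)
    {t : ℝ} (ht : t ∈ Icc 0 T) (k : Fin n → ℤ) :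
    wt T α 0 t k * ‖fluxCoeff H w₁ μ₁ t k - fluxCoeff H w₂ μ₂ t k‖
      ≤ ∑ i, 2 * stSup T α 1 (fluxDiff H w₁ w₂ μ₁ μ₂ i) k := by
  have hm₁ := memST_flux hT hα hH hw₁ hμ₁
  have hm₂ := memST_flux hT hα hH hw₂ hμ₂
  have h : fluxCoeff H w₁ μ₁ t k - fluxCoeff H w₂ μ₂ t k
      = -∑ i, dcoef i (torusCoeff (fluxDiff H w₁ w₂ μ₁ μ₂ i t)) k := by
    have h2 : ∀ i, torusCoeff (fluxDiff H w₁ w₂ μ₁ μ₂ i t) k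
        = torusCoeff (flux H w₁ μ₁ i t) k - torusCoeff (flux H w₂ μ₂ i t) k := fun i =>
      torusCoeff_sub ((hm₁ i).continuous ht) ((hm₂ i).continuous ht) k
    simp only [fluxCoeff, dcoef, h2, mul_sub, Finset.sum_sub_distrib]
    ring
  rw [h, norm_neg]
  refine (mul_le_mul_of_nonneg_left (norm_sum_le _ _) (wt_pos _ _).le).trans ?_
  rw [Finset.mul_sum]
  refine Finset.sum_le_sum fun i _ => ?_
  exact (wt_mul_dcoef_le t i _ k).trans (mul_le_mul_of_nonneg_left
    (((hm₁ i).sub hT hα (hm₂ i)).1.coeff_le ht k) zero_le_two)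

lemma theta_zero (hH : HamiltonianCondition T α H b) {t : ℝ} (ht : t ∈ Icc 0 T) (x : Euc n) :
    Theta H (fun _ _ => 0) (fun _ _ => 0) t x = 0 := hH.2.1 t ht x

/-- The difference splits as μ₁(Θ₁ - Θ₂) + (μ₁ - μ₂)Θ₂ + m̄(Θ₁ - Θ₂). Each term carries ε, and with
ρ ≤ 1 and the product constant 2 they contribute 2, 4 and m̄. -/
lemma stNorm_fluxDiff_le (hT : 0 < T) (hα : 0 ≤ α) (hH : HamiltonianCondition T α H b) {ε ρ : ℝ}
    (hε : 0 ≤ ε) (hρ0 : 0 ≤ ρ) (hρ : ρ ≤ 1) (hL : LocalBound T α H b ε ρ)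
    (hw₁ : MemST T α 2 w₁) (hw₂ : MemST T α 2 w₂) (hμ₁ : MemST T α 2 μ₁) (hμ₂ : MemST T α 2 μ₂)
    (n₁ : stNorm T α 2 w₁ ≤ ρ) (n₂ : stNorm T α 2 w₂ ≤ ρ) (n₃ : stNorm T α 2 μ₁ ≤ ρ)
    (n₄ : stNorm T α 2 μ₂ ≤ ρ) (i : Fin n) :
    stNorm T α 1 (fluxDiff H w₁ w₂ μ₁ μ₂ i) ≤
      (6 + mBar n) * (ε * ((2 * n + 1) * (stDist T α 2 w₁ w₂ + stDist T α 2 μ₁ μ₂))) := by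
  have hΘ₁ := (hH.2.2.1 w₁ μ₁ hw₁ hμ₁).1 i
  have hΘ₂ := (hH.2.2.1 w₂ μ₂ hw₂ hμ₂).1 i
  have hz : MemST T α 2 (fun (_ : ℝ) (_ : Euc n) => (0 : ℝ)) := memST_zero hT hα
  have hzn : stNorm T α 2 (fun (_ : ℝ) (_ : Euc n) => (0 : ℝ)) ≤ ρ := by rw [stNorm_zero]; exact hρ0
  set D := stDist T α 2 w₁ w₂ + stDist T α 2 μ₁ μ₂ with hD
  have hDw : 0 ≤ stDist T α 2 w₁ w₂ := stNorm_nonneg _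
  have hDμ : 0 ≤ stDist T α 2 μ₁ μ₂ := stNorm_nonneg _
  have b1 : stNorm T α 1 (fun t x => Theta H w₁ μ₁ t x i - Theta H w₂ μ₂ t x i)
      ≤ ε * ((2 * n + 1) * D) := by
    refine (stNorm_le_stVecNorm (fun t x => Theta H w₁ μ₁ t x - Theta H w₂ μ₂ t x) i).trans ?_
    refine (hL w₁ w₂ μ₁ μ₂ hw₁ hw₂ hμ₁ hμ₂ n₁ n₂ n₃ n₄).1.trans ?_
    exact mul_le_mul_of_nonneg_left (pairDist_le hT hα hw₁ hw₂) hε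
  -- Θ₂ itself is small: it is compared with Θ at the origin, which vanishes, and the two norms add
  -- up to at most 2ρ ≤ 2.
  have b2 : stNorm T α 1 (fun t x => Theta H w₂ μ₂ t x i) ≤ ε * ((2 * n + 1) * 2) := by
    have e : ∀ t ∈ Icc 0 T, (fun x => Theta H w₂ μ₂ t x i)
        = fun x => (Theta H w₂ μ₂ t x - Theta H (fun _ _ => 0) (fun _ _ => 0) t x) i := by
      intro t ht; ext x; rw [theta_zero hH ht, sub_zero]
    rw [stNorm_congr e]
    refine (stNorm_le_stVecNorm (fun t x => Theta H w₂ μ₂ t x -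
      Theta H (fun _ _ => 0) (fun _ _ => 0) t x) i).trans ?_
    refine (hL w₂ _ μ₂ _ hw₂ hz hμ₂ hz n₂ hzn n₄ hzn).1.trans ?_
    refine mul_le_mul_of_nonneg_left ((pairDist_le hT hα hw₂ hz).trans ?_) hε
    simp only [stDist, sub_zero]
    gcongr
    linarith
  have hdΘ := (hΘ₁.sub hT hα hΘ₂).1
  have hdμ := (hμ₁.sub hT hα hμ₂).1
  have m1 := hμ₁.mul hT hα le_rfl hdΘ
  have m2 := hdμ.mul hT hα le_rfl hΘ₂
  have m3 := hdΘ.const_mul hT hα (mBar n)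
  have s1 := m1.1.add hT hα m2.1
  have s2 := s1.1.add hT hα m3.1
  have e : ∀ t ∈ Icc 0 T, fluxDiff H w₁ w₂ μ₁ μ₂ i t = fun x =>
      μ₁ t x * (Theta H w₁ μ₁ t x i - Theta H w₂ μ₂ t x i)
        + (μ₁ t x - μ₂ t x) * Theta H w₂ μ₂ t x i
        + mBar n * (Theta H w₁ μ₁ t x i - Theta H w₂ μ₂ t x i) := by
    intro t _; ext x; simp only [fluxDiff, flux]; ring
  rw [stNorm_congr e]
  have hdμ' : stNorm T α 2 (fun t x => μ₁ t x - μ₂ t x) = stDist T α 2 μ₁ μ₂ := rfl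
  rw [hdμ'] at m2
  have hm := mBar_pos n
  rw [abs_of_pos hm] at m3
  have h0 := stNorm_nonneg (T := T) (α := α) (j := 1)
    (fun t x => Theta H w₁ μ₁ t x i - Theta H w₂ μ₂ t x i)
  have h0' := stNorm_nonneg (T := T) (α := α) (j := 1) (fun t x => Theta H w₂ μ₂ t x i)
  have hnn : 0 ≤ ε * ((2 * n + 1) * D) := by positivity
  have c1 : stNorm T α 2 μ₁ * stNorm T α 1 (fun t x => Theta H w₁ μ₁ t x i - Theta H w₂ μ₂ t x i)
      ≤ 1 * (ε * ((2 * n + 1) * D)) := mul_le_mul (n₃.trans hρ) b1 h0 zero_le_one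
  have c2 : stDist T α 2 μ₁ μ₂ * stNorm T α 1 (fun t x => Theta H w₂ μ₂ t x i)
      ≤ D * (ε * ((2 * n + 1) * 2)) := mul_le_mul (by linarith) b2 h0' (by positivity)
  have c3 := mul_le_mul_of_nonneg_left b1 hm.le
  linarith [s2.2, s1.2, m1.2, m2.2, m3.2]

/-! ### The Hamiltonian -/

/-- The Hamiltonian along `(w, μ)`. -/
def ham (H : ℝ → Euc n → Euc n → ℝ → ℝ) (w μ : ℝ → Euc n → ℝ) (t : ℝ) (x : Euc n) : ℝ :=
  H t x (spaceGrad w t x) (μ t x + mBar n)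

/-- `mean f` is some real number whether or not f is integrable, so f and `proj f` always differ by
a constant. This recovers Υ from the hypothesis on ℙΥ. -/
lemma continuous_of_proj {f : Euc n → ℝ} (hf : Continuous (proj f)) : Continuous f := by
  have h : f = fun x => proj f x + mean f := by ext x; simp [proj]
  rw [h]
  exact hf.add continuous_const

lemma continuous_Xi (hH : HamiltonianCondition T α H b) (hb : MemST T α 0 b)
    (hw : MemST T α 2 w) (hμ : MemST T α 2 μ) {t : ℝ} (ht : t ∈ Icc 0 T) :
    Continuous (Xi H w μ t) := by
  have h1 := continuous_of_proj ((hH.2.2.1 w μ hw hμ).2.continuous ht)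
  have h2 : Xi H w μ t = fun x => Upsilon H b w μ t x + b t x * μ t x := by
    ext x; simp [Upsilon]
  rw [h2]
  exact h1.add ((hb.continuous ht).mul (hμ.continuous ht))

lemma torusCoeff_Xi_eq_ham (hH : HamiltonianCondition T α H b) (hb : MemST T α 0 b)
    (hw : MemST T α 2 w) (hμ : MemST T α 2 μ) {t : ℝ} (ht : t ∈ Icc 0 T) (k : Fin n → ℤ) :
    torusCoeff (Xi H w μ t) k = if k = 0 then 0 else torusCoeff (ham H w μ t) k :=
  torusCoeff_proj (continuous_of_proj (continuous_Xi hH hb hw hμ ht)) k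

/-- The estimates concern ℙΥ and bμ, which together agree with Ξ off the zero mode. There bμ may
have a mean while Ξ has none, hence the case split. -/
lemma torusCoeff_Xi (hH : HamiltonianCondition T α H b) (hb : MemST T α 0 b)
    (hw : MemST T α 2 w) (hμ : MemST T α 2 μ) {t : ℝ} (ht : t ∈ Icc 0 T) (k : Fin n → ℤ) :
    torusCoeff (Xi H w μ t) k = if k = 0 then 0 else
      torusCoeff (proj (Upsilon H b w μ t)) k + torusCoeff (fun x => μ t x * b t x) k := by
  split_ifs with hk
  · rw [torusCoeff_Xi_eq_ham hH hb hw hμ ht, if_pos hk]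
  · have h1 := continuous_of_proj ((hH.2.2.1 w μ hw hμ).2.continuous ht)
    rw [torusCoeff_proj h1, if_neg hk, ← torusCoeff_add (g := fun x => μ t x * b t x)
      h1 ((hμ.continuous ht).mul (hb.continuous ht))]
    congr 1
    ext x
    simp [Upsilon, mul_comm]

lemma continuousOn_coeff_Xi (hT : 0 < T) (hα : 0 ≤ α) (hH : HamiltonianCondition T α H b)
    (hb : MemST T α 0 b) (hw : MemST T α 2 w) (hμ : MemST T α 2 μ) (k : Fin n → ℤ) :
    ContinuousOn (fun t => torusCoeff (Xi H w μ t) k) (Icc 0 T) := by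
  refine ContinuousOn.congr ?_ fun t ht => torusCoeff_Xi hH hb hw hμ ht k
  split_ifs
  · exact continuousOn_const
  · exact ((hH.2.2.1 w μ hw hμ).2.continuousOn_coeff k).add
      ((hμ.mul hT hα zero_le_one hb).1.continuousOn_coeff k)

lemma wt_mul_norm_coeff_Xi_le (hT : 0 < T) (hα : 0 ≤ α) (hH : HamiltonianCondition T α H b)
    (hb : MemST T α 0 b) (hw : MemST T α 2 w) (hμ : MemST T α 2 μ) {t : ℝ} (ht : t ∈ Icc 0 T)
    (k : Fin n → ℤ) : wt T α 0 t k * ‖torusCoeff (Xi H w μ t) k‖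
      ≤ stSup T α 0 (fun t => proj (Upsilon H b w μ t)) k
        + stSup T α 0 (fun t x => μ t x * b t x) k := by
  rw [torusCoeff_Xi hH hb hw hμ ht]
  split_ifs
  · rw [norm_zero, mul_zero]
    exact add_nonneg (stSup_nonneg _ _) (stSup_nonneg _ _)
  · refine (mul_le_mul_of_nonneg_left (norm_add_le _ _) (wt_pos _ _).le).trans ?_
    rw [mul_add]
    exact add_le_add ((hH.2.2.1 w μ hw hμ).2.coeff_le ht k)
      ((hμ.mul hT hα zero_le_one hb).1.coeff_le ht k)

lemma wt_mul_norm_coeff_Xi_sub_le (hT : 0 < T) (hα : 0 ≤ α) (hH : HamiltonianCondition T α H b)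
    (hb : MemST T α 0 b) (hw₁ : MemST T α 2 w₁) (hw₂ : MemST T α 2 w₂) (hμ₁ : MemST T α 2 μ₁)
    (hμ₂ : MemST T α 2 μ₂) {t : ℝ} (ht : t ∈ Icc 0 T) (k : Fin n → ℤ) :
    wt T α 0 t k * ‖torusCoeff (Xi H w₁ μ₁ t) k - torusCoeff (Xi H w₂ μ₂ t) k‖
      ≤ stSup T α 0 (fun t x => proj (Upsilon H b w₁ μ₁ t) x - proj (Upsilon H b w₂ μ₂ t) x) k
        + stSup T α 0 (fun t x => (μ₁ t x - μ₂ t x) * b t x) k := by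
  rw [torusCoeff_Xi hH hb hw₁ hμ₁ ht, torusCoeff_Xi hH hb hw₂ hμ₂ ht]
  split_ifs
  · rw [sub_zero, norm_zero, mul_zero]
    exact add_nonneg (stSup_nonneg _ _) (stSup_nonneg _ _)
  · have hU₁ := (hH.2.2.1 w₁ μ₁ hw₁ hμ₁).2
    have hU₂ := (hH.2.2.1 w₂ μ₂ hw₂ hμ₂).2
    have e1 := torusCoeff_sub (hU₁.continuous ht) (hU₂.continuous ht) k
    have e2 := torusCoeff_sub (f := fun x => μ₁ t x * b t x)
      (g := fun x => μ₂ t x * b t x) ((hμ₁.continuous ht).mul (hb.continuous ht))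
      ((hμ₂.continuous ht).mul (hb.continuous ht)) k
    have e3 : (fun x => μ₁ t x * b t x - μ₂ t x * b t x)
        = fun x => (μ₁ t x - μ₂ t x) * b t x := by ext x; ring
    rw [e3] at e2
    rw [add_sub_add_comm, ← e1, ← e2]
    refine (mul_le_mul_of_nonneg_left (norm_add_le _ _) (wt_pos _ _).le).trans ?_
    rw [mul_add]
    exact add_le_add ((hU₁.sub hT hα hU₂).1.coeff_le ht k)
      (((hμ₁.sub hT hα hμ₂).1.mul hT hα zero_le_one hb).1.coeff_le ht k)

/-! ### Estimates for the Duhamel maps -/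

/-- At k = 0 nothing decays, but without forcing the solution is the constant y, whose weight is 1.
-/
lemma wt_mul_norm_fwd_le_of_zero {f : ℝ → ℂ} (hT : 0 < T) (hα0 : 0 ≤ α) (hα : α < T / 2)
    {k : Fin n → ℤ} (hf : k = 0 → ∀ s ∈ Icc 0 T, f s = 0) {M : ℝ} (y : ℂ)
    (hb : ∀ s ∈ Icc 0 T, wt T α 0 s k * ‖f s‖ ≤ M) {t : ℝ} (ht : t ∈ Icc 0 T) :
    wt T α 2 t k * ‖fwd (freqNorm k ^ 2) y f t‖
      ≤ (1 + freqNorm k ^ 2) * ‖y‖ + gain T α * M := by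
  rcases eq_or_ne k 0 with rfl | hk
  · have hM : 0 ≤ M := (mul_nonneg (wt_pos _ _).le (norm_nonneg _)).trans (hb t ht)
    have hg := gain_pos hT hα
    rw [fwd_congr (T := T) (g := fun _ => 0) _ _ (hf rfl) ht]
    simp only [freqNorm_zero, wt, fwd]
    simp
    positivity
  · exact wt_mul_norm_fwd_le hT hα0 hα hk y hb ht

lemma wt_mul_norm_bwd_le_of_zero {f : ℝ → ℂ} (hT : 0 < T) (hα0 : 0 ≤ α) (hα : α < T / 2)
    {k : Fin n → ℤ} (hf : k = 0 → ∀ s ∈ Icc 0 T, f s = 0) {M : ℝ} (y : ℂ)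
    (hb : ∀ s ∈ Icc 0 T, wt T α 0 s k * ‖f s‖ ≤ M) {t : ℝ} (ht : t ∈ Icc 0 T) :
    wt T α 2 t k * ‖bwd T (freqNorm k ^ 2) y f t‖
      ≤ (1 + freqNorm k ^ 2) * ‖y‖ + gain T α * M := by
  rw [← wt_reverse hT]
  refine wt_mul_norm_fwd_le_of_zero hT hα0 hα (fun h s hs => hf h _ (sub_mem_Icc_self hs)) y
    (fun s hs => ?_) (sub_mem_Icc_self ht)
  rw [← wt_reverse hT]
  exact hb _ (sub_mem_Icc_self hs)

lemma goodCoeff_mildM (hT : 0 < T) (hα0 : 0 ≤ α) (hα : α < T / 2)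
    (hH : HamiltonianCondition T α H b) (hw : MemST T α 2 w) (hμ : MemST T α 2 μ)
    {μ₀ : Euc n → ℝ} (hμ₀ : MemB 2 μ₀) : GoodCoeff T α (mildM H μ₀ w μ) := by
  refine ⟨fun k => continuousOn_fwd hT _ _ (continuousOn_fluxCoeff hT hα0 hH hw hμ k),
    fun k => (1 + freqNorm k ^ 2) * ‖torusCoeff μ₀ k‖
      + gain T α * ∑ i, 2 * stSup T α 1 (flux H w μ i) k, ?_, fun t ht k => ?_⟩
  · refine hμ₀.summable.add (Summable.mul_left _ (summable_sum fun i _ => ?_))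
    exact (memST_flux hT hα0 hH hw hμ i).summable_stSup.mul_left 2
  · exact wt_mul_norm_fwd_le_of_zero hT hα0 hα (by rintro rfl s _; exact fluxCoeff_zero_freq s) _
      (fun s hs => wt_mul_norm_fluxCoeff_le hT hα0 hH hw hμ hs k) ht

lemma goodCoeff_mildW (hT : 0 < T) (hα0 : 0 ≤ α) (hα : α < T / 2)
    (hH : HamiltonianCondition T α H b) (hb : MemST T α 0 b) (hw : MemST T α 2 w)
    (hμ : MemST T α 2 μ) (hG : MemB 2 (payoffTilde G (μ T))) :
    GoodCoeff T α (mildW T H G w μ) := by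
  refine ⟨fun k => continuousOn_bwd hT _ _ (continuousOn_coeff_Xi hT hα0 hH hb hw hμ k),
    fun k => (1 + freqNorm k ^ 2) * ‖torusCoeff (payoffTilde G (μ T)) k‖
      + gain T α * (stSup T α 0 (fun t => proj (Upsilon H b w μ t)) k
        + stSup T α 0 (fun t x => μ t x * b t x) k), ?_, fun t ht k => ?_⟩
  · refine hG.summable.add (Summable.mul_left _ (Summable.add ?_ ?_))
    · exact (hH.2.2.1 w μ hw hμ).2.summable_stSup
    · exact (hμ.mul hT hα0 zero_le_one hb).1.summable_stSup
  · exact wt_mul_norm_bwd_le_of_zero hT hα0 hα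
      (by rintro rfl s hs; rw [torusCoeff_Xi_eq_ham hH hb hw hμ hs, if_pos rfl]) _
      (fun s hs => wt_mul_norm_coeff_Xi_le hT hα0 hH hb hw hμ hs k) ht

/-- Both images start from the same datum, so the free heat flows cancel and all that remains
carries the factor ε. -/
lemma norm_enc_mildM_sub_le (hT : 0 < T) (hα0 : 0 ≤ α) (hα : α < T / 2)
    (hH : HamiltonianCondition T α H b) {ε ρ : ℝ}
    (hε : 0 ≤ ε) (hρ0 : 0 ≤ ρ) (hρ : ρ ≤ 1) (hL : LocalBound T α H b ε ρ)
    (hw₁ : MemST T α 2 w₁) (hw₂ : MemST T α 2 w₂) (hμ₁ : MemST T α 2 μ₁) (hμ₂ : MemST T α 2 μ₂)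
    (n₁ : stNorm T α 2 w₁ ≤ ρ) (n₂ : stNorm T α 2 w₂ ≤ ρ) (n₃ : stNorm T α 2 μ₁ ≤ ρ)
    (n₄ : stNorm T α 2 μ₂ ≤ ρ) {μ₀ : Euc n → ℝ} (hμ₀ : MemB 2 μ₀) :
    ‖enc hT α (mildM H μ₀ w₁ μ₁) - enc hT α (mildM H μ₀ w₂ μ₂)‖ ≤
      gain T α * (n * (2 * ((6 + mBar n) *
        (ε * ((2 * n + 1) * (stDist T α 2 w₁ w₂ + stDist T α 2 μ₁ μ₂)))))) := by
  have hm : ∀ i, MemST T α 1 (fluxDiff H w₁ w₂ μ₁ μ₂ i) := fun i =>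
    ((memST_flux hT hα0 hH hw₁ hμ₁ i).sub hT hα0 (memST_flux hT hα0 hH hw₂ hμ₂ i)).1
  have hg := gain_pos hT hα
  have hsum := hasSum_sum (s := Finset.univ) fun i _ => (hm i).summable_stSup.hasSum.mul_left 2
  have hsum' := hsum.mul_left (gain T α)
  have h1 : ‖enc hT α (mildM H μ₀ w₁ μ₁) - enc hT α (mildM H μ₀ w₂ μ₂)‖
      ≤ ∑' k, gain T α * ∑ i, 2 * stSup T α 1 (fluxDiff H w₁ w₂ μ₁ μ₂ i) k := by
    refine norm_coeffSpace_le (α := α) hT hsum'.summable (fun k => mul_nonneg hg.le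
      (Finset.sum_nonneg fun i _ => mul_nonneg zero_le_two (stSup_nonneg _ _))) fun t ht k => ?_
    rw [cof_sub, cof_enc hT (goodCoeff_mildM hT hα0 hα hH hw₁ hμ₁ hμ₀) ht,
      cof_enc hT (goodCoeff_mildM hT hα0 hα hH hw₂ hμ₂ hμ₀) ht, mildM, mildM,
      fwd_sub _ _ _ (continuousOn_fluxCoeff hT hα0 hH hw₁ hμ₁ k)
        (continuousOn_fluxCoeff hT hα0 hH hw₂ hμ₂ k) ht, sub_self]
    refine (wt_mul_norm_fwd_le_of_zero hT hα0 hα ?_ _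
      (fun s hs => wt_mul_norm_fluxCoeff_sub_le hT hα0 hH hw₁ hw₂ hμ₁ hμ₂ hs k) ht).trans ?_
    · rintro rfl s _
      rw [fluxCoeff_zero_freq, fluxCoeff_zero_freq, sub_zero]
    · simp
  refine h1.trans ?_
  rw [hsum'.tsum_eq]
  gcongr
  refine (Finset.sum_le_sum fun i _ => mul_le_mul_of_nonneg_left ((hm i).tsum_stSup.le.trans
    (stNorm_fluxDiff_le hT hα0 hH hε hρ0 hρ hL hw₁ hw₂ hμ₁ hμ₂ n₁ n₂ n₃ n₄ i)) zero_le_two).trans ?_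
  simp

lemma MemST.bNorm_le (hT : 0 < T) (hα : 0 ≤ α) {j : ℕ} {f : ℝ → Euc n → ℝ} (hf : MemST T α j f)
    {t : ℝ} (ht : t ∈ Icc 0 T) : bNorm j (f t) ≤ stNorm T α j f := by
  rw [bNorm_eq (hf.summable_coeff ht), ← hf.tsum_stSup]
  exact (hf.summable_coeff ht).tsum_le_tsum (fun k => hf.weight_coeff_le hT hα ht k)
    hf.summable_stSup

/-- The terms without ε come from the payoff and from bμ and involve only the distance of the μ's;
this is the triangular structure. -/
lemma norm_enc_mildW_sub_le (hT : 0 < T) (hα0 : 0 ≤ α) (hα : α < T / 2)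
    (hH : HamiltonianCondition T α H b) (hb : MemST T α 0 b) {ε ρ c : ℝ}
    (hε : 0 ≤ ε) (hL : LocalBound T α H b ε ρ)
    (hw₁ : MemST T α 2 w₁) (hw₂ : MemST T α 2 w₂) (hμ₁ : MemST T α 2 μ₁) (hμ₂ : MemST T α 2 μ₂)
    (n₁ : stNorm T α 2 w₁ ≤ ρ) (n₂ : stNorm T α 2 w₂ ≤ ρ) (n₃ : stNorm T α 2 μ₁ ≤ ρ)
    (n₄ : stNorm T α 2 μ₂ ≤ ρ) (hG₁ : MemB 2 (payoffTilde G (μ₁ T)))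
    (hG₂ : MemB 2 (payoffTilde G (μ₂ T))) (hc : 0 ≤ c)
    (hG : bNorm 2 (fun x => payoffTilde G (μ₁ T) x - payoffTilde G (μ₂ T) x)
      ≤ c * bNorm 2 (fun x => μ₁ T x - μ₂ T x)) :
    ‖enc hT α (mildW T H G w₁ μ₁) - enc hT α (mildW T H G w₂ μ₂)‖ ≤
      c * stDist T α 2 μ₁ μ₂ + gain T α *
        (ε * ((2 * n + 1) * (stDist T α 2 w₁ w₂ + stDist T α 2 μ₁ μ₂))
          + 2 * (stDist T α 2 μ₁ μ₂ * stNorm T α 0 b)) := by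
  have hTm : T ∈ Icc 0 T := right_mem_Icc.2 hT.le
  have hg := gain_pos hT hα
  have hU := ((hH.2.2.1 w₁ μ₁ hw₁ hμ₁).2.sub hT hα0 (hH.2.2.1 w₂ μ₂ hw₂ hμ₂).2).1
  have hdμ := (hμ₁.sub hT hα0 hμ₂).1
  have hV := hdμ.mul hT hα0 zero_le_one hb
  have hGs : Summable fun k => (1 + freqNorm k ^ 2) *
      ‖torusCoeff (payoffTilde G (μ₁ T)) k - torusCoeff (payoffTilde G (μ₂ T)) k‖ := by
    refine Summable.of_nonneg_of_le (fun k => by have := freqNorm_nonneg k; positivity)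
      (fun k => ?_) (hG₁.summable.add hG₂.summable)
    rw [← mul_add]
    exact mul_le_mul_of_nonneg_left (norm_sub_le _ _)
      (zero_le_one.trans (one_le_one_add_pow 2 k))
  have hGc : ∀ k, torusCoeff (fun x => payoffTilde G (μ₁ T) x - payoffTilde G (μ₂ T) x) k
      = torusCoeff (payoffTilde G (μ₁ T)) k - torusCoeff (payoffTilde G (μ₂ T)) k :=
    torusCoeff_sub hG₁.1 hG₂.1
  have hsum := hGs.hasSum.add
    ((hU.summable_stSup.hasSum.add hV.1.summable_stSup.hasSum).mul_left (gain T α))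
  have h1 : ‖enc hT α (mildW T H G w₁ μ₁) - enc hT α (mildW T H G w₂ μ₂)‖ ≤
      ∑' k, ((1 + freqNorm k ^ 2) *
          ‖torusCoeff (payoffTilde G (μ₁ T)) k - torusCoeff (payoffTilde G (μ₂ T)) k‖ +
        gain T α * (stSup T α 0
            (fun t x => proj (Upsilon H b w₁ μ₁ t) x - proj (Upsilon H b w₂ μ₂ t) x) k +
          stSup T α 0 (fun t x => (μ₁ t x - μ₂ t x) * b t x) k)) := by
    refine norm_coeffSpace_le (α := α) hT hsum.summable (fun k => ?_) fun t ht k => ?_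
    · have := freqNorm_nonneg k
      have h2 := stSup_nonneg (T := T) (α := α) (j := 0) (fun t x =>
        proj (Upsilon H b w₁ μ₁ t) x - proj (Upsilon H b w₂ μ₂ t) x) k
      have h3 := stSup_nonneg (T := T) (α := α) (j := 0) (fun t x =>
        (μ₁ t x - μ₂ t x) * b t x) k
      positivity
    · rw [cof_sub, cof_enc hT (goodCoeff_mildW hT hα0 hα hH hb hw₁ hμ₁ hG₁) ht,
        cof_enc hT (goodCoeff_mildW hT hα0 hα hH hb hw₂ hμ₂ hG₂) ht, mildW, mildW,
        bwd_sub _ _ _ (continuousOn_coeff_Xi hT hα0 hH hb hw₁ hμ₁ k)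
          (continuousOn_coeff_Xi hT hα0 hH hb hw₂ hμ₂ k) ht]
      refine wt_mul_norm_bwd_le_of_zero hT hα0 hα ?_ _
        (fun s hs => wt_mul_norm_coeff_Xi_sub_le hT hα0 hH hb hw₁ hw₂ hμ₁ hμ₂ hs k) ht
      rintro rfl s hs
      rw [torusCoeff_Xi_eq_ham hH hb hw₁ hμ₁ hs, torusCoeff_Xi_eq_ham hH hb hw₂ hμ₂ hs,
        if_pos rfl, if_pos rfl, sub_zero]
  refine h1.trans ?_
  rw [hsum.tsum_eq, hU.tsum_stSup, hV.1.tsum_stSup]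
  have hGb := bNorm_eq (j := 2) (f := fun x => payoffTilde G (μ₁ T) x - payoffTilde G (μ₂ T) x)
    (by simpa only [hGc] using hGs)
  simp only [hGc] at hGb
  rw [← hGb]
  have hGb' := hG.trans (mul_le_mul_of_nonneg_left (hdμ.bNorm_le hT hα0 hTm) hc)
  have hUb := (hL w₁ w₂ μ₁ μ₂ hw₁ hw₂ hμ₁ hμ₂ n₁ n₂ n₃ n₄).2.trans
    (mul_le_mul_of_nonneg_left (pairDist_le hT hα0 hw₁ hw₂) hε)
  exact add_le_add hGb' (mul_le_mul_of_nonneg_left (add_le_add hUb hV.2) hg.le)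

end

/-! ### Recovering means, and differentiation in time. -/

section

variable {n : ℕ} {T α : ℝ} {H : ℝ → Euc n → Euc n → ℝ → ℝ} {G : (Euc n → ℝ) → Euc n → ℝ}
  {b : ℝ → Euc n → ℝ} {w μ u m : ℝ → Euc n → ℝ} {j : ℕ}

/-! ### Means and constants -/

lemma memB_of_proj {f : Euc n → ℝ} (hf : MemB j (proj f)) : MemB j f := by
  have hc := continuous_of_proj hf.1
  refine memB_of_summable hc (fun i x => ?_) ?_
  · have := hf.2.1 i x
    simp only [proj] at this
    linarith
  · refine Summable.of_nonneg_of_le (fun k => by have := freqNorm_nonneg k; positivity)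
      (fun k => ?_) (hf.summable.add
        (hasSum_ite_eq (0 : Fin n → ℤ) ((1 + (0 : ℝ) ^ j) * ‖torusCoeff f 0‖)).summable)
    rw [torusCoeff_proj hc]
    split_ifs with hk
    · subst hk; simp [freqNorm_zero]
    · simp

/-- Only the zero mode has to be added, and a continuous mean is bounded on [0, T]. -/
lemma MemST.of_proj (hT : 0 < T) (hα : 0 ≤ α) {f : ℝ → Euc n → ℝ}
    (hf : MemST T α j (fun t => MFG.proj (f t)))
    (hm : ContinuousOn (fun t => mean (f t)) (Icc 0 T)) : MemST T α j f := by
  have hB : ∀ t ∈ Icc 0 T, MemB j (f t) := fun t ht => memB_of_proj (hf.1 t ht)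
  obtain ⟨C, hC⟩ := isCompact_Icc.exists_bound_of_continuousOn
    (((continuous_wt (α := α) (j := j) hT (0 : Fin n → ℤ)).continuousOn).mul hm)
  have hk0 : ∀ t ∈ Icc 0 T, ∀ k, k ≠ 0 → torusCoeff (f t) k = torusCoeff (MFG.proj (f t)) k :=
    fun t ht k hk => by rw [torusCoeff_proj (hB t ht).1, if_neg hk]
  refine memST_of_coeff (M := fun k => stSup T α j (fun t => MFG.proj (f t)) k
    + if k = 0 then C else 0) hT hα (fun t ht => (hB t ht).1) (fun t ht => (hB t ht).2.1)
    (fun k => ?_) (hf.summable_stSup.add (hasSum_ite_eq _ _).summable) fun t ht k => ?_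
  · by_cases hk : k = 0
    · subst hk
      simp only [torusCoeff_zero_eq_mean]
      exact Complex.continuous_ofReal.comp_continuousOn hm
    · exact (hf.continuousOn_coeff k).congr fun t ht => hk0 t ht k hk
  · by_cases hk : k = 0
    · subst hk
      have : ‖wt T α j t 0 * mean (f t)‖ ≤ C := hC t ht
      rw [norm_mul, Real.norm_of_nonneg (wt_pos _ _).le] at this
      rw [if_pos rfl, torusCoeff_zero_eq_mean, Complex.norm_real]
      linarith [stSup_nonneg (T := T) (α := α) (j := j) (fun t => MFG.proj (f t)) 0]
    · rw [if_neg hk, add_zero, hk0 t ht k hk]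
      exact hf.coeff_le ht k

lemma mean_add_const {f : Euc n → ℝ} (hf : Continuous f) (a : ℝ) :
    mean (fun x => f x + a) = mean f + a := by
  have h := torusCoeff_add hf (continuous_const (y := a)) 0
  rw [torusCoeff_zero_eq_mean, torusCoeff_zero_eq_mean, torusCoeff_const, if_pos rfl] at h
  exact_mod_cast h

lemma proj_add_const {f : Euc n → ℝ} (hf : Continuous f) (a : ℝ) :
    proj (fun x => f x + a) = proj f := by
  ext x
  rw [proj, proj, mean_add_const hf]
  ring

lemma memST_add_const (hT : 0 < T) (hα : 0 ≤ α) {f : ℝ → Euc n → ℝ} (hf : MemST T α j f)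
    {a : ℝ → ℝ} (ha : ContinuousOn a (Icc 0 T)) : MemST T α j (fun t x => f t x + a t) := by
  refine MemST.of_proj hT hα ((hf.proj hT hα).1.congr hT hα fun t ht =>
    (proj_add_const (hf.continuous ht) (a t)).symm) ?_
  refine ContinuousOn.congr (f := fun t => mean (f t) + a t) ?_
    fun t ht => mean_add_const (hf.continuous ht) (a t)
  refine ContinuousOn.add ?_ ha
  have := Complex.continuous_re.comp_continuousOn (hf.continuousOn_coeff 0)
  simpa only [Function.comp_def, torusCoeff_zero_eq_mean, ofReal_re] using this

lemma spaceGrad_proj (t : ℝ) (x : Euc n) : spaceGrad (fun t => proj (u t)) t x = spaceGrad u t x := by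
  ext i
  simp only [spaceGrad, gradient_apply_eq]
  have : proj (u t) = fun x => u t x - mean (u t) := rfl
  rw [this, fderiv_sub_const]

/-! ### The Hamiltonian as an element of `𝓑_α⁰` -/

lemma continuousOn_spaceGrad (hT : 0 < T) (hα : 0 ≤ α) (hw : MemST T α 2 w) :
    ContinuousOn (fun p : ℝ × Euc n => spaceGrad w p.1 p.2) (Icc 0 T ×ˢ univ) := by
  have h : ContinuousOn (fun (p : ℝ × Euc n) (i : Fin n) => spaceGrad w p.1 p.2 i)
      (Icc 0 T ×ˢ univ) :=
    continuousOn_pi.2 fun i => (MemST.spaceGrad hT hα hw i).1.continuousOn_uncurry hT hα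
  exact (PiLp.continuous_toLp 2 _).comp_continuousOn h

lemma continuousOn_ham (hT : 0 < T) (hα : 0 ≤ α) (hH : IsHamiltonian T H) (hw : MemST T α 2 w)
    (hμ : MemST T α 2 μ) :
    ContinuousOn (fun p : ℝ × Euc n => ham H w μ p.1 p.2) (Icc 0 T ×ˢ univ) := by
  refine hH.continuousOn.comp (f := fun p : ℝ × Euc n =>
    (p.1, p.2, spaceGrad w p.1 p.2, μ p.1 p.2 + mBar n)) ?_ fun p hp => ⟨hp.1, mem_univ _⟩
  exact continuousOn_fst.prodMk (continuousOn_snd.prodMk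
    ((continuousOn_spaceGrad hT hα hw).prodMk
      ((hμ.continuousOn_uncurry hT hα).add continuousOn_const)))

lemma continuousOn_mean {f : ℝ → Euc n → ℝ}
    (hf : ContinuousOn (fun p : ℝ × Euc n => f p.1 p.2) (Icc 0 T ×ˢ univ)) :
    ContinuousOn (fun t => mean (f t)) (Icc 0 T) := by
  obtain ⟨C, hC⟩ := (isCompact_Icc.prod (isCompact_closedBall (0 : Euc n)
    (Real.sqrt (∑ _i : Fin n, (2 * Real.pi) ^ 2)))).exists_bound_of_continuousOn
    (hf.mono (prod_mono_right (subset_univ _)))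
  refine continuousOn_const.mul (continuousOn_of_dominated (bound := fun _ => C)
    (fun t ht => ?_) (fun t ht => ?_) ?_ ?_)
  · refine Continuous.aestronglyMeasurable ?_
    rw [← continuousOn_univ]
    exact hf.comp (f := fun x : Euc n => (t, x)) (Continuous.continuousOn (by fun_prop))
      fun x _ => ⟨ht, mem_univ _⟩
  · filter_upwards [ae_restrict_mem measurableSet_cell] with x hx
    exact hC (t, x) ⟨ht, cell_subset_closedBall hx⟩
  · exact integrableOn_cell continuous_const
  · refine Eventually.of_forall fun x => ?_
    exact hf.comp (f := fun t : ℝ => (t, x)) (Continuous.continuousOn (by fun_prop))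
      fun t ht => ⟨ht, mem_univ _⟩

lemma memST_Xi (hT : 0 < T) (hα : 0 ≤ α) (hH : HamiltonianCondition T α H b)
    (hb : MemST T α 0 b) (hw : MemST T α 2 w) (hμ : MemST T α 2 μ) : MemST T α 0 (Xi H w μ) := by
  have hU := (hH.2.2.1 w μ hw hμ).2
  refine memST_of_coeff hT hα (fun t ht => continuous_Xi hH hb hw hμ ht) (fun t ht i x => ?_)
    (fun k => continuousOn_coeff_Xi hT hα hH hb hw hμ k)
    (hU.summable_stSup.add (hμ.mul hT hα zero_le_one hb).1.summable_stSup)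
    fun t ht k => wt_mul_norm_coeff_Xi_le hT hα hH hb hw hμ ht k
  have h1 := hU.periodic ht i x
  have h2 := hb.periodic ht i x
  have h3 := hμ.periodic ht i x
  simp only [proj, Upsilon, h2, h3] at h1
  linarith

/-- The conditions on Υ control the mean-free part; the mean is continuous in time by the joint
continuity of H. -/
lemma memST_ham (hT : 0 < T) (hα : 0 ≤ α) (hI : IsHamiltonian T H)
    (hH : HamiltonianCondition T α H b) (hb : MemST T α 0 b) (hw : MemST T α 2 w)
    (hμ : MemST T α 2 μ) : MemST T α 0 (ham H w μ) :=
  (memST_Xi hT hα hH hb hw hμ).of_proj hT hα (continuousOn_mean (continuousOn_ham hT hα hI hw hμ))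

/-! ### Differentiation in time -/

lemma hasDerivAt_trig_time {c c' : ℝ → (Fin n → ℤ) → ℂ} {M : (Fin n → ℤ) → ℝ} (hM : Summable M)
    (hc : ∀ t ∈ Ioo 0 T, Summable fun k => ‖c t k‖)
    (hd : ∀ t ∈ Ioo 0 T, ∀ k, HasDerivAt (fun s => c s k) (c' t k) t)
    (hb : ∀ t ∈ Ioo 0 T, ∀ k, ‖c' t k‖ ≤ M k) {t : ℝ} (ht : t ∈ Ioo 0 T) (x : Euc n) :
    HasDerivAt (fun s => trig (c s) x) (trig (c' t) x) t := by
  have h := hasDerivAt_tsum_of_isPreconnected hM isOpen_Ioo isPreconnected_Ioo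
    (fun k s hs => (hd s hs k).mul_const (chi k x))
    (fun k s hs => by rw [norm_mul, norm_chi, mul_one]; exact hb s hs k) ht
    (summable_chi (hc t ht) x) ht
  exact (Complex.reCLM.hasFDerivAt.comp_hasDerivAt t h)

/-- A strong solution has time derivatives only pointwise in x. Once the equation writes them as
trigonometric series with majorant M, they are bounded by ∑ M uniformly, and differentiation under
the integral is legitimate. Hermitian symmetry ensures that the coefficients of `trig (c' t)` are
those of c' itself. -/
lemma hasDerivAt_torusCoeff {f : ℝ → Euc n → ℝ} {c' : ℝ → (Fin n → ℤ) → ℂ}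
    {M : (Fin n → ℤ) → ℝ} (hM : Summable M) (hf : ∀ t ∈ Ioo 0 T, Continuous (f t))
    (hd : ∀ t ∈ Ioo 0 T, ∀ x, HasDerivAt (fun s => f s x) (trig (c' t) x) t)
    (hb : ∀ t ∈ Ioo 0 T, ∀ k, ‖c' t k‖ ≤ M k) (hh : ∀ t ∈ Ioo 0 T, herm (c' t) = c' t) {t : ℝ}
    (ht : t ∈ Ioo 0 T) (k : Fin n → ℤ) :
    HasDerivAt (fun s => torusCoeff (f s) k) (c' t k) t := by
  have hs : ∀ t ∈ Ioo 0 T, Summable fun k => ‖c' t k‖ := fun t ht =>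
    Summable.of_nonneg_of_le (fun _ => norm_nonneg _) (hb t ht) hM
  have hk : torusCoeff (trig (c' t)) k = c' t k := by
    rw [torusCoeff_trig (hs t ht), hh t ht]
  rw [← hk]
  simp only [torusCoeff_def]
  refine HasDerivAt.const_mul _ ?_
  have hft : Continuous (f t) := hf t ht
  have hct : Continuous (trig (c' t)) := continuous_trig (hs t ht)
  refine (hasDerivAt_integral_of_dominated_loc_of_deriv_le (μ := volume.restrict (cell n))
    (F := fun s x => (f s x : ℂ) * chi (-k) x) (F' := fun s x => (trig (c' s) x : ℂ) * chi (-k) x)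
    (bound := fun _ => ∑' k, M k) (isOpen_Ioo.mem_nhds ht) ?_ ?_ ?_ ?_ ?_ ?_).2
  · filter_upwards [isOpen_Ioo.mem_nhds ht] with s hs'
    have hfs : Continuous (f s) := hf s hs'
    exact Continuous.aestronglyMeasurable (by fun_prop)
  · exact integrableOn_cell (by fun_prop)
  · exact Continuous.aestronglyMeasurable (by fun_prop)
  · refine Eventually.of_forall fun x s hs' => ?_
    rw [norm_mul, norm_chi, mul_one, Complex.norm_real]
    exact (abs_trig_le (hs s hs') x).trans ((hs s hs').tsum_le_tsum (hb s hs') hM)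
  · exact integrableOn_cell continuous_const
  · exact Eventually.of_forall fun x s hs' => ((hd s hs' x).ofReal_comp).mul_const _

/-! ### The right-hand sides as trigonometric series -/

lemma herm_add {c d : (Fin n → ℤ) → ℂ} (hc : herm c = c) (hd : herm d = d) :
    herm (fun k => c k + d k) = fun k => c k + d k := by
  ext k
  have h1 := congrFun hc k
  have h2 := congrFun hd k
  simp only [herm, map_add] at *
  linear_combination h1 + h2

lemma herm_neg {c : (Fin n → ℤ) → ℂ} (hc : herm c = c) :
    herm (fun k => -c k) = fun k => -c k := by
  ext k
  have h1 := congrFun hc k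
  simp only [herm, map_neg] at *
  linear_combination -h1

lemma herm_freq_sq_mul {c : (Fin n → ℤ) → ℂ} (hc : herm c = c) :
    herm (fun k => (freqNorm k : ℂ) ^ 2 * c k) = fun k => (freqNorm k : ℂ) ^ 2 * c k := by
  ext k
  have h1 := congrFun hc k
  simp only [herm, map_mul, map_pow, Complex.conj_ofReal, freqNorm_neg] at *
  linear_combination (freqNorm k : ℂ) ^ 2 * h1

lemma herm_fluxCoeff (t : ℝ) : herm (fluxCoeff H w μ t) = fluxCoeff H w μ t := by
  ext k
  have h1 : ∀ i, herm (dcoef i (torusCoeff (flux H w μ i t))) k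
      = dcoef i (torusCoeff (flux H w μ i t)) k := fun i =>
    congrFun (herm_dcoef (herm_torusCoeff _) i) k
  have h2 : ∀ l, fluxCoeff H w μ t l = -∑ i, dcoef i (torusCoeff (flux H w μ i t)) l := fun _ => rfl
  simp only [herm] at h1
  simp only [herm, h2, map_neg, map_sum]
  rw [← neg_add, ← Finset.sum_add_distrib, neg_div, Finset.sum_div]
  simp only [h1]

lemma norm_freq_sq_mul_le (c : (Fin n → ℤ) → ℂ) (k : Fin n → ℤ) :
    ‖(freqNorm k : ℂ) ^ 2 * c k‖ ≤ (1 + freqNorm k ^ 2) * ‖c k‖ := by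
  rw [norm_mul, norm_pow, Complex.norm_real, Real.norm_of_nonneg (freqNorm_nonneg k)]
  gcongr
  linarith

lemma trig_neg (c : (Fin n → ℤ) → ℂ) (x : Euc n) : trig (fun k => -c k) x = -trig c x := by
  simp only [trig, neg_mul, tsum_neg, Complex.neg_re]

lemma summable_freq_sq_mul {c : (Fin n → ℤ) → ℂ}
    (hc : Summable fun k => (1 + freqNorm k ^ 2) * ‖c k‖) :
    Summable fun k => ‖(freqNorm k : ℂ) ^ 2 * c k‖ :=
  Summable.of_nonneg_of_le (fun _ => norm_nonneg _) (norm_freq_sq_mul_le c) hc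

lemma summable_fluxCoeff (hT : 0 < T) (hα : 0 ≤ α) (hH : HamiltonianCondition T α H b)
    (hw : MemST T α 2 w) (hμ : MemST T α 2 μ) {t : ℝ} (ht : t ∈ Icc 0 T) :
    Summable fun k => ‖fluxCoeff H w μ t k‖ := by
  refine Summable.of_nonneg_of_le (fun _ => norm_nonneg _) (fun k =>
    (le_mul_of_one_le_left (norm_nonneg _) (one_le_wt hT hα ht k)).trans
      (wt_mul_norm_fluxCoeff_le hT hα hH hw hμ ht k)) ?_
  exact summable_sum fun i _ => (memST_flux hT hα hH hw hμ i).summable_stSup.mul_left 2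

lemma trig_fluxCoeff (hT : 0 < T) (hα : 0 ≤ α) (hH : HamiltonianCondition T α H b)
    (hw : MemST T α 2 w) (hμ : MemST T α 2 μ) {t : ℝ} (ht : t ∈ Icc 0 T) (x : Euc n)
    {F : Euc n → Euc n} (hF : ∀ y i, F y i = flux H w μ i t y) :
    trig (fluxCoeff H w μ t) x = -divergence F x := by
  have hs : ∀ i, Summable fun k => (1 + freqNorm k ^ 1) * ‖torusCoeff (flux H w μ i t) k‖ :=
    fun i => (memST_flux hT hα hH hw hμ i).summable_coeff ht
  have h1 : ∀ i, HasSum (fun k => (dcoef i (torusCoeff (flux H w μ i t)) k * chi k x).re)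
      (fderiv ℝ (fun y => F y i) x (EuclideanSpace.single i 1)) := by
    intro i
    have h2 : (fun y => F y i) = trig (torusCoeff (flux H w μ i t)) := by
      rw [(memST_flux hT hα hH hw hμ i).trig_eq ht]
      exact funext fun y => hF y i
    rw [h2, fderiv_trig_single (hs i)]
    exact hasSum_trig (summable_of_weight (j := 0) (summable_dcoef i (hs i))) x
  have h3 := (hasSum_sum (s := Finset.univ) fun i _ => h1 i).neg
  rw [divergence, ← h3.tsum_eq,
    ← (hasSum_trig (summable_fluxCoeff hT hα hH hw hμ ht) x).tsum_eq]
  refine tsum_congr fun k => ?_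
  rw [← Complex.re_sum, ← Finset.sum_mul, ← Complex.neg_re, ← neg_mul]
  rfl

/-- The time derivative of the Fourier coefficients of the density. -/
def rateM (H : ℝ → Euc n → Euc n → ℝ → ℝ) (w μ : ℝ → Euc n → ℝ) (c : (Fin n → ℤ) → ℂ) (t : ℝ)
    (k : Fin n → ℤ) : ℂ := -((freqNorm k : ℂ) ^ 2 * c k) + fluxCoeff H w μ t k

/-- The time derivative of the Fourier coefficients in a backward heat equation. -/
def rateB (f : ℝ → Euc n → ℝ) (c : (Fin n → ℤ) → ℂ) (t : ℝ) (k : Fin n → ℤ) : ℂ :=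
  (freqNorm k : ℂ) ^ 2 * c k - torusCoeff (f t) k

lemma trig_rateM (hT : 0 < T) (hα : 0 ≤ α) (hH : HamiltonianCondition T α H b)
    (hw : MemST T α 2 w) (hμ : MemST T α 2 μ) {c : (Fin n → ℤ) → ℂ}
    (hc : Summable fun k => (1 + freqNorm k ^ 2) * ‖c k‖) {t : ℝ} (ht : t ∈ Icc 0 T) (x : Euc n)
    {F : Euc n → Euc n} (hF : ∀ y i, F y i = flux H w μ i t y) :
    trig (rateM H w μ c t) x = Laplacian.laplacian (trig c) x - divergence F x := by
  rw [laplacian_trig hc, sub_eq_add_neg, ← trig_fluxCoeff hT hα hH hw hμ ht x hF, ← trig_add]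
  · rfl
  · simpa only [norm_neg] using summable_freq_sq_mul hc
  · exact summable_fluxCoeff hT hα hH hw hμ ht

lemma trig_rateB {f : ℝ → Euc n → ℝ} (hf : MemST T α j f) {c : (Fin n → ℤ) → ℂ}
    (hc : Summable fun k => (1 + freqNorm k ^ 2) * ‖c k‖) {t : ℝ} (ht : t ∈ Icc 0 T) (x : Euc n) :
    trig (rateB f c t) x = -Laplacian.laplacian (trig c) x - f t x := by
  conv_rhs => rw [← hf.trig_eq ht]
  rw [laplacian_trig hc, trig_neg, neg_neg, ← trig_sub (summable_freq_sq_mul hc)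
    (summable_of_weight (hf.summable_coeff ht))]
  rfl

lemma norm_rateM_le (hT : 0 < T) (hα : 0 ≤ α) (hH : HamiltonianCondition T α H b)
    (hw : MemST T α 2 w) (hμ : MemST T α 2 μ) {c : ℝ → (Fin n → ℤ) → ℂ} {M : (Fin n → ℤ) → ℝ}
    (hM : Summable M) (hb : ∀ t ∈ Icc 0 T, ∀ k, wt T α 2 t k * ‖c t k‖ ≤ M k) :
    ∃ N : (Fin n → ℤ) → ℝ, Summable N ∧
      ∀ t ∈ Icc 0 T, ∀ k, ‖rateM H w μ (c t) t k‖ ≤ N k := by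
  refine ⟨_, hM.add (summable_sum (s := Finset.univ) fun i _ =>
    (memST_flux hT hα hH hw hμ i).summable_stSup.mul_left 2), fun t ht k => ?_⟩
  refine (norm_add_le _ _).trans (add_le_add ?_ ?_)
  · rw [norm_neg]
    refine (norm_freq_sq_mul_le _ k).trans (le_trans ?_ (hb t ht k))
    exact mul_le_mul_of_nonneg_right (one_add_pow_le_wt hT hα ht k) (norm_nonneg _)
  · exact (le_mul_of_one_le_left (norm_nonneg _) (one_le_wt hT hα ht k)).trans
      (wt_mul_norm_fluxCoeff_le hT hα hH hw hμ ht k)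

lemma norm_rateB_le (hT : 0 < T) (hα : 0 ≤ α) {f : ℝ → Euc n → ℝ} (hf : MemST T α j f)
    {c : ℝ → (Fin n → ℤ) → ℂ} {M : (Fin n → ℤ) → ℝ}
    (hM : Summable M) (hb : ∀ t ∈ Icc 0 T, ∀ k, wt T α 2 t k * ‖c t k‖ ≤ M k) :
    ∃ N : (Fin n → ℤ) → ℝ, Summable N ∧ ∀ t ∈ Icc 0 T, ∀ k, ‖rateB f (c t) t k‖ ≤ N k := by
  refine ⟨_, hM.add hf.summable_stSup, fun t ht k => ?_⟩
  refine (norm_sub_le _ _).trans (add_le_add ?_ (hf.norm_coeff_le hT hα ht k))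
  refine (norm_freq_sq_mul_le _ k).trans (le_trans ?_ (hb t ht k))
  exact mul_le_mul_of_nonneg_right (one_add_pow_le_wt hT hα ht k) (norm_nonneg _)

end

/-! ### Choice of constants and well-posedness of the mild problem. -/

section

variable {n : ℕ} {T α : ℝ} {H : ℝ → Euc n → Euc n → ℝ → ℝ} {G : (Euc n → ℝ) → Euc n → ℝ}
  {b : ℝ → Euc n → ℝ} {w μ w' μ' u m u' m' : ℝ → Euc n → ℝ}

/-! ### Mild solutions -/

lemma mul_div_add_one_le {C S η : ℝ} (hC : 0 ≤ C) (hS : C ≤ S) (hη : 0 ≤ η) :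
    C * (η / (S + 1)) ≤ η := by
  rw [← mul_div_assoc, div_le_iff₀ (by linarith)]
  nlinarith

/-- The order of choices matters: K does not depend on the radius, so η, then ε, then ρ can be
adapted to it. -/
lemma exists_mild_estimates (hT : 0 < T) (hα0 : 0 ≤ α) (hα : α < T / 2)
    (hG : PayoffCondition G) (hb : MemST T α 0 b) (hH : HamiltonianCondition T α H b)
    {r₀ : ℝ} (hr₀ : 0 < r₀) :
    ∃ K η ρ : ℝ, 1 ≤ K ∧ η * (16 * K) = 1 ∧ 0 < ρ ∧ ρ ≤ r₀ ∧
      (∀ μ : ℝ → Euc n → ℝ, MemST T α 2 μ → stNorm T α 2 μ ≤ ρ →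
        MemB 2 (payoffTilde G (μ T))) ∧
      (∀ μ₀ : Euc n → ℝ, MemB 2 μ₀ → ∀ a a' c c' : CoeffSpace n T,
        ‖a‖ ≤ ρ → ‖a'‖ ≤ ρ → ‖c‖ ≤ ρ → ‖c'‖ ≤ ρ →
        ‖enc hT α (mildM H μ₀ (dec hT α a) (dec hT α c))
            - enc hT α (mildM H μ₀ (dec hT α a') (dec hT α c'))‖
          ≤ η * (‖a - a'‖ + ‖c - c'‖)) ∧
      ∀ a a' c c' : CoeffSpace n T, ‖a‖ ≤ ρ → ‖a'‖ ≤ ρ → ‖c‖ ≤ ρ → ‖c'‖ ≤ ρ →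
        ‖enc hT α (mildW T H G (dec hT α a) (dec hT α c))
            - enc hT α (mildW T H G (dec hT α a') (dec hT α c'))‖
          ≤ K * ‖c - c'‖ + η * (‖a - a'‖ + ‖c - c'‖) := by
  obtain ⟨-, c₀, hc₀, εG, hεG, hG1, hG2⟩ := hG
  have hTm : T ∈ Icc 0 T := right_mem_Icc.2 hT.le
  have hg := gain_pos hT hα
  have hm := mBar_pos n
  have hβ : 0 ≤ stNorm T α 0 b := stNorm_nonneg b
  have hn : (0 : ℝ) ≤ n := Nat.cast_nonneg n
  set C₁ : ℝ := gain T α * (n * (2 * ((6 + mBar n) * (2 * n + 1)))) with hC₁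
  set C₂ : ℝ := gain T α * (2 * n + 1) with hC₂
  have hC₁0 : 0 ≤ C₁ := by positivity
  have hC₂0 : 0 ≤ C₂ := by positivity
  -- c₀ comes from the payoff, the last term from bμ, and the 1 secures K ≥ 1.
  set K : ℝ := 1 + c₀ + 2 * gain T α * stNorm T α 0 b with hK
  have hK0 : 0 < K := by positivity
  set η : ℝ := 1 / (16 * K) with hη
  have hη0 : 0 < η := by positivity
  set ε : ℝ := η / (C₁ + C₂ + 1) with hε
  have hε0 : 0 < ε := by positivity
  have hε₁ : C₁ * ε ≤ η := mul_div_add_one_le hC₁0 (by linarith) hη0.le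
  have hε₂ : C₂ * ε ≤ η := mul_div_add_one_le hC₂0 (by linarith) hη0.le
  obtain ⟨δ, hδ, hL⟩ := hH.exists_localBound hε0
  -- δ makes the Lipschitz constants small, 1 serves the flux estimate, εG / 2 keeps μ(T) strictly
  -- inside the domain of the payoff estimate, and r₀ is imposed from outside.
  set ρ : ℝ := min (min δ 1) (min (εG / 2) r₀) with hρ
  have hρ0 : 0 < ρ := by positivity
  have hρδ : ρ ≤ δ := (min_le_left _ _).trans (min_le_left _ _)
  have hρ1 : ρ ≤ 1 := (min_le_left _ _).trans (min_le_right _ _)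
  have hρG : ρ < εG := ((min_le_right _ _).trans (min_le_left _ _)).trans_lt (half_lt_self hεG)
  have hbG : ∀ μ : ℝ → Euc n → ℝ, MemST T α 2 μ → stNorm T α 2 μ ≤ ρ → bNorm 2 (μ T) < εG :=
    fun μ h1 h2 => ((h1.bNorm_le hT hα0 hTm).trans h2).trans_lt hρG
  have hD : ∀ a a' c c' : CoeffSpace n T, stDist T α 2 (dec hT α a) (dec hT α a')
      + stDist T α 2 (dec hT α c) (dec hT α c') ≤ ‖a - a'‖ + ‖c - c'‖ := fun a a' c c' =>
    add_le_add (stDist_dec_le hT hα0 a a') (stDist_dec_le hT hα0 c c')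
  have hM : ∀ a : CoeffSpace n T, MemST T α 2 (dec hT α a) := fun a => (memST_dec hT hα0 a).1
  have hN : ∀ a : CoeffSpace n T, ‖a‖ ≤ ρ → stNorm T α 2 (dec hT α a) ≤ ρ := fun a h =>
    (memST_dec hT hα0 a).2.trans h
  refine ⟨K, η, ρ, ?_, ?_, hρ0, (min_le_right _ _).trans (min_le_right _ _),
    fun μ h1 h2 => hG1 _ (h1.1 T hTm) (hbG μ h1 h2), ?_, ?_⟩
  · have : 0 ≤ 2 * gain T α * stNorm T α 0 b := by positivity
    linarith
  · rw [hη]; field_simp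
  · intro μ₀ hμ₀ a a' c c' ha ha' hc hc'
    have h := norm_enc_mildM_sub_le hT hα0 hα hH hε0.le hρ0.le hρ1 (hL ρ hρδ) (hM a) (hM a')
      (hM c) (hM c') (hN a ha) (hN a' ha') (hN c hc) (hN c' hc') hμ₀
    set D := stDist T α 2 (dec hT α a) (dec hT α a') + stDist T α 2 (dec hT α c) (dec hT α c')
    refine h.trans (le_trans (le_of_eq ?_) (mul_le_mul hε₁ (hD a a' c c')
      (add_nonneg (stNorm_nonneg _) (stNorm_nonneg _)) hη0.le))
    rw [hC₁]; ring
  · intro a a' c c' ha ha' hc hc'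
    have h := norm_enc_mildW_sub_le (G := G) hT hα0 hα hH hb hε0.le (hL ρ hρδ) (hM a) (hM a')
      (hM c) (hM c') (hN a ha) (hN a' ha') (hN c hc) (hN c' hc')
      (hG1 _ ((hM c).1 T hTm) (hbG _ (hM c) (hN c hc)))
      (hG1 _ ((hM c').1 T hTm) (hbG _ (hM c') (hN c' hc'))) hc₀.le
      (hG2 _ _ ((hM c).1 T hTm) ((hM c').1 T hTm) (hbG _ (hM c) (hN c hc))
        (hbG _ (hM c') (hN c' hc')))
    have h1 := mul_le_mul hε₂ (hD a a' c c')
      (add_nonneg (stNorm_nonneg _) (stNorm_nonneg _)) hη0.le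
    have h2 : (c₀ + 2 * gain T α * stNorm T α 0 b) * stDist T α 2 (dec hT α c) (dec hT α c')
        ≤ K * ‖c - c'‖ :=
      mul_le_mul (by linarith) (stDist_dec_le hT hα0 c c') (stNorm_nonneg _) hK0.le
    refine h.trans (le_trans (le_of_eq ?_) (add_le_add h2 h1))
    rw [hC₂]; ring

lemma fluxCoeff_congr {t : ℝ} (hw : w t = w' t) (hμ : μ t = μ' t) :
    fluxCoeff H w μ t = fluxCoeff H w' μ' t := by
  have h : ∀ i, flux H w μ i t = flux H w' μ' i t := fun i => by
    ext x; simp only [flux, Theta, spaceGrad, hw, hμ]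
  ext k
  simp only [fluxCoeff, h]

lemma Xi_congr {t : ℝ} (hw : w t = w' t) (hμ : μ t = μ' t) : Xi H w μ t = Xi H w' μ' t := by
  simp only [Xi, spaceGrad, hw, hμ]

lemma mildM_congr (hw : ∀ t ∈ Icc 0 T, w t = w' t) (hμ : ∀ t ∈ Icc 0 T, μ t = μ' t)
    (μ₀ : Euc n → ℝ) {t : ℝ} (ht : t ∈ Icc 0 T) : mildM H μ₀ w μ t = mildM H μ₀ w' μ' t :=
  funext fun _ => fwd_congr _ _ (fun s hs => by rw [fluxCoeff_congr (hw s hs) (hμ s hs)]) ht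

lemma mildW_congr (hT : 0 < T) (hw : ∀ t ∈ Icc 0 T, w t = w' t)
    (hμ : ∀ t ∈ Icc 0 T, μ t = μ' t) {t : ℝ} (ht : t ∈ Icc 0 T) :
    mildW T H G w μ t = mildW T H G w' μ' t := by
  ext k
  rw [mildW, mildW, hμ T (right_mem_Icc.2 hT.le)]
  exact bwd_congr _ _ (fun s hs => by rw [Xi_congr (hw s hs) (hμ s hs)]) ht

lemma norm_enc_mildM_zero_le (hT : 0 < T) (hα0 : 0 ≤ α) (hα : α < T / 2)
    (hH : HamiltonianCondition T α H b) {μ₀ : Euc n → ℝ} (hμ₀ : MemB 2 μ₀) :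
    ‖enc hT α (mildM H μ₀ 0 0)‖ ≤ bNorm 2 μ₀ := by
  have h0 : MemST T α 2 (0 : ℝ → Euc n → ℝ) := memST_zero hT hα0
  rw [bNorm_eq hμ₀.summable]
  refine norm_coeffSpace_le (α := α) hT hμ₀.summable
    (fun k => by have := freqNorm_nonneg k; positivity) fun t ht k => ?_
  rw [cof_enc hT (goodCoeff_mildM hT hα0 hα hH h0 h0 hμ₀) ht]
  have hz : ∀ s ∈ Icc 0 T, fluxCoeff H 0 0 s k = 0 := fun s hs => by
    have : ∀ i, flux H (0 : ℝ → Euc n → ℝ) 0 i s = fun _ => 0 := fun i => by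
      ext x
      simp [flux, hH.2.1 s hs x]
    simp [fluxCoeff, this, torusCoeff_zero]
  have h := wt_mul_norm_fwd_le_of_zero (k := k) (M := 0) hT hα0 hα (fun _ => hz) (torusCoeff μ₀ k)
    (fun s hs => by rw [hz s hs, norm_zero, mul_zero]) ht
  rwa [mul_zero, add_zero] at h

lemma enc_mildW_zero (hT : 0 < T) (hα0 : 0 ≤ α) (hα : α < T / 2) (hG : payoffTilde G 0 = 0)
    (hb : MemST T α 0 b) (hH : HamiltonianCondition T α H b)
    (hG' : MemB 2 (payoffTilde G ((0 : ℝ → Euc n → ℝ) T))) : enc hT α (mildW T H G 0 0) = 0 := by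
  have h0 : MemST T α 2 (0 : ℝ → Euc n → ℝ) := memST_zero hT hα0
  refine coeff_ext (α := α) hT fun t ht k => ?_
  have hz : ∀ s ∈ Icc 0 T, torusCoeff (Xi H 0 0 s) k = 0 := fun s hs => by
    have : Xi H (0 : ℝ → Euc n → ℝ) 0 s = fun _ => 0 := by
      ext x
      simpa [Upsilon] using hH.1 s hs x
    rw [this, torusCoeff_zero]
  rw [cof_zero, cof_enc hT (goodCoeff_mildW hT hα0 hα hH hb h0 h0 hG') ht, mildW, Pi.zero_apply,
    hG, bwd_congr _ _ hz ht]
  have : torusCoeff (0 : Euc n → ℝ) k = 0 := torusCoeff_zero k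
  simp [bwd, fwd, this]

/-- Well-posedness of the mild formulation near the origin. -/
lemma exists_unique_mild (hT : 0 < T) (hα0 : 0 ≤ α) (hα : α < T / 2)
    (hG : PayoffCondition G) (hb : MemST T α 0 b) (hH : HamiltonianCondition T α H b)
    {r₀ : ℝ} (hr₀ : 0 < r₀) :
    ∃ δ > 0, ∃ ρ > 0, ρ ≤ r₀ ∧ ∀ μ₀ : Euc n → ℝ, MemB 2 μ₀ → bNorm 2 μ₀ < δ →
      (∃ w μ : ℝ → Euc n → ℝ, MemST T α 2 w ∧ MemST T α 2 μ ∧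
        stNorm T α 2 w ≤ ρ / 4 ∧ stNorm T α 2 μ ≤ ρ / 4 ∧ MemB 2 (payoffTilde G (μ T)) ∧
        ∀ t ∈ Icc 0 T, w t = trig (mildW T H G w μ t) ∧ μ t = trig (mildM H μ₀ w μ t)) ∧
      ∀ w μ w' μ' : ℝ → Euc n → ℝ, MemST T α 2 w → MemST T α 2 μ → MemST T α 2 w' →
        MemST T α 2 μ' → stNorm T α 2 w ≤ ρ → stNorm T α 2 μ ≤ ρ → stNorm T α 2 w' ≤ ρ →
        stNorm T α 2 μ' ≤ ρ →
        (∀ t ∈ Icc 0 T, torusCoeff (w t) = mildW T H G w μ t ∧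
          torusCoeff (μ t) = mildM H μ₀ w μ t) →
        (∀ t ∈ Icc 0 T, torusCoeff (w' t) = mildW T H G w' μ' t ∧
          torusCoeff (μ' t) = mildM H μ₀ w' μ' t) →
        ∀ t ∈ Icc 0 T, w t = w' t ∧ μ t = μ' t := by
  obtain ⟨K, η, ρ, hK, hη, hρ, hρr, hGm, hA, hB⟩ :=
    exists_mild_estimates hT hα0 hα hG hb hH hr₀
  have hK0 : 0 < K := by linarith
  -- At the origin A is the free heat flow of μ₀, of norm at most `bNorm 2 μ₀`; ρ / (8K) is what the
  -- fixed point lemma allows for it.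
  refine ⟨ρ / (8 * K), by positivity, ρ, hρ, hρr, fun μ₀ hμ₀ hδ => ⟨?_, ?_⟩⟩
  · obtain ⟨a, c, ha, hc, h1, h2⟩ := exists_fixedPoint_pair
      (A := fun a c => enc hT α (mildM H μ₀ (dec hT α a) (dec hT α c)))
      (B := fun a c => enc hT α (mildW T H G (dec hT α a) (dec hT α c)))
      hρ hK hη (hA μ₀ hμ₀) hB
      (by
        simp only [dec_zero]
        exact (norm_enc_mildM_zero_le hT hα0 hα hH hμ₀).trans hδ.le)
      (by
        simp only [dec_zero]
        refine enc_mildW_zero hT hα0 hα hG.1 hb hH (hGm 0 (memST_zero hT hα0) ?_)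
        exact (stNorm_zero (n := n) (j := 2)).trans_le hρ.le)
    have hMa := memST_dec hT hα0 a
    have hMc := memST_dec hT hα0 c
    have hP := hGm _ hMc.1 (by linarith [hMc.2])
    -- The fixed point is a coefficient family not known to be Hermitian, so its equations are
    -- asserted only after `trig`.
    refine ⟨dec hT α a, dec hT α c, hMa.1, hMc.1, hMa.2.trans ha, hMc.2.trans hc, hP,
      fun t ht => ⟨?_, ?_⟩⟩
    · rw [← funext fun k => cof_enc hT (goodCoeff_mildW hT hα0 hα hH hb hMa.1 hMc.1 hP) ht k, h2]
      rfl
    · rw [← funext fun k => cof_enc hT (goodCoeff_mildM hT hα0 hα hH hMa.1 hMc.1 hμ₀) ht k, h1]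
      rfl
  -- The encoded coefficients of a mild pair form a fixed point, so uniqueness in the coefficient
  -- space applies.
  · have key : ∀ w μ : ℝ → Euc n → ℝ, MemST T α 2 w → MemST T α 2 μ → stNorm T α 2 μ ≤ ρ →
        (∀ t ∈ Icc 0 T, torusCoeff (w t) = mildW T H G w μ t ∧
          torusCoeff (μ t) = mildM H μ₀ w μ t) →
        enc hT α (mildM H μ₀ (dec hT α (enc hT α fun t => torusCoeff (w t)))
          (dec hT α (enc hT α fun t => torusCoeff (μ t)))) = enc hT α (fun t => torusCoeff (μ t)) ∧
        enc hT α (mildW T H G (dec hT α (enc hT α fun t => torusCoeff (w t)))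
          (dec hT α (enc hT α fun t => torusCoeff (μ t)))) = enc hT α fun t => torusCoeff (w t) := by
      intro w μ hw hμ nμ h
      have ew : ∀ t ∈ Icc 0 T, dec hT α (enc hT α fun t => torusCoeff (w t)) t = w t :=
        fun t ht => dec_enc_torusCoeff hT hw ht
      have eμ : ∀ t ∈ Icc 0 T, dec hT α (enc hT α fun t => torusCoeff (μ t)) t = μ t :=
        fun t ht => dec_enc_torusCoeff hT hμ ht
      have hMa := (memST_dec hT hα0 (enc hT α fun t => torusCoeff (w t))).1
      have hMc := (memST_dec hT hα0 (enc hT α fun t => torusCoeff (μ t))).1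
      have hP : MemB 2 (payoffTilde G
          (dec hT α (enc hT α fun t => torusCoeff (μ t)) T)) := by
        rw [eμ T (right_mem_Icc.2 hT.le)]
        exact hGm μ hμ nμ
      constructor
      · refine coeff_ext (α := α) hT fun t ht k => ?_
        rw [cof_enc hT (goodCoeff_mildM hT hα0 hα hH hMa hMc hμ₀) ht, cof_enc hT hμ.goodCoeff ht,
          mildM_congr ew eμ μ₀ ht, (h t ht).2]
      · refine coeff_ext (α := α) hT fun t ht k => ?_
        rw [cof_enc hT (goodCoeff_mildW hT hα0 hα hH hb hMa hMc hP) ht, cof_enc hT hw.goodCoeff ht,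
          mildW_congr hT ew eμ ht, (h t ht).1]
    intro w μ w' μ' hw hμ hw' hμ' nw nμ nw' nμ' h h' t ht
    have k := key w μ hw hμ nμ h
    have k' := key w' μ' hw' hμ' nμ' h'
    have e := fixedPoint_pair_unique
      (A := fun a c => enc hT α (mildM H μ₀ (dec hT α a) (dec hT α c)))
      (B := fun a c => enc hT α (mildW T H G (dec hT α a) (dec hT α c))) hK hη (hA μ₀ hμ₀) hB
      ((norm_enc_torusCoeff_le hT hw).trans nw) ((norm_enc_torusCoeff_le hT hw').trans nw')
      ((norm_enc_torusCoeff_le hT hμ).trans nμ) ((norm_enc_torusCoeff_le hT hμ').trans nμ')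
      k.1 k.2 k'.1 k'.2
    refine ⟨?_, ?_⟩
    · rw [← dec_enc_torusCoeff hT hw ht, e.1, dec_enc_torusCoeff hT hw' ht]
    · rw [← dec_enc_torusCoeff hT hμ ht, e.2, dec_enc_torusCoeff hT hμ' ht]

end

/-! ### Equivalence of strong and mild solutions. -/

section

variable {n : ℕ} {T α : ℝ} {H : ℝ → Euc n → Euc n → ℝ → ℝ} {G : (Euc n → ℝ) → Euc n → ℝ}
  {b : ℝ → Euc n → ℝ} {w μ u m : ℝ → Euc n → ℝ} {m₀ : Euc n → ℝ}

/-! ### Strong solutions are mild solutions -/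

lemma memST_const (hT : 0 < T) (hα : 0 ≤ α) {j : ℕ} (a : ℝ) :
    MemST T α j (fun (_ : ℝ) (_ : Euc n) => a) := by
  simpa using memST_add_const hT hα (memST_zero hT hα) (a := fun _ => a) continuousOn_const

/-- Taking Fourier coefficients of both equations gives one scalar linear equation per mode, with
Duhamel's formula as its only solution. The nonlinear terms see u through Du, so u may be replaced
there by ℙu. -/
lemma IsStrongSolution.coeff_eq (hT : 0 < T) (hα : 0 ≤ α) (hI : IsHamiltonian T H)
    (hH : HamiltonianCondition T α H b) (hb : MemST T α 0 b)
    (h : IsStrongSolution T α H G m₀ u m) {t : ℝ} (ht : t ∈ Icc 0 T) (k : Fin n → ℤ) :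
    torusCoeff (u t) k = bwd T (freqNorm k ^ 2) (torusCoeff (G (m T)) k)
      (fun s => torusCoeff (ham H (fun t => proj (u t)) (fun t x => m t x - mBar n) s) k) t ∧
    torusCoeff (fun x => m t x - mBar n) k = mildM H (fun x => m₀ x - mBar n)
      (fun t => proj (u t)) (fun t x => m t x - mBar n) t k := by
  set w : ℝ → Euc n → ℝ := fun t => proj (u t) with hw
  set μ : ℝ → Euc n → ℝ := fun t x => m t x - mBar n with hμ
  have hMw : MemST T α 2 w := (h.mem_u.proj hT hα).1
  have hMμ : MemST T α 2 μ := (h.mem_m.sub hT hα (memST_const hT hα _)).1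
  have hham := memST_ham hT hα hI hH hb hMw hMμ
  have hIo : ∀ {s}, s ∈ Ioo 0 T → s ∈ Icc 0 T := fun hs => Ioo_subset_Icc_self hs
  have hhamEq : ∀ s x, ham H w μ s x = H s x (MFG.spaceGrad u s x) (m s x) := fun s x => by
    simp only [ham, hw, hμ, spaceGrad_proj, sub_add_cancel]
  constructor
  · obtain ⟨N, hN, hNb⟩ := norm_rateB_le hT hα hham h.mem_u.summable_stSup
      fun t ht k => h.mem_u.coeff_le ht k
    have hd : ∀ s ∈ Ioo 0 T, HasDerivAt (fun s => torusCoeff (u s) k)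
        (rateB (ham H w μ) (torusCoeff (u s)) s k) s := by
      intro s hs
      refine hasDerivAt_torusCoeff (c' := fun s => rateB (ham H w μ) (torusCoeff (u s)) s) hN
        (fun t ht => h.mem_u.continuous (hIo ht)) (fun t ht x => ?_)
        (fun t ht k => hNb t (hIo ht) k) (fun t ht => ?_) hs k
      · obtain ⟨ut, h1, h2⟩ := h.eq_u t ht x
        rw [trig_rateB hham (h.mem_u.summable_coeff (hIo ht)) (hIo ht), h.mem_u.trig_eq (hIo ht),
          hhamEq]
        convert h1 using 1
        linarith
      · exact herm_add (herm_freq_sq_mul (herm_torusCoeff _)) (herm_neg (herm_torusCoeff _))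
    have e := eq_bwd_of_hasDerivAt (κ := freqNorm k ^ 2) (hham.continuousOn_coeff k)
      (h.mem_u.continuousOn_coeff k) (fun s hs => by
        have := hd s hs
        rw [rateB] at this
        exact_mod_cast this) ht
    rw [e, funext h.terminal]
  · obtain ⟨N, hN, hNb⟩ := norm_rateM_le hT hα hH hMw hMμ hMμ.summable_stSup
      fun t ht k => hMμ.coeff_le ht k
    have hd : ∀ s ∈ Ioo 0 T, HasDerivAt (fun s => torusCoeff (μ s) k)
        (rateM H w μ (torusCoeff (μ s)) s k) s := by
      intro s hs
      refine hasDerivAt_torusCoeff (c' := fun s => rateM H w μ (torusCoeff (μ s)) s) hN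
        (fun t ht => hMμ.continuous (hIo ht)) (fun t ht x => ?_)
        (fun t ht k => hNb t (hIo ht) k) (fun t ht => ?_) hs k
      · obtain ⟨mt, h1, h2⟩ := h.eq_m t ht x
        have hF : ∀ y i, (m t y • gradP H t y (MFG.spaceGrad u t y) (m t y)) i
            = flux H w μ i t y := fun y i => by
          simp only [flux, Theta, hw, hμ, spaceGrad_proj, sub_add_cancel, PiLp.smul_apply,
            smul_eq_mul]
        have hlap : Laplacian.laplacian (μ t) x = Laplacian.laplacian (m t) x := by
          have e : m t = μ t + fun _ => mBar n := by ext y; simp [hμ]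
          have hc : ContDiff ℝ 2 (μ t) := (h.smooth_m t ht).sub contDiff_const
          rw [e, hc.contDiffAt.laplacian_add contDiff_const.contDiffAt,
            InnerProductSpace.laplacian_const]
          simp
        rw [trig_rateM hT hα hH hMw hMμ (hMμ.summable_coeff (hIo ht)) (hIo ht) x hF,
          hMμ.trig_eq (hIo ht), hlap]
        refine (h1.sub_const (mBar n)).congr_deriv ?_
        linear_combination h2
      · exact herm_add (herm_neg (herm_freq_sq_mul (herm_torusCoeff _))) (herm_fluxCoeff t)
    have e := eq_fwd_of_hasDerivAt (κ := freqNorm k ^ 2)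
      (continuousOn_fluxCoeff hT hα hH hMw hMμ k) (hMμ.continuousOn_coeff k) (fun s hs => by
        have := hd s hs
        rw [rateM] at this
        exact_mod_cast this) ht
    have h0 : μ 0 = fun x => m₀ x - mBar n := by ext x; simp only [hμ, h.initial]
    rw [mildM, ← h0]
    exact e

lemma IsStrongSolution.isMild (hT : 0 < T) (hα : 0 ≤ α) (hI : IsHamiltonian T H)
    (hH : HamiltonianCondition T α H b) (hb : MemST T α 0 b)
    (h : IsStrongSolution T α H G m₀ u m) {t : ℝ} (ht : t ∈ Icc 0 T) :
    torusCoeff (proj (u t)) = mildW T H G (fun t => proj (u t)) (fun t x => m t x - mBar n) t ∧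
    torusCoeff (fun x => m t x - mBar n) = mildM H (fun x => m₀ x - mBar n)
      (fun t => proj (u t)) (fun t x => m t x - mBar n) t := by
  have hMw : MemST T α 2 (fun t => proj (u t)) := (h.mem_u.proj hT hα).1
  have hMμ : MemST T α 2 (fun t x => m t x - mBar n) :=
    (h.mem_m.sub hT hα (memST_const hT hα _)).1
  refine ⟨?_, funext fun k => (h.coeff_eq hT hα hI hH hb ht k).2⟩
  ext k
  have hTm : T ∈ Icc 0 T := right_mem_Icc.2 hT.le
  -- G is an arbitrary operator; continuity of this value is inherited from u(T) through the
  -- terminal condition.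
  have hGT : Continuous (G (m T)) := by
    rw [← funext h.terminal]
    exact h.mem_u.continuous hTm
  have hp : payoffTilde G (fun x => m T x - mBar n) = proj (G (m T)) := by
    simp only [payoffTilde, sub_add_cancel]
  rw [torusCoeff_proj (h.mem_u.continuous ht), mildW, hp, torusCoeff_proj hGT]
  split_ifs with hk
  · rw [bwd_congr _ _ (g := fun _ => 0) (fun s hs => by
      rw [torusCoeff_Xi_eq_ham hH hb hMw hMμ hs, if_pos hk]) ht]
    simp [bwd, fwd]
  · rw [(h.coeff_eq hT hα hI hH hb ht k).1]
    exact bwd_congr _ _ (fun s hs => by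
      rw [torusCoeff_Xi_eq_ham hH hb hMw hMμ hs, if_neg hk]) ht

/-! ### Mild solutions are strong solutions -/

/-- The spatial mean of the value function. -/
def meanPart (T : ℝ) (H : ℝ → Euc n → Euc n → ℝ → ℝ) (G : (Euc n → ℝ) → Euc n → ℝ)
    (w μ : ℝ → Euc n → ℝ) (t : ℝ) : ℝ :=
  (bwd T 0 (mean (G fun x => μ T x + mBar n) : ℂ) (fun s => (mean (ham H w μ s) : ℂ)) t).re

lemma continuousOn_mean_ham (hT : 0 < T) (hα : 0 ≤ α) (hI : IsHamiltonian T H)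
    (hw : MemST T α 2 w) (hμ : MemST T α 2 μ) :
    ContinuousOn (fun s => (mean (ham H w μ s) : ℂ)) (Icc 0 T) :=
  Complex.continuous_ofReal.comp_continuousOn (continuousOn_mean (continuousOn_ham hT hα hI hw hμ))

lemma hasDerivAt_meanPart (hT : 0 < T) (hα : 0 ≤ α) (hI : IsHamiltonian T H)
    (hw : MemST T α 2 w) (hμ : MemST T α 2 μ) {t : ℝ} (ht : t ∈ Ioo 0 T) :
    HasDerivAt (meanPart T H G w μ) (-mean (ham H w μ t)) t := by
  have h := hasDerivAt_bwd 0 (mean (G fun x => μ T x + mBar n) : ℂ)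
    (continuousOn_mean_ham hT hα hI hw hμ) ht
  have h2 := Complex.reCLM.hasFDerivAt.comp_hasDerivAt t h
  refine h2.congr_deriv ?_
  simp

lemma laplacian_add_const {f : Euc n → ℝ} (hf : ContDiff ℝ 2 f) (a : ℝ) (x : Euc n) :
    Laplacian.laplacian (fun y => f y + a) x = Laplacian.laplacian f x := by
  have := hf.contDiffAt.laplacian_add (x := x) (contDiff_const (c := a)).contDiffAt
  rw [InnerProductSpace.laplacian_const, Pi.zero_apply, add_zero] at this
  exact this

lemma spaceGrad_add_const (a : ℝ → ℝ) (t : ℝ) (x : Euc n) :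
    spaceGrad (fun t x => w t x + a t) t x = spaceGrad w t x := by
  ext i
  simp only [spaceGrad, gradient_apply_eq, fderiv_add_const]

lemma fwd_zero_eq_zero {κ : ℝ} {f : ℝ → ℂ} (hf : ∀ t ∈ Icc 0 T, f t = 0) {t : ℝ}
    (ht : t ∈ Icc 0 T) : fwd κ 0 f t = 0 := by
  rw [fwd_congr κ 0 hf ht]
  simp [fwd]

lemma mean_trig_eq_zero {c : (Fin n → ℤ) → ℂ} (hc : Summable fun k => ‖c k‖) (h0 : c 0 = 0) :
    mean (trig c) = 0 := by
  have h := torusCoeff_trig hc 0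
  rw [torusCoeff_zero_eq_mean, herm, neg_zero, h0] at h
  simpa using h

lemma GoodCoeff.summable (hT : 0 < T) (hα : 0 ≤ α) {c : ℝ → (Fin n → ℤ) → ℂ}
    (hc : GoodCoeff T α c) {t : ℝ} (ht : t ∈ Icc 0 T) :
    Summable fun k => (1 + freqNorm k ^ 2) * ‖c t k‖ := by
  obtain ⟨-, M, hM, hb⟩ := hc
  refine Summable.of_nonneg_of_le (fun k => by have := freqNorm_nonneg k; positivity)
    (fun k => ?_) hM
  exact (mul_le_mul_of_nonneg_right (one_add_pow_le_wt hT hα ht k) (norm_nonneg _)).trans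
    (hb t ht k)

/-- Datum and forcing have no zero mode. This identifies w with ℙu once the mean part has been
added. -/
lemma mean_mild_eq_zero (hT : 0 < T) (hα0 : 0 ≤ α) (hα : α < T / 2)
    (hH : HamiltonianCondition T α H b) (hb : MemST T α 0 b) (hw : MemST T α 2 w)
    (hμ : MemST T α 2 μ) (hP : MemB 2 (payoffTilde G (μ T))) {t : ℝ} (ht : t ∈ Icc 0 T) :
    mean (trig (mildW T H G w μ t)) = 0 := by
  refine mean_trig_eq_zero (summable_of_weight
    ((goodCoeff_mildW hT hα0 hα hH hb hw hμ hP).summable hT hα0 ht)) ?_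
  have h0 : torusCoeff (payoffTilde G (μ T)) 0 = 0 := by
    rw [payoffTilde, torusCoeff_proj (continuous_of_proj hP.1), if_pos rfl]
  rw [mildW, h0]
  exact fwd_zero_eq_zero (fun s hs => by
    have := torusCoeff_Xi_eq_ham hH hb hw hμ (sub_mem_Icc_self hs) 0
    rwa [if_pos rfl] at this) (sub_mem_Icc_self ht)

/-- The majorants allow termwise differentiation in time. The equation for w lacks the mean of the
Hamiltonian, which is minus the derivative of `meanPart`, so the sum solves the full equation;
likewise at time T the mean part restores the mean of the payoff. -/
lemma isStrongSolution_of_mild (hT : 0 < T) (hα0 : 0 ≤ α) (hα : α < T / 2)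
    (hI : IsHamiltonian T H) (hH : HamiltonianCondition T α H b) (hb : MemST T α 0 b)
    (hm₀ : MemB 2 (fun x => m₀ x - mBar n)) (hw : MemST T α 2 w) (hμ : MemST T α 2 μ)
    (hP : MemB 2 (payoffTilde G (μ T)))
    (h : ∀ t ∈ Icc 0 T, w t = trig (mildW T H G w μ t) ∧
      μ t = trig (mildM H (fun x => m₀ x - mBar n) w μ t)) :
    IsStrongSolution T α H G m₀ (fun t x => w t x + meanPart T H G w μ t)
      (fun t x => μ t x + mBar n) := by
  have hgW := goodCoeff_mildW hT hα0 hα hH hb hw hμ hP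
  have hgM := goodCoeff_mildM hT hα0 hα hH hw hμ hm₀
  have hIo : ∀ {s}, s ∈ Ioo 0 T → s ∈ Icc 0 T := fun hs => Ioo_subset_Icc_self hs
  have hTm : T ∈ Icc 0 T := right_mem_Icc.2 hT.le
  have h0m : 0 ∈ Icc 0 T := left_mem_Icc.2 hT.le
  have hXi := memST_Xi hT hα0 hH hb hw hμ
  have hsw : ∀ t ∈ Ioo 0 T, ContDiff ℝ 2 (w t) := fun t ht => by
    rw [(h t (hIo ht)).1]
    exact contDiff_two_trig (hgW.summable hT hα0 (hIo ht))
  have hsm : ∀ t ∈ Ioo 0 T, ContDiff ℝ 2 (μ t) := fun t ht => by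
    rw [(h t (hIo ht)).2]
    exact contDiff_two_trig (hgM.summable hT hα0 (hIo ht))
  have hF : ∀ t y i, (((μ t y + mBar n) • gradP H t y
      (spaceGrad (fun t x => w t x + meanPart T H G w μ t) t y) (μ t y + mBar n) : Euc n)) i
      = flux H w μ i t y := fun t y i => by
    rw [spaceGrad_add_const, PiLp.smul_apply, smul_eq_mul]
    rfl
  refine ⟨?_, memST_add_const hT hα0 hμ continuousOn_const, fun t ht =>
    (hsw t ht).add contDiff_const, fun t ht => (hsm t ht).add contDiff_const, fun t ht => ?_,
    fun t ht x => ?_, fun t ht x => ?_, fun x => ?_, fun x => ?_⟩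
  · refine memST_add_const hT hα0 hw ?_
    exact Complex.continuous_re.comp_continuousOn
      (continuousOn_bwd hT _ _ (continuousOn_mean_ham hT hα0 hI hw hμ))
  · refine differentiable_euclidean.2 fun i => ?_
    simp only [hF]
    exact (memST_flux hT hα0 hH hw hμ i).differentiable (hIo ht)
  · obtain ⟨M, hM, hMb⟩ := hgW.2
    obtain ⟨N, hN, hNb⟩ := norm_rateB_le hT hα0 hXi hM hMb
    have hd : HasDerivAt (fun s => trig (mildW T H G w μ s) x)
        (trig (rateB (Xi H w μ) (mildW T H G w μ t) t) x) t :=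
      hasDerivAt_trig_time (c' := fun t => rateB (Xi H w μ) (mildW T H G w μ t) t) hN
        (fun s hs => summable_of_weight (hgW.summable hT hα0 (hIo hs)))
        (fun s hs k => by
          have := hasDerivAt_bwd (freqNorm k ^ 2) (torusCoeff (payoffTilde G (μ T)) k)
            (continuousOn_coeff_Xi hT hα0 hH hb hw hμ k) hs
          rw [ofReal_pow] at this
          exact this)
        (fun s hs k => hNb s (hIo hs) k) ht x
    rw [trig_rateB hXi (hgW.summable hT hα0 (hIo ht)) (hIo ht), ← (h t (hIo ht)).1] at hd
    have hd' : HasDerivAt (fun s => w s x) (-Laplacian.laplacian (w t) x - Xi H w μ t x) t := by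
      refine hd.congr_of_eventuallyEq ?_
      filter_upwards [isOpen_Ioo.mem_nhds ht] with s hs
      rw [← (h s (hIo hs)).1]
    refine ⟨_, hd'.add (hasDerivAt_meanPart hT hα0 hI hw hμ ht), ?_⟩
    rw [laplacian_add_const (hsw t ht), spaceGrad_add_const]
    have e : Xi H w μ t x = H t x (spaceGrad w t x) (μ t x + mBar n) - mean (ham H w μ t) := rfl
    rw [e]
    ring
  · obtain ⟨M, hM, hMb⟩ := hgM.2
    obtain ⟨N, hN, hNb⟩ := norm_rateM_le hT hα0 hH hw hμ hM hMb
    have hd : HasDerivAt (fun s => trig (mildM H (fun x => m₀ x - mBar n) w μ s) x)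
        (trig (rateM H w μ (mildM H (fun x => m₀ x - mBar n) w μ t) t) x) t :=
      hasDerivAt_trig_time
        (c' := fun t => rateM H w μ (mildM H (fun x => m₀ x - mBar n) w μ t) t) hN
        (fun s hs => summable_of_weight (hgM.summable hT hα0 (hIo hs)))
        (fun s hs k => by
          have := hasDerivAt_fwd (freqNorm k ^ 2) (torusCoeff (fun x => m₀ x - mBar n) k)
            (continuousOn_fluxCoeff hT hα0 hH hw hμ k) hs
          rw [ofReal_pow] at this
          exact this)
        (fun s hs k => hNb s (hIo hs) k) ht x
    rw [trig_rateM hT hα0 hH hw hμ (hgM.summable hT hα0 (hIo ht)) (hIo ht) x (hF t),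
      ← (h t (hIo ht)).2] at hd
    have hd' := hd.congr_of_eventuallyEq (f₁ := fun s => μ s x) (by
      filter_upwards [isOpen_Ioo.mem_nhds ht] with s hs
      rw [← (h s (hIo hs)).2])
    refine ⟨_, hd'.add_const (mBar n), ?_⟩
    rw [laplacian_add_const (hsm t ht)]
    ring
  · have e : mildM H (fun x => m₀ x - mBar n) w μ 0 = torusCoeff fun x => m₀ x - mBar n :=
      funext fun k => fwd_zero _ _ _
    rw [(h 0 h0m).2, e, hm₀.trig_eq]
    ring
  · have e : mildW T H G w μ T = torusCoeff (payoffTilde G (μ T)) :=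
      funext fun k => bwd_self _ _ _
    rw [(h T hTm).1, e, hP.trig_eq, meanPart, bwd_self, ofReal_re]
    simp only [payoffTilde, proj]
    ring

end

/-! ### Analyticity, conservation of mass, and uniqueness of the mean. -/

section

variable {n : ℕ} {T α : ℝ} {H : ℝ → Euc n → Euc n → ℝ → ℝ} {G : (Euc n → ℝ) → Euc n → ℝ}
  {b : ℝ → Euc n → ℝ} {w μ u m u' m' : ℝ → Euc n → ℝ} {m₀ : Euc n → ℝ}

/-! ### Properties of strong solutions -/

lemma weight_pos (hT : 0 < T) (hα : 0 < α) {t : ℝ} (ht : t ∈ Ioo 0 T) : 0 < weight T α t := by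
  obtain ⟨h0, h1⟩ := ht
  unfold weight
  split_ifs
  · positivity
  · have : 2 * α - 2 * α * t / T = 2 * α * (T - t) / T := by field_simp
    rw [this]
    have := sub_pos.2 h1
    positivity

/-- Inside (0, T) the coefficients decay like e^{-β(t)|k|} with β(t) > 0. -/
lemma MemST.analyticOnNhd (hT : 0 < T) (hα : 0 < α) {j : ℕ} {f : ℝ → Euc n → ℝ}
    (hf : MemST T α j f) {t : ℝ} (ht : t ∈ Ioo 0 T) : AnalyticOnNhd ℝ (f t) univ := by
  have ht' := Ioo_subset_Icc_self ht
  rw [← hf.trig_eq ht']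
  refine analyticOnNhd_trig (weight_pos hT hα ht) (Summable.of_nonneg_of_le
    (fun k => by positivity) (fun k => le_trans ?_ (hf.coeff_le ht' k)) hf.summable_stSup)
  refine mul_le_mul_of_nonneg_right ?_ (norm_nonneg _)
  exact le_mul_of_one_le_left (Real.exp_pos _).le (one_le_one_add_pow j k)

lemma mean_eq_mBar_iff {f : Euc n → ℝ} : mean f = mBar n ↔ ∫ x in cell n, f x = 1 := by
  rw [mean, mul_eq_left₀ (mBar_pos n).ne']

/-- The zero mode of the density equation has neither decay nor forcing, so it keeps its initial
value. -/
lemma IsStrongSolution.mean_eq (hT : 0 < T) (hα : 0 ≤ α) (hI : IsHamiltonian T H)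
    (hH : HamiltonianCondition T α H b) (hb : MemST T α 0 b)
    (h : IsStrongSolution T α H G m₀ u m) (h0 : mean m₀ = mBar n) {t : ℝ} (ht : t ∈ Icc 0 T) :
    mean (m t) = mBar n := by
  have hc : ∀ s ∈ Icc 0 T, torusCoeff (fun x => m s x - mBar n) 0 = (mean (m s) - mBar n : ℝ) :=
    fun s hs => by
      rw [torusCoeff_zero_eq_mean]
      exact congrArg _ (mean_add_const (h.mem_m.continuous hs) (-mBar n))
  have h1 := (h.coeff_eq hT hα hI hH hb ht 0).2
  have h2 := hc 0 (left_mem_Icc.2 hT.le)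
  simp only [h.initial] at h2
  rw [funext h.initial, h0, sub_self, ofReal_zero] at h2
  rw [hc t ht, mildM, h2, fwd_zero_eq_zero (fun s _ => fluxCoeff_zero_freq s) ht] at h1
  exact sub_eq_zero.1 (by exact_mod_cast h1)

/-- InBall does not see the mean of u, but Duhamel's formula determines all of u from ℙu, m and the
terminal value G(m(T)). -/
lemma IsStrongSolution.eq_of_proj_eq (hT : 0 < T) (hα : 0 ≤ α) (hI : IsHamiltonian T H)
    (hH : HamiltonianCondition T α H b) (hb : MemST T α 0 b)
    (h : IsStrongSolution T α H G m₀ u m) (h' : IsStrongSolution T α H G m₀ u' m')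
    (hw : ∀ t ∈ Icc 0 T, proj (u' t) = proj (u t)) (hm : ∀ t ∈ Icc 0 T, m' t = m t) {t : ℝ}
    (ht : t ∈ Icc 0 T) : u' t = u t := by
  rw [← h.mem_u.trig_eq ht, ← h'.mem_u.trig_eq ht]
  congr 1
  ext k
  rw [(h.coeff_eq hT hα hI hH hb ht k).1, (h'.coeff_eq hT hα hI hH hb ht k).1,
    hm T (right_mem_Icc.2 hT.le)]
  refine bwd_congr _ _ (fun s hs => ?_) ht
  congr 1
  ext x
  simp only [ham, spaceGrad, hw s hs, hm s hs]

end

end MFG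

end

/-! ### The main theorem. -/

theorem theorem1 (n : ℕ) (hn : 1 ≤ n) (T α : ℝ) (hT : 0 < T) (hα : α ∈ Set.Ioo 0 (T / 2))
    (H : ℝ → MFG.Euc n → MFG.Euc n → ℝ → ℝ) (hH : MFG.IsHamiltonian T H)
    (G : (MFG.Euc n → ℝ) → MFG.Euc n → ℝ) (b : ℝ → MFG.Euc n → ℝ)
    (hG : MFG.PayoffCondition G)
    (hb : MFG.MemST T α 0 b)
    (hHb : MFG.HamiltonianCondition T α H b) :
    ∃ δ > 0, ∃ r > 0, ∀ m₀ : MFG.Euc n → ℝ, MFG.IsProbabilityDensity m₀ →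
      MFG.MemB 2 (fun x => m₀ x - MFG.mBar n) →
      MFG.bNorm 2 (fun x => m₀ x - MFG.mBar n) < δ →
      ∃ u m : ℝ → MFG.Euc n → ℝ,
        MFG.IsStrongSolution T α H G m₀ u m ∧ MFG.InBall T α r u m ∧
        (∀ u' m' : ℝ → MFG.Euc n → ℝ,
          MFG.IsStrongSolution T α H G m₀ u' m' → MFG.InBall T α r u' m' →
          ∀ t ∈ Set.Icc 0 T, ∀ x, u' t x = u t x ∧ m' t x = m t x) ∧
        ∀ t ∈ Set.Ioo 0 T,
          AnalyticOnNhd ℝ (u t) Set.univ ∧ AnalyticOnNhd ℝ (m t) Set.univ ∧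
          MFG.IsProbabilityDensity (m t) := by
  obtain ⟨hα0, hα⟩ := hα
  obtain ⟨δ, hδ, ρ, hρ, hρm, hmild⟩ :=
    -- The radius is capped by m̄ so that |μ| < m̄ and the density stays positive.
    MFG.exists_unique_mild hT hα0.le hα hG hb hHb (MFG.mBar_pos n)
  refine ⟨δ, hδ, ρ, hρ, fun m₀ hm₀ hB hlt => ?_⟩
  obtain ⟨⟨w, μ, hw, hμ, nw, nμ, hP, h⟩, huniq⟩ := hmild _ hB hlt
  have hS := MFG.isStrongSolution_of_mild hT hα0.le hα hH hHb hb hB hw hμ hP h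
  set u : ℝ → MFG.Euc n → ℝ := fun t x => w t x + MFG.meanPart T H G w μ t with hu
  set m : ℝ → MFG.Euc n → ℝ := fun t x => μ t x + MFG.mBar n with hm
  have hmean : MFG.mean m₀ = MFG.mBar n := MFG.mean_eq_mBar_iff.2 hm₀.2.2
  have hproj : ∀ t ∈ Set.Icc 0 T, MFG.proj (u t) = w t := fun t ht => by
    have h0 : MFG.mean (w t) = 0 := by
      rw [(h t ht).1]
      exact MFG.mean_mild_eq_zero hT hα0.le hα hHb hb hw hμ hP ht
    rw [hu, MFG.proj_add_const (hw.continuous ht)]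
    ext x
    rw [MFG.proj, h0, sub_zero]
  have hsub : (fun t x => m t x - MFG.mBar n) = μ := by
    ext t x
    simp only [hm, add_sub_cancel_right]
  have hball : MFG.InBall T α ρ u m := by
    rw [MFG.InBall, MFG.stNorm_congr hproj, hsub]
    -- Each norm is at most ρ/4, so the solution lies strictly inside the ball of radius ρ on which
    -- uniqueness holds.
    linarith
  refine ⟨u, m, hS, hball, fun u' m' hS' hball' => ?_, fun t ht => ⟨?_, ?_, ?_⟩⟩
  · have hle : ∀ {v q : ℝ → MFG.Euc n → ℝ}, MFG.InBall T α ρ v q →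
        MFG.stNorm T α 2 (fun t => MFG.proj (v t)) ≤ ρ ∧
        MFG.stNorm T α 2 (fun t x => q t x - MFG.mBar n) ≤ ρ := fun {v q} hvq => by
      have h1 := MFG.stNorm_nonneg (T := T) (α := α) (j := 2) (fun t => MFG.proj (v t))
      have h2 := MFG.stNorm_nonneg (T := T) (α := α) (j := 2) (fun t x => q t x - MFG.mBar n)
      unfold MFG.InBall at hvq
      constructor <;> linarith
    have hmem : ∀ {v q : ℝ → MFG.Euc n → ℝ}, MFG.IsStrongSolution T α H G m₀ v q →
        MFG.MemST T α 2 (fun t => MFG.proj (v t)) ∧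
        MFG.MemST T α 2 (fun t x => q t x - MFG.mBar n) := fun hvq =>
      ⟨(hvq.mem_u.proj hT hα0.le).1,
        (hvq.mem_m.sub hT hα0.le (MFG.memST_const hT hα0.le _)).1⟩
    have key := huniq _ _ _ _ (hmem hS').1 (hmem hS').2 (hmem hS).1 (hmem hS).2
      (hle hball').1 (hle hball').2 (hle hball).1 (hle hball).2
      (fun t ht => hS'.isMild hT hα0.le hH hHb hb ht)
      (fun t ht => hS.isMild hT hα0.le hH hHb hb ht)
    have hmm : ∀ t ∈ Set.Icc 0 T, m' t = m t := fun t ht => by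
      ext x
      exact sub_left_inj.1 (congrFun (key t ht).2 x)
    exact fun t ht x => ⟨congrFun (hS.eq_of_proj_eq hT hα0.le hH hHb hb hS'
      (fun s hs => (key s hs).1) hmm ht) x, congrFun (hmm t ht) x⟩
  · exact hS.mem_u.analyticOnNhd hT hα0 ht
  · exact hS.mem_m.analyticOnNhd hT hα0 ht
  · have ht' := Set.Ioo_subset_Icc_self ht
    refine ⟨hS.mem_m.periodic ht', fun x => ?_,
      MFG.mean_eq_mBar_iff.1 (hS.mean_eq hT hα0.le hH hHb hb hmean ht')⟩
    -- μ ≥ -ρ/4 ≥ -m̄/4, hence m = μ + m̄ > 0.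
    have h1 := (abs_le.1 (hμ.abs_le_stNorm hT hα0.le ht' x)).1
    simp only [hm]
    linarith
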